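/- Let $\mathcal E$ be an NQ symplectic manifold of degree 2 over a smooth (Hausdorff, second countable) manifold $M$: a sheaf $C^\infty(\mathcal E)$ of $\mathbb N$-graded, graded commutative algebras on $M$, locally of the form $C^\infty(\mathcal U)\otimes S(V)$ with $V$ a finite-dimensional vector space graded in positive degrees, together with a symplectic form $\omega$ of degree 2 and a vector field $Q_{\mathcal E}$ of degree 1 with $Q_{\mathcal E}^2=0$ and $L_{Q_{\mathcal E}}\omega=0$. Let $E\to M$ be the vector bundle with $\Gamma(E^*)=C^\infty_1(\mathcal E)$ (functions of degree 1). Let $\iota$ be a generalized metric, that is, a symplectic involution of $\mathcal E$ which is the identity on $M$; let $V_+\subset E$ be the subbundle fixed by $\iota$, and let $\mathcal V\to\mathcal E$ be the pullback to $\mathcal E$ of $V_+$ placed in degree 1, so that functions on $\mathcal V$ are polynomials in the fibre coordinates $\xi\in\Gamma(V_+^*)$, which have degree 1, with coefficients in $C^\infty(\mathcal E)$. Let $\Gamma(\mathcal V^*)\subset C^\infty(\mathcal V)$ be the functions that are linear along the fibres of $\mathcal V\to\mathcal E$. A connection on $\mathcal V^*$ is a vector field $Q$ of degree 1 on $\mathcal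 V$ which projects to $Q_{\mathcal E}$ and preserves $\Gamma(\mathcal V^*)$. A Courant algebroid connection is an additive map $\nabla\colon\Gamma(V_+)\to\Gamma(E^*\otimes V_+)$ with $\nabla(fu)=f\,\nabla u+(Q_{\mathcal E}f)\otimes u$ for $f\in C^\infty(M)$, $u\in\Gamma(V_+)$. (1) There is a bijection $Q\mapsto\nabla$ between connections on $\mathcal V^*$ and Courant algebroid connections, under which $\nabla$ corresponds to $Q$ if and only if $\nabla$ is dual to the restriction $Q\colon\Gamma(V_+^*)\to\Gamma(E^*\otimes V_+^*)$ of $Q$ to the fibre coordinates, i.e. $$Q_{\mathcal E}\langle u,\xi\rangle=\langle\nabla u,\xi\rangle+\langle u,Q\xi\rangle\in\Gamma(E^*)$$ for all $u\in\Gamma(V_+)$ and all local sections $\xi$ of $V_+^*$. (2) Let $\tau\in\Gamma(\mathcal V^*)$ be the tautological section: it is of degree 2, and its contraction with any section $v$ of $V_+$ is the linear function $\omega(v,\cdot)\in\Gamma(E^*)$, where sections of $E$ are regarded as vector fields of degree $-1$ on $\mathcal E$. Say that $Q$ has invariant torsion if $Q\tau$ is invariant under the involution of $\Gamma(\mathcal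 V^*)$ induced by $\iota$, which acts trivially on the fibre coordinates. If $Q$ and $Q'$ are connections with invariant torsion whose Courant algebroid connections have the same restriction $\Gamma(V_+)\to\Gamma(V_+^*\otimes V_+)$, then $Q=Q'$. -/

import Mathlib

open scoped Manifold ContDiff TensorProduct
open TopologicalSpace

universe u v

noncomputable section

namespace NQ

/-- The ring `C^∞(U)` of smooth functions on an open subset `U` of `M`. -/
abbrev SmoothFn (n : ℕ) {M : Type v} [TopologicalSpace M]
    [ChartedSpace (EuclideanSpace ℝ (Fin n)) M] (U : Opens M) : Type v :=
  C^∞⟮𝓡 n, U; 𝓘(ℝ), ℝ⟯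

/-- Restriction of smooth functions. -/
def resFn (n : ℕ) {M : Type v} [TopologicalSpace M]
    [ChartedSpace (EuclideanSpace ℝ (Fin n)) M] {U W : Opens M} (h : W ≤ U) :
    SmoothFn n U →+* SmoothFn n W :=
  ContMDiffMap.restrictRingHom (𝓡 n) 𝓘(ℝ) ℝ h

/-- Exponents of the ordered monomials in generators of degrees `d`: generators of odd degree occur
at most once. -/
def Expo {r : ℕ} (d : Fin r → ℕ) : Type :=
  {m : Fin r → ℕ // ∀ i, Odd (d i) → m i ≤ 1}

/-- The ordered monomial `y₁ ^ m₁ ⋯ yᵣ ^ mᵣ`. -/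
def monomial {A : Type u} [Ring A] {r : ℕ} (y : Fin r → A) (m : Fin r → ℕ) : A :=
  (List.ofFn fun i => y i ^ m i).prod

/-- The underlying data of a graded ringed space over the manifold `M`: a presheaf of `ℕ`-graded
algebras over the sheaf of smooth functions. -/
structure GradedPresheaf (n : ℕ) (M : Type v) [TopologicalSpace M]
    [ChartedSpace (EuclideanSpace ℝ (Fin n)) M] where
  O : Opens M → Type u
  [ring : ∀ U, Ring (O U)]
  [algebra : ∀ U, Algebra (SmoothFn n U) (O U)]
  /-- the homogeneous part of each degree -/
  deg : ∀ U, ℕ → Submodule (SmoothFn n U) (O U)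
  [graded : ∀ U, GradedAlgebra (deg U)]
  res : ∀ {U W : Opens M}, W ≤ U → O U →+* O W
  res_self : ∀ (U : Opens M) (a : O U), res (le_refl U) a = a
  res_res : ∀ {U W W' : Opens M} (h : W ≤ U) (h' : W' ≤ W) (a : O U),
    res h' (res h a) = res (h'.trans h) a
  res_algebraMap : ∀ {U W : Opens M} (h : W ≤ U) (f : SmoothFn n U),
    res h (algebraMap (SmoothFn n U) (O U) f) = algebraMap (SmoothFn n W) (O W) (resFn n h f)
  res_mem_deg : ∀ {U W : Opens M} (h : W ≤ U) (k : ℕ) (a : O U), a ∈ deg U k → res h a ∈ deg W k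

attribute [instance] GradedPresheaf.ring GradedPresheaf.algebra GradedPresheaf.graded

/-- `y₁, …, yᵣ` are homogeneous generators of degrees `d₁, …, dᵣ ≥ 1` which identify the sheaf
restricted to `U` with `C^∞ ⊗ S(V)`, where `V` is the graded vector space spanned by the `yᵢ`
and `S(V)` is the free graded commutative algebra on it: over each open `W ⊆ U` the ordered
monomials in the `yᵢ` form a basis over `C^∞(W)`. -/
structure IsCoordinates {n : ℕ} {M : Type v} [TopologicalSpace M]
    [ChartedSpace (EuclideanSpace ℝ (Fin n)) M] (𝓔 : GradedPresheaf.{u, v} n M) (U : Opens M)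
    {r : ℕ} (d : Fin r → ℕ) (y : Fin r → 𝓔.O U) : Prop where
  pos : ∀ i, 1 ≤ d i
  mem : ∀ i, y i ∈ 𝓔.deg U (d i)
  linearIndependent : ∀ (W : Opens M) (h : W ≤ U),
    LinearIndependent (SmoothFn n W) fun m : Expo d => monomial (fun i => 𝓔.res h (y i)) m.1
  span : ∀ (W : Opens M) (h : W ≤ U),
    Submodule.span (SmoothFn n W)
      (Set.range fun m : Expo d => monomial (fun i => 𝓔.res h (y i)) m.1) = ⊤

/-- An open set over which the graded manifold has global coordinates of positive degree. These
sets form a basis of the topology as soon as they cover. -/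
def IsCoordDomain {n : ℕ} {M : Type v} [TopologicalSpace M]
    [ChartedSpace (EuclideanSpace ℝ (Fin n)) M] (𝓔 : GradedPresheaf.{u, v} n M)
    (U : Opens M) : Prop :=
  ∃ (r : ℕ) (d : Fin r → ℕ) (y : Fin r → 𝓔.O U), IsCoordinates 𝓔 U d y

/-- An `ℕ`-graded manifold with body `M`: a sheaf of `ℕ`-graded, graded commutative algebras on `M`
which is locally of the form `C^∞ ⊗ S(V)` with `V` a finite-dimensional vector space graded in
positive degrees. As usual for graded objects, gluing is degreewise. -/
structure GradedManifold (n : ℕ) (M : Type v) [TopologicalSpace M]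
    [ChartedSpace (EuclideanSpace ℝ (Fin n)) M] extends GradedPresheaf.{u, v} n M where
  graded_comm : ∀ (U : Opens M) (i j : ℕ) (a b : O U), a ∈ deg U i → b ∈ deg U j →
    a * b = ((i : ℤ) * j).negOnePow • (b * a)
  glue : ∀ {J : Type v} (U : J → Opens M) (k : ℕ) (s : ∀ j, O (U j)), (∀ j, s j ∈ deg (U j) k) →
    (∀ i j, res (inf_le_left : U i ⊓ U j ≤ U i) (s i)
      = res (inf_le_right : U i ⊓ U j ≤ U j) (s j)) →
    ∃! t : O (⨆ j, U j), t ∈ deg (⨆ j, U j) k ∧ ∀ j, res (le_iSup U j) t = s j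
  locally_free : ∀ x : M, ∃ U : Opens M, x ∈ U ∧ IsCoordDomain toGradedPresheaf U

section VectorFields

variable {n : ℕ} {M : Type v} [TopologicalSpace M]
  [ChartedSpace (EuclideanSpace ℝ (Fin n)) M] (𝓔 : GradedManifold.{u, v} n M)

/-- The part of degree `m`, for an integer `m`; it vanishes for negative `m`. -/
def degZ (U : Opens M) : ℤ → Submodule (SmoothFn n U) (𝓔.O U)
  | Int.ofNat k => 𝓔.deg U k
  | Int.negSucc _ => ⊥

/-- Families of additive operators on the algebras `O(W)`, for `W ⊆ U` open. -/
abbrev Op (U : Opens M) : Type (max u v) :=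
  ∀ W : {W : Opens M // W ≤ U}, 𝓔.O W.1 →+ 𝓔.O W.1

/-- `D` is a graded derivation of degree `k` of the structure sheaf over `U`
(killing constants is `ℝ`-linearity). -/
structure IsDer (U : Opens M) (k : ℤ) (D : Op 𝓔 U) : Prop where
  res : ∀ (W W' : {W : Opens M // W ≤ U}) (h : W'.1 ≤ W.1) (a : 𝓔.O W.1),
    𝓔.res h (D W a) = D W' (𝓔.res h a)
  const : ∀ (W : {W : Opens M // W ≤ U}) (c : ℝ),
    D W (algebraMap (SmoothFn n W.1) (𝓔.O W.1) (algebraMap ℝ (SmoothFn n W.1) c)) = 0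
  degree : ∀ (W : {W : Opens M // W ≤ U}) (i : ℕ) (a : 𝓔.O W.1), a ∈ 𝓔.deg W.1 i →
    D W a ∈ degZ 𝓔 W.1 (i + k)
  leibniz : ∀ (W : {W : Opens M // W ≤ U}) (i : ℕ) (a b : 𝓔.O W.1), a ∈ 𝓔.deg W.1 i →
    D W (a * b) = D W a * b + (k * i).negOnePow • (a * D W b)

/-- Vector fields of degree `k` over `U`: graded derivations of the structure sheaf over `U`. -/
def Der (U : Opens M) (k : ℤ) : AddSubgroup (Op 𝓔 U) where
  carrier := {D | IsDer 𝓔 U k D}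
  zero_mem' :=
    { res := fun W W' h a => by simp
      const := fun W c => by simp
      degree := fun W i a _ => by simp
      leibniz := fun W i a b _ => by simp }
  add_mem' := fun {D D'} hD hD' =>
    { res := fun W W' h a => by
        simp [hD.res W W' h a, hD'.res W W' h a]
      const := fun W c => by simp [hD.const W c, hD'.const W c]
      degree := fun W i a ha => by
        simpa using Submodule.add_mem _ (hD.degree W i a ha) (hD'.degree W i a ha)
      leibniz := fun W i a b ha => by
        simp only [Pi.add_apply, AddMonoidHom.add_apply, hD.leibniz W i a b ha,
          hD'.leibniz W i a b ha, add_mul, mul_add, smul_add]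
        abel }
  neg_mem' := fun {D} hD =>
    { res := fun W W' h a => by
        have := hD.res W W' h a
        simp only [Pi.neg_apply, AddMonoidHom.neg_apply, map_neg]
        rw [this]
      const := fun W c => by
        have := hD.const W c
        simp only [Pi.neg_apply, AddMonoidHom.neg_apply]
        rw [this, neg_zero]
      degree := fun W i a ha => by
        have := Submodule.neg_mem _ (hD.degree W i a ha)
        simpa only [Pi.neg_apply, AddMonoidHom.neg_apply] using this
      leibniz := fun W i a b ha => by
        have := hD.leibniz W i a b ha
        simp only [Pi.neg_apply, AddMonoidHom.neg_apply]
        rw [this, neg_add, neg_mul, mul_neg, smul_neg] }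

variable {𝓔}

theorem mem_degZ_iff (U : Opens M) (k : ℕ) (a : 𝓔.O U) :
    a ∈ degZ 𝓔 U k ↔ a ∈ 𝓔.deg U k := Iff.rfl

theorem degZ_cases {U : Opens M} {m : ℤ} {a : 𝓔.O U} (ha : a ∈ degZ 𝓔 U m) :
    a = 0 ∨ ∃ k : ℕ, m = k ∧ a ∈ 𝓔.deg U k := by
  cases m with
  | ofNat k => exact Or.inr ⟨k, rfl, ha⟩
  | negSucc k => exact Or.inl (by simpa [degZ] using ha)

theorem IsDer.degreeZ {U : Opens M} {k : ℤ} {D : Op 𝓔 U} (hD : IsDer 𝓔 U k D) (W : {W : Opens M // W ≤ U})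
    (m : ℤ) (a : 𝓔.O W.1) (ha : a ∈ degZ 𝓔 W.1 m) : D W a ∈ degZ 𝓔 W.1 (m + k) := by
  rcases degZ_cases ha with rfl | ⟨i, rfl, hi⟩
  · simp
  · exact hD.degree W i a hi

theorem IsDer.leibnizZ {U : Opens M} {k : ℤ} {D : Op 𝓔 U} (hD : IsDer 𝓔 U k D) (W : {W : Opens M // W ≤ U})
    (m : ℤ) (a b : 𝓔.O W.1) (ha : a ∈ degZ 𝓔 W.1 m) :
    D W (a * b) = D W a * b + (k * m).negOnePow • (a * D W b) := by
  rcases degZ_cases ha with rfl | ⟨i, rfl, hi⟩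
  · simp
  · exact hD.leibniz W i a b hi

/-- The value of a vector field over `U` on a function over `W ⊆ U`. -/
def app {U : Opens M} {k : ℤ} (X : Der 𝓔 U k) {W : Opens M} (h : W ≤ U) (a : 𝓔.O W) : 𝓔.O W :=
  X.1 ⟨W, h⟩ a

/-- Restriction of vector fields. -/
def Der.res {U W : Opens M} (h : W ≤ U) {k : ℤ} (X : Der 𝓔 U k) : Der 𝓔 W k :=
  ⟨fun W' => X.1 ⟨W'.1, W'.2.trans h⟩,
    { res := fun V V' h' a => X.2.res ⟨V.1, V.2.trans h⟩ ⟨V'.1, V'.2.trans h⟩ h' a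
      const := fun _ c => X.2.const _ c
      degree := fun W' i a ha => X.2.degree ⟨W'.1, W'.2.trans h⟩ i a ha
      leibniz := fun W' i a b ha => X.2.leibniz ⟨W'.1, W'.2.trans h⟩ i a b ha }⟩

theorem mul_mem_degZ {U : Opens M} {i : ℕ} {m : ℤ} {f a : 𝓔.O U} (hf : f ∈ 𝓔.deg U i)
    (ha : a ∈ degZ 𝓔 U m) : f * a ∈ degZ 𝓔 U (i + m) := by
  rcases degZ_cases ha with rfl | ⟨k, rfl, hk⟩
  · simp
  · have := SetLike.mul_mem_graded hf hk
    rw [← mem_degZ_iff] at this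
    exact_mod_cast this

/-- The product `f X` of a homogeneous function and a vector field. -/
def smulDer {U : Opens M} {i : ℕ} (f : 𝓔.O U) (hf : f ∈ 𝓔.deg U i) {k : ℤ} (X : Der 𝓔 U k) :
    Der 𝓔 U (i + k) :=
  ⟨fun W => (AddMonoidHom.mulLeft (𝓔.res W.2 f)).comp (X.1 W),
    { res := fun W W' h a => by
        simp only [AddMonoidHom.comp_apply, AddMonoidHom.coe_mulLeft, map_mul, 𝓔.res_res]
        rw [X.2.res W W' h a]
      const := fun W c => by
        simp only [AddMonoidHom.comp_apply, AddMonoidHom.coe_mulLeft]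
        rw [X.2.const W c, mul_zero]
      degree := fun W j a ha => by
        have := mul_mem_degZ (𝓔.res_mem_deg W.2 i f hf) (X.2.degree W j a ha)
        simp only [AddMonoidHom.comp_apply, AddMonoidHom.coe_mulLeft]
        convert this using 2
        ring
      leibniz := fun W j a b ha => by
        have hc := 𝓔.graded_comm W.1 i j _ a (𝓔.res_mem_deg W.2 i f hf) ha
        simp only [AddMonoidHom.comp_apply, AddMonoidHom.coe_mulLeft]
        rw [X.2.leibniz W j a b ha, mul_add, mul_smul_comm, ← mul_assoc, ← mul_assoc, hc, add_mul,
          Int.negOnePow_add, smul_mul_assoc, smul_smul, mul_comm (Int.negOnePow _), mul_assoc a] }⟩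

/-- The graded commutator `[X, Y] = X Y - (-1)^{|X||Y|} Y X`. -/
def bracket {U : Opens M} {k l : ℤ} (X : Der 𝓔 U k) (Y : Der 𝓔 U l) : Der 𝓔 U (k + l) :=
  ⟨fun W => (X.1 W).comp (Y.1 W) - ((k * l).negOnePow : ℤ) • (Y.1 W).comp (X.1 W),
    { res := fun W W' h a => by
        simp only [AddMonoidHom.sub_apply, AddMonoidHom.comp_apply, map_sub,
          AddMonoidHom.smul_apply, map_zsmul]
        rw [X.2.res W W' h, Y.2.res W W' h, Y.2.res W W' h, X.2.res W W' h]
      const := fun W c => by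
        simp only [AddMonoidHom.sub_apply, AddMonoidHom.comp_apply, AddMonoidHom.smul_apply]
        rw [X.2.const W c, Y.2.const W c]
        simp
      degree := fun W i a ha => by
        simp only [AddMonoidHom.sub_apply, AddMonoidHom.comp_apply, AddMonoidHom.smul_apply]
        have h1 := X.2.degreeZ W _ _ (Y.2.degree W i a ha)
        have h2 := Y.2.degreeZ W _ _ (X.2.degree W i a ha)
        have e1 : (i : ℤ) + l + k = i + (k + l) := by ring
        have e2 : (i : ℤ) + k + l = i + (k + l) := by ring
        rw [e1] at h1
        rw [e2] at h2
        exact Submodule.sub_mem _ h1 (zsmul_mem h2 _)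
      leibniz := fun W i a b ha => by
        simp only [AddMonoidHom.sub_apply, AddMonoidHom.comp_apply, AddMonoidHom.smul_apply,
          ← Units.smul_def]
        have h1 := X.2.degree W i a ha
        have h2 := Y.2.degree W i a ha
        rw [X.2.leibniz W i a b ha, Y.2.leibniz W i a b ha]
        simp only [map_add, Units.smul_def, map_zsmul]
        simp only [← Units.smul_def]
        rw [X.2.leibnizZ W _ _ _ h2, Y.2.leibnizZ W _ _ _ h1, X.2.leibniz W i a _ ha,
          Y.2.leibniz W i a _ ha]
        simp only [mul_add, add_mul, Int.negOnePow_add, sub_mul, mul_sub, smul_add, smul_sub,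
          smul_smul, smul_mul_assoc, mul_smul_comm]
        rw [mul_comm l k]
        have hs : (k * l).negOnePow * ((k * l).negOnePow) = 1 := Int.units_mul_self _
        have e2 : (k * l).negOnePow * ((k * l).negOnePow * (l * (i : ℤ)).negOnePow)
            = (l * (i : ℤ)).negOnePow := by
          rw [← mul_assoc, hs, one_mul]
        simp only [e2, mul_comm]
        abel }⟩

end VectorFields

/-- A symplectic form of degree 2 on a graded manifold: a graded skew-symmetric, closed,
non-degenerate 2-form, given by its values on vector fields over open sets. -/
structure SymplecticForm {n : ℕ} {M : Type v} [TopologicalSpace M]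
    [ChartedSpace (EuclideanSpace ℝ (Fin n)) M] (𝓔 : GradedManifold.{u, v} n M) where
  form : ∀ (U : Opens M) (k l : ℤ), Der 𝓔 U k →+ Der 𝓔 U l →+ 𝓔.O U
  res_form : ∀ {U W : Opens M} (h : W ≤ U) (k l : ℤ) (X : Der 𝓔 U k) (Y : Der 𝓔 U l),
    𝓔.res h (form U k l X Y) = form W k l (Der.res h X) (Der.res h Y)
  degree : ∀ (U : Opens M) (k l : ℤ) (X : Der 𝓔 U k) (Y : Der 𝓔 U l),
    form U k l X Y ∈ degZ 𝓔 U (k + l + 2)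
  smul_left : ∀ (U : Opens M) (i : ℕ) (f : 𝓔.O U) (hf : f ∈ 𝓔.deg U i) (k l : ℤ)
    (X : Der 𝓔 U k) (Y : Der 𝓔 U l), form U (i + k) l (smulDer f hf X) Y = f * form U k l X Y
  skew : ∀ (U : Opens M) (k l : ℤ) (X : Der 𝓔 U k) (Y : Der 𝓔 U l),
    form U k l X Y = -((k * l).negOnePow • form U l k Y X)
  closed : ∀ (U : Opens M) (k l m : ℤ) (X : Der 𝓔 U k) (Y : Der 𝓔 U l) (Z : Der 𝓔 U m),
    (k * m).negOnePow • (app X le_rfl (form U l m Y Z) - form U (k + l) m (bracket X Y) Z)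
      + (l * k).negOnePow • (app Y le_rfl (form U m k Z X) - form U (l + m) k (bracket Y Z) X)
      + (m * l).negOnePow • (app Z le_rfl (form U k l X Y) - form U (m + k) l (bracket Z X) Y)
      = 0
  /-- every homogeneous 1-form `α` is `ω(·, X)` for exactly one vector field `X` -/
  nondegenerate : ∀ (U : Opens M) (k : ℤ) (α : ∀ l : ℤ, Der 𝓔 U l →+ 𝓔.O U),
    (∀ (l : ℤ) (Y : Der 𝓔 U l), α l Y ∈ degZ 𝓔 U (l + k + 2)) →
    (∀ (i : ℕ) (f : 𝓔.O U) (hf : f ∈ 𝓔.deg U i) (l : ℤ) (Y : Der 𝓔 U l),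
      α (i + l) (smulDer f hf Y) = f * α l Y) →
    ∃! X : Der 𝓔 U k, ∀ (l : ℤ) (Y : Der 𝓔 U l), form U l k Y X = α l Y

/-- An NQ symplectic manifold of degree 2: an `ℕ`-graded manifold with a symplectic form of
degree 2 and a vector field `Q` of degree 1 with `Q² = 0` that preserves the symplectic form. -/
structure NQSymplecticManifold (n : ℕ) (M : Type v) [TopologicalSpace M]
    [ChartedSpace (EuclideanSpace ℝ (Fin n)) M] extends GradedManifold.{u, v} n M where
  symp : SymplecticForm toGradedManifold
  Q : Der toGradedManifold ⊤ 1
  Q_sq : ∀ (U : Opens M) (a : O U), app Q le_top (app Q le_top a) = 0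
  Q_symplectic : ∀ (U : Opens M) (k l : ℤ) (X : Der toGradedManifold U k)
    (Y : Der toGradedManifold U l),
    app Q le_top (symp.form U k l X Y) = symp.form U (1 + k) l (bracket (Der.res le_top Q) X) Y
      + k.negOnePow • symp.form U k (1 + l) X (bracket (Der.res le_top Q) Y)

/-- An automorphism of a graded manifold over the identity of the body which is an involution. -/
structure BaseInvolution {n : ℕ} {M : Type v} [TopologicalSpace M]
    [ChartedSpace (EuclideanSpace ℝ (Fin n)) M] (𝓔 : GradedManifold.{u, v} n M) where
  /-- the pullback of functions; linearity over `C^∞(U)` says that it is the identity on the body -/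
  inv : ∀ U : Opens M, 𝓔.O U →ₐ[SmoothFn n U] 𝓔.O U
  res_inv : ∀ {U W : Opens M} (h : W ≤ U) (a : 𝓔.O U), 𝓔.res h (inv U a) = inv W (𝓔.res h a)
  inv_mem_deg : ∀ (U : Opens M) (k : ℕ) (a : 𝓔.O U), a ∈ 𝓔.deg U k → inv U a ∈ 𝓔.deg U k
  inv_inv : ∀ (U : Opens M) (a : 𝓔.O U), inv U (inv U a) = a

/-- The image `ι ∘ X ∘ ι` of a vector field under an involution. -/
def BaseInvolution.conj {n : ℕ} {M : Type v} [TopologicalSpace M]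
    [ChartedSpace (EuclideanSpace ℝ (Fin n)) M] {𝓔 : GradedManifold.{u, v} n M}
    (ι : BaseInvolution 𝓔) {U : Opens M} {k : ℤ} (X : Der 𝓔 U k) : Der 𝓔 U k :=
  ⟨fun W => ((ι.inv W.1 : 𝓔.O W.1 →+ 𝓔.O W.1).comp (X.1 W)).comp
      (ι.inv W.1 : 𝓔.O W.1 →+ 𝓔.O W.1),
    { res := fun W W' h a => by
        simp only [AddMonoidHom.comp_apply, AddMonoidHom.coe_coe]
        rw [ι.res_inv, X.2.res W W' h, ι.res_inv]
      const := fun W c => by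
        simp only [AddMonoidHom.comp_apply, AddMonoidHom.coe_coe, AlgHom.commutes]
        rw [X.2.const W c, map_zero]
      degree := fun W i a ha => by
        simp only [AddMonoidHom.comp_apply, AddMonoidHom.coe_coe]
        have h := X.2.degree W i _ (ι.inv_mem_deg W.1 i a ha)
        rcases degZ_cases h with h0 | ⟨j, hj, h1⟩
        · rw [h0, map_zero]
          exact Submodule.zero_mem _
        · rw [hj]
          exact ι.inv_mem_deg W.1 j _ h1
      leibniz := fun W i a b ha => by
        simp only [AddMonoidHom.comp_apply, AddMonoidHom.coe_coe, map_mul]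
        rw [X.2.leibniz W i _ _ (ι.inv_mem_deg W.1 i a ha)]
        simp only [map_add, map_mul, Units.smul_def, map_zsmul, ι.inv_inv] }⟩

/-- A generalized metric: a symplectic involution which is the identity on the body. -/
structure GeneralizedMetric {n : ℕ} {M : Type v} [TopologicalSpace M]
    [ChartedSpace (EuclideanSpace ℝ (Fin n)) M] (𝓔 : NQSymplecticManifold.{u, v} n M)
    extends BaseInvolution 𝓔.toGradedManifold where
  symplectic : ∀ (U : Opens M) (k l : ℤ) (X : Der 𝓔.toGradedManifold U k)
    (Y : Der 𝓔.toGradedManifold U l),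
    𝓔.symp.form U k l (toBaseInvolution.conj X) (toBaseInvolution.conj Y)
      = inv U (𝓔.symp.form U k l X Y)

section Bundles

variable {n : ℕ} {M : Type v} [TopologicalSpace M]
  [ChartedSpace (EuclideanSpace ℝ (Fin n)) M]

/-- The projection of a function to its part of degree 1. -/
def proj₁ (𝓔 : GradedManifold.{u, v} n M) (U : Opens M) :
    𝓔.O U →ₗ[SmoothFn n U] 𝓔.deg U 1 :=
  (DirectSum.component (SmoothFn n U) ℕ (fun i => 𝓔.deg U i) 1).comp
    (DirectSum.decomposeLinearEquiv (𝓔.deg U)).toLinearMap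

/-- `Γ(U, E)`: the functions of degree 1 are the sections of `E*`, hence the sections of `E` over
`U` are the linear morphisms, over `U`, from the sheaf of functions of degree 1 to the sheaf of
smooth functions. -/
def secESubgroup (𝓔 : GradedManifold.{u, v} n M) (U : Opens M) :
    AddSubgroup (∀ W : {W : Opens M // W ≤ U}, 𝓔.deg W.1 1 →ₗ[SmoothFn n W.1] SmoothFn n W.1) where
  carrier := {s | ∀ (W W' : {W : Opens M // W ≤ U}) (h : W'.1 ≤ W.1) (f : 𝓔.deg W.1 1),
    resFn n h (s W f) = s W' ⟨𝓔.res h f, 𝓔.res_mem_deg h 1 f f.2⟩}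
  zero_mem' := fun W W' h f => by simp
  add_mem' := fun {s t} hs ht W W' h f => by
    simp only [Pi.add_apply, LinearMap.add_apply, map_add, hs W W' h f, ht W W' h f]
  neg_mem' := fun {s} hs W W' h f => by
    simp only [Pi.neg_apply, LinearMap.neg_apply, map_neg, hs W W' h f]

/-- The sections of `E` over `U`. -/
def SecE (𝓔 : GradedManifold.{u, v} n M) (U : Opens M) : Type (max u v) :=
  {s // s ∈ secESubgroup 𝓔 U}

variable {𝓔 : GradedManifold.{u, v} n M}

instance (U : Opens M) : AddCommGroup (SecE 𝓔 U) :=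
  AddSubgroup.toAddCommGroup (secESubgroup 𝓔 U)

/-- The pairing of a section of `E` over `U` with a section of `E*` over `W ⊆ U`. -/
def pair {U : Opens M} (s : SecE 𝓔 U) {W : Opens M} (h : W ≤ U) :
    𝓔.deg W 1 →ₗ[SmoothFn n W] SmoothFn n W :=
  s.1 ⟨W, h⟩

theorem pair_add {U : Opens M} (s t : SecE 𝓔 U) {W : Opens M} (h : W ≤ U) :
    pair (s + t) h = pair s h + pair t h := rfl

theorem SecE.ext {U : Opens M} {s t : SecE 𝓔 U}
    (e : ∀ (W : Opens M) (h : W ≤ U) (f : 𝓔.deg W 1), pair s h f = pair t h f) : s = t :=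
  Subtype.ext (funext fun W => LinearMap.ext fun f => e W.1 W.2 f)

theorem resFn_resFn {U W W' : Opens M} (h : W ≤ U) (h' : W' ≤ W) (f : SmoothFn n U) :
    resFn n h' (resFn n h f) = resFn n (h'.trans h) f := rfl

/-- Multiplication of sections of `E` by smooth functions. -/
instance (U : Opens M) : SMul (SmoothFn n U) (SecE 𝓔 U) where
  smul g s := ⟨fun W => resFn n W.2 g • s.1 W, fun W W' h f => by
    have := s.2 W W' h f
    simp only [LinearMap.smul_apply, smul_eq_mul, map_mul, resFn_resFn]
    rw [this]⟩

theorem pair_smul {U : Opens M} (g : SmoothFn n U) (s : SecE 𝓔 U) {W : Opens M} (h : W ≤ U) :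
    pair (g • s) h = resFn n h g • pair s h := rfl

instance (U : Opens M) : Module (SmoothFn n U) (SecE 𝓔 U) where
  one_smul s := SecE.ext fun W h f => by rw [pair_smul, map_one, one_smul]
  mul_smul a b s := SecE.ext fun W h f => by
    rw [pair_smul, pair_smul, pair_smul, map_mul, mul_smul]
  smul_zero a := SecE.ext fun W h f => by
    rw [pair_smul]
    exact smul_zero (resFn n h a)
  smul_add a s t := SecE.ext fun W h f => by
    rw [pair_add, pair_smul, pair_add, pair_smul, pair_smul, smul_add]
  add_smul a b s := SecE.ext fun W h f => by
    rw [pair_add, pair_smul, pair_smul, pair_smul, map_add, add_smul]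
  zero_smul s := SecE.ext fun W h f => by
    rw [pair_smul, map_zero, zero_smul]
    rfl

/-- Restriction of sections of `E`. -/
def SecE.res {U W : Opens M} (h : W ≤ U) (s : SecE 𝓔 U) : SecE 𝓔 W :=
  ⟨fun W' => s.1 ⟨W'.1, W'.2.trans h⟩,
    fun V V' h' f => s.2 ⟨V.1, V.2.trans h⟩ ⟨V'.1, V'.2.trans h⟩ h' f⟩

/-- `Γ(U, V₊)`: the sections of `E` over `U` with values in the subbundle `V₊` fixed by the
involution. -/
def secPlusSubmodule (ι : BaseInvolution 𝓔) (U : Opens M) :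
    Submodule (SmoothFn n U) (SecE 𝓔 U) where
  carrier := {s | ∀ (W : Opens M) (h : W ≤ U) (f : 𝓔.deg W 1),
    pair s h ⟨ι.inv W f, ι.inv_mem_deg W 1 f f.2⟩ = pair s h f}
  zero_mem' := fun W h f => rfl
  add_mem' := fun {s t} hs ht W h f => by
    rw [pair_add, LinearMap.add_apply, LinearMap.add_apply, hs W h f, ht W h f]
  smul_mem' := fun g s hs W h f => by
    rw [pair_smul, LinearMap.smul_apply, LinearMap.smul_apply, hs W h f]

/-- The sections of `V₊` over `U`. -/
def SecPlus (ι : BaseInvolution 𝓔) (U : Opens M) : Type (max u v) :=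
  {s // s ∈ secPlusSubmodule ι U}

instance (ι : BaseInvolution 𝓔) (U : Opens M) : AddCommGroup (SecPlus ι U) :=
  Submodule.addCommGroup (secPlusSubmodule ι U)

instance (ι : BaseInvolution 𝓔) (U : Opens M) : Module (SmoothFn n U) (SecPlus ι U) :=
  Submodule.module (secPlusSubmodule ι U)

/-- `Γ(U, V₊*)`: the linear functions on the fixed point set `V₁` of the involution in `E₁`, each
represented by its unique invariant extension to a function of degree 1. -/
def PlusDual (ι : BaseInvolution 𝓔) (U : Opens M) : Submodule (SmoothFn n U) (𝓔.O U) where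
  carrier := {f | f ∈ 𝓔.deg U 1 ∧ ι.inv U f = f}
  zero_mem' := ⟨Submodule.zero_mem _, map_zero _⟩
  add_mem' := fun {f g} hf hg => ⟨Submodule.add_mem _ hf.1 hg.1, by rw [map_add, hf.2, hg.2]⟩
  smul_mem' := fun c f hf => ⟨Submodule.smul_mem _ c hf.1, by rw [map_smul, hf.2]⟩

theorem plusDual_le (ι : BaseInvolution 𝓔) (U : Opens M) : PlusDual ι U ≤ 𝓔.deg U 1 :=
  fun _ hf => hf.1

/-- The pairing `⟨u, ξ⟩` of a section of `V₊` with a section of `V₊*` over `W ⊆ U`. -/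
def pairPlus {ι : BaseInvolution 𝓔} {U : Opens M} (u : SecPlus ι U) {W : Opens M} (h : W ≤ U) :
    PlusDual ι W →ₗ[SmoothFn n W] SmoothFn n W :=
  (pair u.1 h).comp (Submodule.inclusion (plusDual_le ι W))

/-- Restriction of sections of `V₊*`. -/
def PlusDual.res {ι : BaseInvolution 𝓔} {U W : Opens M} (h : W ≤ U) (ξ : PlusDual ι U) :
    PlusDual ι W :=
  ⟨𝓔.res h ξ, 𝓔.res_mem_deg h 1 _ ξ.2.1, by rw [← ι.res_inv, ξ.2.2]⟩

/-- The functions on the graded manifold `𝓥` (the pullback to `𝓔` of the bundle `V₁` over the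
body) over `U`: polynomials in the fibre coordinates, which have degree 1, with coefficients in the
functions on `𝓔`. It is used for coordinate domains `U` only, which form a basis of the topology,
and where `PlusDual ι U` is a finitely generated projective module. -/
abbrev FunV (ι : BaseInvolution 𝓔) (U : Opens M) : Type (max u v) :=
  GradedTensorProduct (SmoothFn n U) (𝓔.deg U)
    (fun i : ℕ => ⋀[SmoothFn n U]^i (PlusDual ι U))

/-- The product `a ξ` of a function on `𝓔` and a fibre coordinate. -/
def linV {ι : BaseInvolution 𝓔} {U : Opens M} (a : 𝓔.O U) (ξ : PlusDual ι U) : FunV ι U :=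
  GradedTensorProduct.tmul (SmoothFn n U) a (ExteriorAlgebra.ι (SmoothFn n U) ξ)

/-- A function on `𝓔`, pulled back to `𝓥`. -/
def pullV {ι : BaseInvolution 𝓔} {U : Opens M} (a : 𝓔.O U) : FunV ι U :=
  GradedTensorProduct.tmul (SmoothFn n U) a 1

/-- Functions on `𝓥` of degree `m`: sums of products of a function on `𝓔` of degree `i` and a
polynomial of degree `j` in the fibre coordinates, with `i + j = m`. -/
def degV (ι : BaseInvolution 𝓔) (U : Opens M) (m : ℕ) : Submodule (SmoothFn n U) (FunV ι U) :=
  Submodule.span (SmoothFn n U)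
    {t | ∃ (i j : ℕ) (a : 𝓔.O U) (b : ExteriorAlgebra (SmoothFn n U) (PlusDual ι U)),
      i + j = m ∧ a ∈ 𝓔.deg U i ∧ b ∈ ⋀[SmoothFn n U]^j (PlusDual ι U) ∧
      t = GradedTensorProduct.tmul (SmoothFn n U) a b}

/-- `Γ(𝓥*)`: the functions on `𝓥` which are linear along the fibres of `𝓥 → 𝓔`. -/
def LinFunV (ι : BaseInvolution 𝓔) (U : Opens M) : Submodule (SmoothFn n U) (FunV ι U) :=
  Submodule.span (SmoothFn n U) {t | ∃ (a : 𝓔.O U) (ξ : PlusDual ι U), t = linV a ξ}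

/-- Contraction of the fibre coordinates with a section of `V₊`: `a ξ ↦ ⟨u, ξ⟩ a`; it vanishes on
functions which are not linear in the fibre coordinates. -/
def contract {ι : BaseInvolution 𝓔} {U : Opens M} (u : SecPlus ι U) :
    FunV ι U →ₗ[SmoothFn n U] 𝓔.O U :=
  (TensorProduct.lift ((LinearMap.lsmul (SmoothFn n U) (𝓔.O U)).flip.compl₂
      ((pairPlus u le_rfl).comp ExteriorAlgebra.ιInv))).comp
    (GradedTensorProduct.of (SmoothFn n U) (𝓔.deg U)
      (fun i : ℕ => ⋀[SmoothFn n U]^i (PlusDual ι U))).symm.toLinearMap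

/-- The involution on the functions on `𝓥`; it acts trivially on the fibre coordinates. -/
def invV (ι : BaseInvolution 𝓔) (U : Opens M) : FunV ι U →ₗ[SmoothFn n U] FunV ι U :=
  (GradedTensorProduct.of (SmoothFn n U) (𝓔.deg U)
      (fun i : ℕ => ⋀[SmoothFn n U]^i (PlusDual ι U))).toLinearMap.comp
    ((TensorProduct.map (ι.inv U).toLinearMap LinearMap.id).comp
      (GradedTensorProduct.of (SmoothFn n U) (𝓔.deg U)
        (fun i : ℕ => ⋀[SmoothFn n U]^i (PlusDual ι U))).symm.toLinearMap)

/-- Restriction of polynomials in the fibre coordinates. -/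
def resExt (ι : BaseInvolution 𝓔) {U W : Opens M} (h : W ≤ U) :
    ExteriorAlgebra (SmoothFn n U) (PlusDual ι U) →+*
      ExteriorAlgebra (SmoothFn n W) (PlusDual ι W) :=
  letI : Algebra (SmoothFn n U) (ExteriorAlgebra (SmoothFn n W) (PlusDual ι W)) :=
    Algebra.compHom _ (resFn n h)
  (ExteriorAlgebra.lift (SmoothFn n U)
    ⟨{ toFun := fun ξ => ExteriorAlgebra.ι (SmoothFn n W) (PlusDual.res h ξ)
       map_add' := fun ξ η => by
        rw [← map_add]
        congr 1
        exact Subtype.ext (map_add (𝓔.res h) _ _)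
       map_smul' := fun c ξ => by
        have : PlusDual.res h (c • ξ) = resFn n h c • PlusDual.res h ξ := by
          apply Subtype.ext
          change 𝓔.res h (c • (ξ : 𝓔.O U)) = resFn n h c • 𝓔.res h ξ
          rw [Algebra.smul_def, Algebra.smul_def, map_mul, 𝓔.res_algebraMap]
        rw [this, map_smul]
        rfl },
      fun ξ => ExteriorAlgebra.ι_sq_zero _⟩).toRingHom

theorem resExt_ι (ι : BaseInvolution 𝓔) {U W : Opens M} (h : W ≤ U) (ξ : PlusDual ι U) :
    resExt ι h (ExteriorAlgebra.ι (SmoothFn n U) ξ)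
      = ExteriorAlgebra.ι (SmoothFn n W) (PlusDual.res h ξ) := by
  let _ : Algebra (SmoothFn n U) (ExteriorAlgebra (SmoothFn n W) (PlusDual ι W)) :=
    Algebra.compHom _ (resFn n h)
  exact ExteriorAlgebra.lift_ι_apply _ _ _ _

theorem resExt_algebraMap (ι : BaseInvolution 𝓔) {U W : Opens M} (h : W ≤ U) (c : SmoothFn n U) :
    resExt ι h (algebraMap _ _ c) = algebraMap (SmoothFn n W) _ (resFn n h c) := by
  let _ : Algebra (SmoothFn n U) (ExteriorAlgebra (SmoothFn n W) (PlusDual ι W)) :=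
    Algebra.compHom _ (resFn n h)
  exact AlgHom.commutes (ExteriorAlgebra.lift (SmoothFn n U) _) c

theorem resExt_mem (ι : BaseInvolution 𝓔) {U W : Opens M} (h : W ≤ U) (j : ℕ)
    (b : ExteriorAlgebra (SmoothFn n U) (PlusDual ι U))
    (hb : b ∈ ⋀[SmoothFn n U]^j (PlusDual ι U)) :
    resExt ι h b ∈ ⋀[SmoothFn n W]^j (PlusDual ι W) := by
  refine Submodule.pow_induction_on_left'
    (LinearMap.range (ExteriorAlgebra.ι (SmoothFn n U) (M := PlusDual ι U)))
    (C := fun j b _ => resExt ι h b ∈ ⋀[SmoothFn n W]^j (PlusDual ι W)) ?_ ?_ ?_ hb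
  · intro c
    rw [resExt_algebraMap]
    change _ ∈ (LinearMap.range (ExteriorAlgebra.ι (SmoothFn n W) (M := PlusDual ι W))) ^ 0
    rw [pow_zero]
    exact Submodule.algebraMap_mem _
  · intro x y i _ _ hx hy
    rw [map_add]
    exact Submodule.add_mem _ hx hy
  · rintro _ ⟨ξ, rfl⟩ i x _ hx
    rw [map_mul, resExt_ι]
    change _ ∈ (LinearMap.range (ExteriorAlgebra.ι (SmoothFn n W) (M := PlusDual ι W))) ^ (i + 1)
    rw [pow_succ']
    exact Submodule.mul_mem_mul (LinearMap.mem_range_self _ _) hx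

/-- Restriction of functions on `𝓥`. -/
def resV (ι : BaseInvolution 𝓔) {U W : Opens M} (h : W ≤ U) : FunV ι U →+* FunV ι W :=
  letI : Algebra (SmoothFn n U) (FunV ι W) := Algebra.compHom _ (resFn n h)
  (GradedTensorProduct.lift (R := SmoothFn n U) (C := FunV ι W) (𝓔.deg U)
    (fun i : ℕ => ⋀[SmoothFn n U]^i (PlusDual ι U))
    { toRingHom := (GradedTensorProduct.includeLeftRingHom (R := SmoothFn n W) (𝓔.deg W)
        (fun i : ℕ => ⋀[SmoothFn n W]^i (PlusDual ι W))).comp (𝓔.res h)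
      commutes' := fun c => by
        change GradedTensorProduct.tmul (SmoothFn n W) (𝓔.res h _) 1 = _
        rw [𝓔.res_algebraMap]
        rfl }
    { toRingHom := (GradedTensorProduct.includeRight (R := SmoothFn n W) (𝓔.deg W)
        (fun i : ℕ => ⋀[SmoothFn n W]^i (PlusDual ι W))).toRingHom.comp (resExt ι h)
      commutes' := fun c => by
        change (GradedTensorProduct.includeRight (R := SmoothFn n W) (𝓔.deg W)
          (fun i : ℕ => ⋀[SmoothFn n W]^i (PlusDual ι W))) (resExt ι h (algebraMap _ _ c)) = _
        rw [resExt_algebraMap, AlgHom.commutes]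
        rfl }
    (fun i j a b => by
      change GradedTensorProduct.tmul (SmoothFn n W) (𝓔.res h a) 1
          * GradedTensorProduct.tmul (SmoothFn n W) 1 (resExt ι h b)
        = (-1 : ℤˣ) ^ (j * i) • (GradedTensorProduct.tmul (SmoothFn n W) 1 (resExt ι h b)
          * GradedTensorProduct.tmul (SmoothFn n W) (𝓔.res h a) 1)
      have ha := 𝓔.res_mem_deg h i a a.2
      have hb := resExt_mem ι h j b b.2
      have e := GradedTensorProduct.tmul_coe_mul_coe_tmul (R := SmoothFn n W) (𝓔.deg W)
        (fun i : ℕ => ⋀[SmoothFn n W]^i (PlusDual ι W)) (1 : 𝓔.O W) ⟨_, hb⟩ ⟨_, ha⟩ 1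
      rw [GradedTensorProduct.tmul_one_mul_one_tmul]
      rw [e, smul_smul, Int.units_mul_self, one_smul, one_mul, mul_one])).toRingHom

theorem resV_tmul (ι : BaseInvolution 𝓔) {U W : Opens M} (h : W ≤ U) (a : 𝓔.O U)
    (b : ExteriorAlgebra (SmoothFn n U) (PlusDual ι U)) :
    resV ι h (GradedTensorProduct.tmul (SmoothFn n U) a b)
      = GradedTensorProduct.tmul (SmoothFn n W) (𝓔.res h a) (resExt ι h b) := by
  change (GradedTensorProduct.tmul (SmoothFn n W) (𝓔.res h a) 1
      * GradedTensorProduct.tmul (SmoothFn n W) 1 (resExt ι h b) : FunV ι W) = _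
  rw [GradedTensorProduct.tmul_one_mul_one_tmul]

theorem contract_linV {ι : BaseInvolution 𝓔} {U : Opens M} (u : SecPlus ι U) (a : 𝓔.O U)
    (ξ : PlusDual ι U) : contract u (linV a ξ) = pairPlus u le_rfl ξ • a := by
  change pairPlus u le_rfl (ExteriorAlgebra.ιInv (ExteriorAlgebra.ι _ ξ)) • a = _
  rw [ExteriorAlgebra.ι_leftInverse]

theorem invV_linV {ι : BaseInvolution 𝓔} {U : Opens M} (a : 𝓔.O U)
    (ξ : PlusDual ι U) : invV ι U (linV a ξ) = linV (ι.inv U a) ξ := rfl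

end Bundles

section Connections

variable {n : ℕ} {M : Type v} [TopologicalSpace M]
  [ChartedSpace (EuclideanSpace ℝ (Fin n)) M] {𝓔 : NQSymplecticManifold.{u, v} n M}

/-- Restriction of sections of `V₊`. -/
def SecPlus.res {𝓔 : GradedManifold.{u, v} n M} {ι : BaseInvolution 𝓔} {U W : Opens M} (h : W ≤ U)
    (s : SecPlus ι U) : SecPlus ι W :=
  ⟨SecE.res h s.1, fun V h' f => s.2 V (h'.trans h) f⟩

/-- A connection on `𝓥* → 𝓔`: a vector field of degree 1 on `𝓥`, that is a derivation of degree 1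
of the structure sheaf of `𝓥` (given on the basis of coordinate domains), which projects to `Q` on
`𝓔` and preserves the functions which are linear along the fibres. -/
@[ext]
structure Connection (ι : GeneralizedMetric 𝓔) where
  D : ∀ U : {U : Opens M // IsCoordDomain 𝓔.toGradedPresheaf U},
    FunV ι.toBaseInvolution U.1 →+ FunV ι.toBaseInvolution U.1
  res_D : ∀ (U W : {U : Opens M // IsCoordDomain 𝓔.toGradedPresheaf U}) (h : W.1 ≤ U.1)
    (t : FunV ι.toBaseInvolution U.1),
    resV ι.toBaseInvolution h (D U t) = D W (resV ι.toBaseInvolution h t)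
  degree : ∀ (U : {U : Opens M // IsCoordDomain 𝓔.toGradedPresheaf U}) (m : ℕ)
    (t : FunV ι.toBaseInvolution U.1), t ∈ degV ι.toBaseInvolution U.1 m →
    D U t ∈ degV ι.toBaseInvolution U.1 (m + 1)
  leibniz : ∀ (U : {U : Opens M // IsCoordDomain 𝓔.toGradedPresheaf U}) (m : ℕ)
    (t t' : FunV ι.toBaseInvolution U.1), t ∈ degV ι.toBaseInvolution U.1 m →
    D U (t * t') = D U t * t' + (-1 : ℤˣ) ^ m • (t * D U t')
  projects : ∀ (U : {U : Opens M // IsCoordDomain 𝓔.toGradedPresheaf U}) (a : 𝓔.O U.1),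
    D U (pullV a) = pullV (app 𝓔.Q le_top a)
  linear : ∀ (U : {U : Opens M // IsCoordDomain 𝓔.toGradedPresheaf U})
    (t : FunV ι.toBaseInvolution U.1), t ∈ LinFunV ι.toBaseInvolution U.1 →
    D U t ∈ LinFunV ι.toBaseInvolution U.1

/-- The derivative `ρ(e) f = ⟨e, Q f⟩` of a function along a section of `E`. -/
def anchor (e : SecE 𝓔.toGradedManifold ⊤) (f : SmoothFn n (⊤ : Opens M)) :
    SmoothFn n (⊤ : Opens M) :=
  pair e le_rfl (proj₁ 𝓔.toGradedManifold ⊤ (app 𝓔.Q le_rfl (algebraMap _ (𝓔.O ⊤) f)))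

/-- A Courant algebroid connection `∇ : Γ(V₊) → Γ(E* ⊗ V₊)`, with `Γ(E* ⊗ V₊)` the
`C^∞(M)`-linear maps `Γ(E) → Γ(V₊)`; we write `nabla e u` for `∇ₑ u`. -/
@[ext]
structure CourantConnection (ι : GeneralizedMetric 𝓔) where
  nabla : SecE 𝓔.toGradedManifold ⊤ → SecPlus ι.toBaseInvolution ⊤ → SecPlus ι.toBaseInvolution ⊤
  nabla_add_left : ∀ (e e' : SecE 𝓔.toGradedManifold ⊤) (u : SecPlus ι.toBaseInvolution ⊤),
    nabla (e + e') u = nabla e u + nabla e' u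
  nabla_add_right : ∀ (e : SecE 𝓔.toGradedManifold ⊤) (u u' : SecPlus ι.toBaseInvolution ⊤),
    nabla e (u + u') = nabla e u + nabla e u'
  nabla_smul_left : ∀ (f : SmoothFn n (⊤ : Opens M)) (e : SecE 𝓔.toGradedManifold ⊤)
    (u : SecPlus ι.toBaseInvolution ⊤), nabla (f • e) u = f • nabla e u
  leibniz : ∀ (f : SmoothFn n (⊤ : Opens M)) (e : SecE 𝓔.toGradedManifold ⊤)
    (u : SecPlus ι.toBaseInvolution ⊤), nabla e (f • u) = f • nabla e u + anchor e f • u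

variable {ι : GeneralizedMetric 𝓔}

/-- `∇` is the dual of the restriction `Γ(V₊*) → Γ(E* ⊗ V₊*)` of `Q` to fibre coordinates:
`Q_E ⟨u, ξ⟩ = ⟨∇ u, ξ⟩ + ⟨u, Q ξ⟩` as sections of `E*`, for all local sections `ξ` of `V₊*`. -/
def IsDual (Q : Connection ι) (C : CourantConnection ι) : Prop :=
  ∀ (e : SecE 𝓔.toGradedManifold ⊤) (u : SecPlus ι.toBaseInvolution ⊤)
    (U : {U : Opens M // IsCoordDomain 𝓔.toGradedPresheaf U})
    (ξ : PlusDual ι.toBaseInvolution U.1),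
    pair e le_top (proj₁ 𝓔.toGradedManifold U.1
        (app 𝓔.Q le_top (algebraMap _ (𝓔.O U.1) (pairPlus u le_top ξ))))
      = pairPlus (C.nabla e u) le_top ξ
        + pair e le_top (proj₁ 𝓔.toGradedManifold U.1
          (contract (SecPlus.res le_top u) (Q.D U (linV 1 ξ))))

/-- `τ` is the tautological section of `𝓥*` over `U`: the section `Σ aᵢ ξᵢ`, with `aᵢ` of degree 1,
whose contraction with any section `v` of `V₊` is the linear function `ω(v, ·)` on `E₁`. Here the
symplectic form is evaluated on vector fields of degree `-1`, a vector field `X` of degree `-1`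
inducing the section of `E` given by its action on functions of degree 1. -/
def IsTautological (ι : GeneralizedMetric 𝓔) (U : Opens M) (τ : FunV ι.toBaseInvolution U) :
    Prop :=
  τ ∈ LinFunV ι.toBaseInvolution U ∧ τ ∈ degV ι.toBaseInvolution U 2 ∧
  ∀ (v : SecPlus ι.toBaseInvolution U) (X : Der 𝓔.toGradedManifold U (-1)),
    (∀ (W : Opens M) (h : W ≤ U) (f : 𝓔.deg W 1),
      app X h (f : 𝓔.O W) = algebraMap _ (𝓔.O W) (pair v.1 h f)) →
    ∀ Y : Der 𝓔.toGradedManifold U (-1),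
      app Y le_rfl (contract v τ) = 𝓔.symp.form U (-1) (-1) X Y

/-- The torsion `Q τ` of the connection is invariant under the involution. -/
def HasInvariantTorsion (Q : Connection ι) : Prop :=
  ∀ (U : {U : Opens M // IsCoordDomain 𝓔.toGradedPresheaf U})
    (τ : FunV ι.toBaseInvolution U.1), IsTautological ι U.1 τ →
    invV ι.toBaseInvolution U.1 (Q.D U τ) = Q.D U τ

end Connections

end NQ

end

/-! Over a coordinate domain the functions on `𝓥` are generated by the functions on `𝓔` and the
fibre coordinates `ξ`. A connection is prescribed by `Q_𝓔` on the former, so it amounts to the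
elements `Q ξ`, subject to additivity, to `Q (f ξ) = (Q_𝓔 f) ξ + f Q ξ` and to compatibility with
restriction. As `Q` has degree 1 and preserves linear functions, `Q ξ` is a sum of terms `a η` with
`a` of degree 1, that is, a local section of `E* ⊗ V₊*`, and it is determined by the numbers `⟨e,
⟨u, Q ξ⟩⟩` (`IsCoordDomain.linFunV_ext`).

Part (1). The expression `⟨e, Q_𝓔⟨u, ξ⟩⟩ - ⟨e, ⟨u, Q ξ⟩⟩` is `C^∞`-linear in `e` and `ξ` and obeys a
Leibniz rule in `u`; hence it equals `⟨∇ₑ u, ξ⟩` for exactly one Courant algebroid connection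
(`Connection.toCourant`). Conversely `∇` prescribes every `Q ξ`, and `OddPoly.exists_derivation`
extends these values to a derivation. Since `∇` is given on global sections only, it is first
localised: bump functions show that `∇ₑ u` depends on germs alone, and the sheaf property of the
sections of `E` yields `localNabla`.

Derivations are produced by one device. A skew derivation of `A` is the second component of a ring
homomorphism from `A` to a square zero extension of `A` twisted by a sign automorphism (`TwistExt`),
so universal properties of algebras give derivations with prescribed values on generators.

Part (2). Put `A(ξ) = ⟨u, Q ξ - Q' ξ⟩`, a function of degree 1 which is `C^∞`-linear in `ξ`.
Equality of the connections along `V₊` says that the invariant part of `A(ξ)` vanishes, so `ι` maps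
`A(ξ)` to `-A(ξ)`. Write `τ = Σ gᵢ ξᵢ` with `gᵢ` invariant (`IsCoordDomain.isTautological`). Up to
sign the contracted torsions differ by `Σ gᵢ A(ξᵢ)`, which is invariant by hypothesis and
anti-invariant by construction, hence zero. The Hamiltonian vector field of an invariant function
`f` (`exists_hamiltonian`) is itself invariant and so kills every `A(ξᵢ)`; applying it to the
vanishing sum leaves `A(f) = 0` (`contractDiff_eq_zero`). -/

noncomputable section

namespace NQ

/-! ### Signs, twisted square zero extensions and free graded commutative algebras. -/

section GradedAlgebras

variable {R A : Type*} [CommRing R] [Ring A] [Algebra R A]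

section SignHom

variable (𝒜 : ℕ → Submodule R A) [GradedAlgebra 𝒜]

/-- The automorphism of a graded algebra which multiplies elements of degree `i` by `ε ^ i`. -/
def signHom (ε : ℤˣ) : A →ₐ[R] A :=
  (DirectSum.toAlgebra R (fun i => 𝒜 i) (fun i => ((ε ^ i : ℤˣ) : ℤ) • (𝒜 i).subtype)
    (by
      simp only [pow_zero, Units.val_one, one_smul]
      rfl)
    (fun {i j} ai aj => by
      simp only [LinearMap.smul_apply, Submodule.subtype_apply, SetLike.coe_gMul, ← Units.smul_def,
        smul_mul_smul_comm, pow_add])).comp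
    (DirectSum.decomposeAlgEquiv 𝒜).toAlgHom

theorem signHom_apply (ε : ℤˣ) {i : ℕ} {a : A} (ha : a ∈ 𝒜 i) : signHom 𝒜 ε a = ε ^ i • a := by
  lift a to 𝒜 i using ha
  change DirectSum.toAddMonoid _ (DirectSum.decompose 𝒜 (a : A)) = _
  rw [DirectSum.decompose_coe]
  exact DirectSum.toAddMonoid_of _ _ _

end SignHom

/-- The square zero extension of a ring `A` by itself, with the left action twisted by `σ`. Ring
homomorphisms to it are pairs of a ring homomorphism and a skew derivation. -/
def TwistExt (σ : A →+* A) : Type _ :=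
  let _ := σ
  A × A

namespace TwistExt

variable (σ : A →+* A)

instance : AddCommGroup (TwistExt σ) := inferInstanceAs (AddCommGroup (A × A))

instance : Ring (TwistExt σ) :=
  { (inferInstance : AddCommGroup (TwistExt σ)) with
    mul := fun x y => (x.1 * y.1, x.2 * y.1 + σ x.1 * y.2)
    one := (1, 0)
    left_distrib := fun a b c => Prod.ext (mul_add _ _ _) (by
      change a.2 * (b.1 + c.1) + σ a.1 * (b.2 + c.2)
        = (a.2 * b.1 + σ a.1 * b.2) + (a.2 * c.1 + σ a.1 * c.2)
      rw [mul_add, mul_add]; abel)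
    right_distrib := fun a b c => Prod.ext (add_mul _ _ _) (by
      change (a.2 + b.2) * c.1 + σ (a.1 + b.1) * c.2
        = (a.2 * c.1 + σ a.1 * c.2) + (b.2 * c.1 + σ b.1 * c.2)
      rw [map_add, add_mul, add_mul]; abel)
    zero_mul := fun a => Prod.ext (zero_mul _) (by
      change (0 : A) * a.1 + σ 0 * a.2 = 0
      rw [map_zero, zero_mul, zero_mul, add_zero])
    mul_zero := fun a => Prod.ext (mul_zero _) (by
      change a.2 * 0 + σ a.1 * 0 = 0
      rw [mul_zero, mul_zero, add_zero])
    mul_assoc := fun a b c => Prod.ext (mul_assoc _ _ _) (by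
      change (a.2 * b.1 + σ a.1 * b.2) * c.1 + σ (a.1 * b.1) * c.2
        = a.2 * (b.1 * c.1) + σ a.1 * (b.2 * c.1 + σ b.1 * c.2)
      rw [map_mul, add_mul, mul_add, mul_assoc, mul_assoc, mul_assoc, add_assoc])
    one_mul := fun a => Prod.ext (one_mul _) (by
      change (0 : A) * a.1 + σ 1 * a.2 = a.2
      rw [map_one, zero_mul, one_mul, zero_add])
    mul_one := fun a => Prod.ext (mul_one _) (by
      change a.2 * 1 + σ a.1 * 0 = a.2
      rw [mul_zero, mul_one, add_zero]) }

variable {σ}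

theorem ext {x y : TwistExt σ} (h1 : x.1 = y.1) (h2 : x.2 = y.2) : x = y := Prod.ext h1 h2

theorem fst_mul (x y : TwistExt σ) : (x * y).1 = x.1 * y.1 := rfl

theorem snd_mul (x y : TwistExt σ) : (x * y).2 = x.2 * y.1 + σ x.1 * y.2 := rfl

variable (σ) in
/-- The projection to `A`. -/
def fstHom : TwistExt σ →+* A where
  toFun x := x.1
  map_one' := rfl
  map_mul' _ _ := rfl
  map_zero' := rfl
  map_add' _ _ := rfl

variable (σ) in
/-- The additive projection to the square zero ideal. -/
def sndHom : TwistExt σ →+ A where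
  toFun x := x.2
  map_zero' := rfl
  map_add' _ _ := rfl

/-- The algebra structure over `R` given by a derivation `q` of `R`. -/
abbrev algebra (q : R →+ A)
    (hq : ∀ f g, q (f * g) = q f * algebraMap R A g + algebraMap R A f * q g)
    (hσ : ∀ f, σ (algebraMap R A f) = algebraMap R A f) (hc : ∀ f a, q f * a = σ a * q f) :
    Algebra R (TwistExt σ) :=
  RingHom.toAlgebra'
    { toFun := fun f => (algebraMap R A f, q f)
      map_one' := TwistExt.ext (map_one _) (by
        have h := hq 1 1
        rw [mul_one, map_one (algebraMap R A), mul_one, one_mul] at h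
        change q 1 = 0
        simpa using h)
      map_mul' := fun f g => TwistExt.ext (map_mul _ _ _) (by
        change q (f * g) = q f * algebraMap R A g + σ (algebraMap R A f) * q g
        rw [hσ]
        exact hq f g)
      map_zero' := TwistExt.ext (map_zero _) (map_zero _)
      map_add' := fun f g => TwistExt.ext (map_add _ _ _) (map_add _ _ _) }
    -- Scalars must be central: `hc` supplies this for the second component `q f`.
    fun f x => TwistExt.ext (Algebra.commutes _ _) (by
      change q f * x.1 + σ (algebraMap R A f) * x.2 = x.2 * algebraMap R A f + σ x.1 * q f
      rw [hσ, hc, Algebra.commutes, add_comm])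

end TwistExt

section Monomials

theorem monomial_succ {r : ℕ} (y : Fin (r + 1) → A) (m : Fin (r + 1) → ℕ) :
    monomial y m = y 0 ^ m 0 * monomial (fun i => y i.succ) (fun i => m i.succ) := by
  simp [monomial, List.ofFn_succ]

theorem map_monomial {B F : Type*} [Ring B] [FunLike F A B] [MonoidHomClass F A B] (φ : F) {r : ℕ}
    (y : Fin r → A) (m : Fin r → ℕ) : φ (monomial y m) = monomial (fun i => φ (y i)) m := by
  simp only [monomial, map_list_prod, List.map_ofFn]
  congr 2
  funext i
  simp

/-- A family of sets, indexed by weights, which is stable under multiplication with the generators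
is stable under multiplication with the monomials. -/
theorem monomial_mul_mem {r : ℕ} (y : Fin r → A) (d : Fin r → ℕ) (S : ℕ → Set A)
    (hS : ∀ i k, ∀ b ∈ S k, y i * b ∈ S (d i + k)) (m : Fin r → ℕ) (k : ℕ) (b : A) (hb : b ∈ S k) :
    monomial y m * b ∈ S (∑ i, m i * d i + k) := by
  induction r with
  | zero => simpa [monomial] using hb
  | succ r ih =>
    rw [monomial_succ, mul_assoc, Fin.sum_univ_succ, add_assoc]
    have h1 := ih (fun i => y i.succ) (fun i => d i.succ) (fun i k => hS i.succ k)
      (fun i => m i.succ)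
    generalize monomial (fun i => y i.succ) (fun i => m i.succ) * b = c at h1 ⊢
    generalize ∑ i : Fin r, m i.succ * d i.succ + k = l at h1 ⊢
    induction m 0 with
    | zero => simpa using h1
    | succ e he =>
      rw [pow_succ', mul_assoc, Nat.succ_mul, add_comm (e * d 0), add_assoc]
      exact hS _ _ _ he

/-- Moving `y i` to its own slot past the earlier generators costs a product of signs `ε i j`. The
value of that product is never used. -/
theorem exists_mul_monomial {r : ℕ} (y : Fin r → A) (ε : Fin r → Fin r → ℤˣ)
    (hy : ∀ i j, y i * y j = ε i j • (y j * y i)) (m : Fin r → ℕ) (i : Fin r) :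
    ∃ η : ℤˣ, y i * monomial y m = η • monomial y (m + Pi.single i 1) := by
  induction r with
  | zero => exact i.elim0
  | succ r ih =>
    refine Fin.cases ?_ (fun i => ?_) i
    · refine ⟨1, ?_⟩
      rw [monomial_succ, monomial_succ, ← mul_assoc, ← pow_succ', one_smul]
      simp
    · obtain ⟨η, hη⟩ := ih (fun i => y i.succ) (fun i j => ε i.succ j.succ)
        (fun i j => hy i.succ j.succ) (fun i => m i.succ) i
      have hp : ∀ e : ℕ, y i.succ * y 0 ^ e = ε i.succ 0 ^ e • (y 0 ^ e * y i.succ) := by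
        intro e
        induction e with
        | zero => simp
        | succ e he =>
          rw [pow_succ, ← mul_assoc, he, smul_mul_assoc, mul_assoc, hy, mul_smul_comm, smul_smul,
            pow_succ, mul_assoc]
      refine ⟨ε i.succ 0 ^ m 0 * η, ?_⟩
      rw [monomial_succ, monomial_succ, ← mul_assoc, hp, smul_mul_assoc, mul_assoc, hη,
        mul_smul_comm, smul_smul]
      congr 3
      funext j
      simp only [Pi.add_apply, Pi.single_apply, Fin.succ_inj]

theorem monomial_eq_zero {r : ℕ} (y : Fin r → A) (m : Fin r → ℕ) (i : Fin r)
    (hi : y i * y i = 0) (hm : 2 ≤ m i) : monomial y m = 0 := by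
  apply List.prod_eq_zero
  rw [List.mem_ofFn]
  refine ⟨i, ?_⟩
  obtain ⟨e, he⟩ := Nat.exists_eq_add_of_le hm
  rw [he, pow_add, pow_two, hi, zero_mul]

theorem monomial_zero {r : ℕ} (y : Fin r → A) : monomial y 0 = 1 := by
  simp [monomial]

theorem monomial_single {r : ℕ} (y : Fin r → A) (i : Fin r) : monomial y (Pi.single i 1) = y i := by
  induction r with
  | zero => exact i.elim0
  | succ r ih =>
    rw [monomial_succ]
    refine Fin.cases ?_ (fun i => ?_) i
    · have : (fun i : Fin r => (Pi.single 0 1 : Fin (r + 1) → ℕ) i.succ) = 0 := by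
        funext j; simp
      rw [this, monomial_zero]
      simp
    · have : (fun j : Fin r => (Pi.single i.succ 1 : Fin (r + 1) → ℕ) j.succ) = Pi.single i 1 := by
        funext j; simp [Pi.single_apply]
      rw [this, ih]
      simp

/-- The universal property of the free graded commutative algebra, for an algebra with a basis of
ordered monomials. -/
theorem exists_algHom {B : Type*} [Ring B] [Algebra R B] {r : ℕ} {d : Fin r → ℕ} {y : Fin r → A}
    (hli : LinearIndependent R fun m : Expo d => monomial y m.1)
    (hsp : Submodule.span R (Set.range fun m : Expo d => monomial y m.1) = ⊤)
    (ε : Fin r → Fin r → ℤˣ) (hy : ∀ i j, y i * y j = ε i j • (y j * y i))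
    (hy0 : ∀ i, Odd (d i) → y i * y i = 0) (z : Fin r → B)
    (hz : ∀ i j, z i * z j = ε i j • (z j * z i)) (hz0 : ∀ i, Odd (d i) → z i * z i = 0) :
    ∃ φ : A →ₐ[R] B, ∀ i, φ (y i) = z i := by
  classical
  let b := Module.Basis.mk hli hsp.ge
  let φ : A →ₗ[R] B := b.constr R fun m => monomial z m.1
  have hφ : ∀ m : Expo d, φ (monomial y m.1) = monomial z m.1 := fun m => by
    have : b m = monomial y m.1 := Module.Basis.mk_apply _ _ _
    rw [← this]
    exact b.constr_basis R _ m
  have h1 : φ 1 = 1 := by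
    have := hφ ⟨0, fun _ _ => Nat.zero_le _⟩
    rwa [monomial_zero, monomial_zero] at this
  have hgen : ∀ i a, φ (y i * a) = z i * φ a := by
    intro i a
    have ha : a ∈ Submodule.span R (Set.range fun m : Expo d => monomial y m.1) := by
      rw [hsp]; trivial
    induction ha using Submodule.span_induction with
    | zero => simp
    | add a b _ _ ha hb => rw [mul_add, map_add, map_add, mul_add, ha, hb]
    | smul c a _ ha => rw [mul_smul_comm, map_smul, map_smul, mul_smul_comm, ha]
    | mem _ h =>
      obtain ⟨m, rfl⟩ := h
      -- Working in `A × B` with the pairs of generators ensures that one and the same sign `η`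
      -- occurs on both sides.
      obtain ⟨η, hη⟩ := exists_mul_monomial (fun i => (y i, z i)) ε
        (fun i j => Prod.ext (hy i j) (hz i j)) m.1 i
      have e1 := congrArg (RingHom.fst A B) hη
      have e2 := congrArg (RingHom.snd A B) hη
      rw [Units.smul_def, map_mul, map_zsmul, map_monomial, map_monomial, ← Units.smul_def] at e1 e2
      simp only [RingHom.coe_fst, RingHom.coe_snd] at e1 e2
      rw [hφ, e1, e2, Units.smul_def, map_zsmul, ← Units.smul_def]
      congr 1
      -- If an odd generator would occur twice, the new exponent leaves the basis, but then both
      -- monomials are zero.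
      by_cases hm : ∀ j, Odd (d j) → (m.1 + Pi.single i 1 : Fin r → ℕ) j ≤ 1
      · exact hφ ⟨_, hm⟩
      · push Not at hm
        obtain ⟨j, hj, hj'⟩ := hm
        rw [monomial_eq_zero _ _ j (hy0 j hj) hj', monomial_eq_zero _ _ j (hz0 j hj) hj', map_zero]
  have hmul : ∀ a c, φ (a * c) = φ a * φ c := by
    intro a c
    have ha : a ∈ Submodule.span R (Set.range fun m : Expo d => monomial y m.1) := by
      rw [hsp]; trivial
    induction ha using Submodule.span_induction with
    | zero => simp
    | add a b _ _ ha hb => rw [add_mul, map_add, map_add, add_mul, ha, hb]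
    | smul e a _ ha => rw [smul_mul_assoc, map_smul, map_smul, smul_mul_assoc, ha]
    | mem _ h =>
      obtain ⟨m, rfl⟩ := h
      have := monomial_mul_mem y d (fun _ => {a | φ (a * c) = φ a * φ c})
        (fun i k b hb => by
          simp only [Set.mem_ofPred_eq] at hb ⊢
          rw [mul_assoc, hgen, hgen, hb, mul_assoc]) m.1 0 1 (by simp [h1])
      simpa using this
  refine ⟨AlgHom.ofLinearMap φ h1 hmul, fun i => ?_⟩
  have := hgen i 1
  rwa [mul_one, h1, mul_one] at this

end Monomials

end GradedAlgebras

/-! ### Algebra over a coordinate domain. -/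

section CoordinateDomains

variable {n : ℕ} {M : Type v} [TopologicalSpace M]
  [ChartedSpace (EuclideanSpace ℝ (Fin n)) M]

theorem negOnePow_pow (k : ℤ) (i : ℕ) : k.negOnePow ^ i = (k * i).negOnePow := by
  rw [Int.negOnePow_def, Int.negOnePow_def, zpow_mul, zpow_natCast]

/-- The constant function `1 / 2`. -/
def half (n : ℕ) {M : Type v} [TopologicalSpace M] [ChartedSpace (EuclideanSpace ℝ (Fin n)) M]
    (U : Opens M) : SmoothFn n U :=
  algebraMap ℝ (SmoothFn n U) (1 / 2)

theorem half_smul_add_self {U : Opens M} {N : Type*} [AddCommGroup N] [Module (SmoothFn n U) N]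
    (a : N) : half n U • (a + a) = a := by
  rw [smul_add, ← add_smul, half, ← map_add]
  norm_num

/-- Division by 2 through the constant functions. Squares of odd elements and quantities that are
both invariant and anti-invariant are shown to vanish this way. -/
theorem eq_zero_of_eq_neg {U : Opens M} {N : Type*} [AddCommGroup N] [Module (SmoothFn n U) N]
    {a : N} (h : a = -a) : a = 0 := by
  rw [← half_smul_add_self (n := n) (U := U) a]
  nth_rewrite 1 [h]
  rw [neg_add_cancel, smul_zero]

theorem resFn_half {U W : Opens M} (h : W ≤ U) : resFn n h (half n U) = half n W := rfl

theorem GradedPresheaf.res_smul (𝓔 : GradedPresheaf.{u, v} n M) {U W : Opens M} (h : W ≤ U)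
    (c : SmoothFn n U) (a : 𝓔.O U) : 𝓔.res h (c • a) = resFn n h c • 𝓔.res h a := by
  rw [Algebra.smul_def, Algebra.smul_def, map_mul, 𝓔.res_algebraMap]

theorem IsCoordinates.restrict {𝓔 : GradedPresheaf.{u, v} n M} {U W : Opens M} {r : ℕ}
    {d : Fin r → ℕ} {y : Fin r → 𝓔.O U} (hc : IsCoordinates 𝓔 U d y) (h : W ≤ U) :
    IsCoordinates 𝓔 W d fun i => 𝓔.res h (y i) where
  pos := hc.pos
  mem i := 𝓔.res_mem_deg h _ _ (hc.mem i)
  linearIndependent W' h' := by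
    simpa only [𝓔.res_res] using hc.linearIndependent W' (h'.trans h)
  span W' h' := by
    simpa only [𝓔.res_res] using hc.span W' (h'.trans h)

theorem IsCoordDomain.mono {𝓔 : GradedPresheaf.{u, v} n M} {U W : Opens M}
    (hU : IsCoordDomain 𝓔 U) (h : W ≤ U) : IsCoordDomain 𝓔 W := by
  obtain ⟨r, d, y, hc⟩ := hU
  exact ⟨r, d, _, hc.restrict h⟩

variable {𝓔 : GradedManifold.{u, v} n M}

theorem graded_commZ (U : Opens M) (i j : ℤ) (a b : 𝓔.O U) (ha : a ∈ degZ 𝓔 U i)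
    (hb : b ∈ degZ 𝓔 U j) : a * b = (i * j).negOnePow • (b * a) := by
  rcases degZ_cases ha with rfl | ⟨i, rfl, ha⟩
  · simp
  rcases degZ_cases hb with rfl | ⟨j, rfl, hb⟩
  · simp
  exact 𝓔.graded_comm U i j a b ha hb

namespace IsCoordinates

variable {U : Opens M} {r : ℕ} {d : Fin r → ℕ} {y : Fin r → 𝓔.O U}
  (hc : IsCoordinates 𝓔.toGradedPresheaf U d y)

include hc

theorem linearIndependent' : LinearIndependent (SmoothFn n U) fun m : Expo d => monomial y m.1 := by
  simpa only [𝓔.res_self] using hc.linearIndependent U le_rfl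

theorem span' :
    Submodule.span (SmoothFn n U) (Set.range fun m : Expo d => monomial y m.1) = ⊤ := by
  simpa only [𝓔.res_self] using hc.span U le_rfl

theorem monomial_mem (m : Fin r → ℕ) : monomial y m ∈ 𝓔.deg U (∑ i, m i * d i) := by
  have := monomial_mul_mem y d (fun k => (𝓔.deg U k : Set (𝓔.O U)))
    (fun i k b hb => SetLike.mul_mem_graded (hc.mem i) hb) m 0 1 SetLike.GradedOne.one_mem
  simpa using this

/-- The monomial basis consists of homogeneous elements, so projecting an expansion to degree `k`
keeps exactly the monomials of weight `k`. -/
theorem mem_span_of_mem_deg {k : ℕ} {a : 𝓔.O U} (ha : a ∈ 𝓔.deg U k) :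
    a ∈ Submodule.span (SmoothFn n U)
      {b | ∃ m : Expo d, ∑ i, m.1 i * d i = k ∧ b = monomial y m.1} := by
  have key : ∀ b : 𝓔.O U, (DirectSum.decompose (𝓔.deg U) b k : 𝓔.O U) ∈
      Submodule.span (SmoothFn n U)
        {b | ∃ m : Expo d, ∑ i, m.1 i * d i = k ∧ b = monomial y m.1} := by
    intro b
    have hb : b ∈ Submodule.span (SmoothFn n U)
        (Set.range fun m : Expo d => monomial y m.1) := by
      rw [hc.span']; trivial
    induction hb using Submodule.span_induction with
    | zero => simp
    | add a b _ _ ha hb =>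
      rw [DirectSum.decompose_add]
      exact Submodule.add_mem _ ha hb
    | smul c a _ ha =>
      rw [DirectSum.decompose_smul]
      exact Submodule.smul_mem _ c ha
    | mem _ h =>
      obtain ⟨m, rfl⟩ := h
      by_cases hm : ∑ i, m.1 i * d i = k
      · rw [DirectSum.decompose_of_mem_same _ (hm ▸ hc.monomial_mem m.1)]
        exact Submodule.subset_span ⟨m, hm, rfl⟩
      · rw [DirectSum.decompose_of_mem_ne _ (hc.monomial_mem m.1) hm]
        exact Submodule.zero_mem _
  have := key a
  rwa [DirectSum.decompose_of_mem_same _ ha] at this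

/-- All generators have positive degree, so the empty monomial is the only one of weight 0. -/
theorem exists_of_mem_deg_zero {a : 𝓔.O U} (ha : a ∈ 𝓔.deg U 0) :
    ∃ c : SmoothFn n U, algebraMap _ _ c = a := by
  suffices h : _ ≤ LinearMap.range (Algebra.linearMap (SmoothFn n U) (𝓔.O U)) from
    h (hc.mem_span_of_mem_deg ha)
  rw [Submodule.span_le]
  rintro _ ⟨m, hm, rfl⟩
  refine ⟨1, ?_⟩
  have h0 : m.1 = 0 := by
    funext i
    have := (Finset.sum_eq_zero_iff.1 hm) i (Finset.mem_univ i)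
    have hd := hc.pos i
    rcases Nat.mul_eq_zero.1 this with h | h
    · exact h
    · omega
  rw [h0, monomial_zero]
  exact map_one (algebraMap (SmoothFn n U) (𝓔.O U))

theorem algebraMap_injective : Function.Injective (algebraMap (SmoothFn n U) (𝓔.O U)) := by
  rw [injective_iff_map_eq_zero]
  intro c h
  let m₀ : Expo d := ⟨0, fun _ _ => Nat.zero_le _⟩
  refine (linearIndependent_iff'.1 hc.linearIndependent') {m₀} (fun _ => c) ?_ m₀
    (Finset.mem_singleton_self _)
  rw [Finset.sum_singleton, monomial_zero, ← Algebra.algebraMap_eq_smul_one, h]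

/-- Positivity of the degrees forces a monomial of weight 1 to be a single generator of degree 1. -/
theorem mem_span_of_mem_deg_one {a : 𝓔.O U} (ha : a ∈ 𝓔.deg U 1) :
    a ∈ Submodule.span (SmoothFn n U) (Set.range fun i : {i : Fin r // d i = 1} => y i.1) := by
  refine Submodule.span_mono ?_ (hc.mem_span_of_mem_deg ha)
  rintro _ ⟨m, hm, rfl⟩
  have hex : ∃ i, m.1 i ≠ 0 := by
    by_contra! h
    rw [Finset.sum_eq_zero fun i _ => by rw [h i, zero_mul]] at hm
    exact zero_ne_one hm
  obtain ⟨i, hi⟩ := hex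
  have h1 := Finset.add_sum_erase Finset.univ (fun i => m.1 i * d i) (Finset.mem_univ i)
  have hpos : 1 ≤ m.1 i * d i := Nat.one_le_iff_ne_zero.2
    (mul_ne_zero hi (Nat.one_le_iff_ne_zero.1 (hc.pos i)))
  rw [hm] at h1
  have h2 : m.1 i * d i = 1 := by omega
  have h3 : ∑ j ∈ Finset.univ.erase i, m.1 j * d j = 0 := by omega
  have h4 := mul_eq_one.1 h2
  have h5 : m.1 = Pi.single i 1 := by
    funext j
    by_cases hj : j = i
    · subst hj; simp [h4.1]
    · have := (Finset.sum_eq_zero_iff.1 h3) j (by simp [hj])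
      have hdj := hc.pos j
      rw [Pi.single_eq_of_ne hj]
      rcases Nat.mul_eq_zero.1 this with h | h
      · exact h
      · omega
  exact ⟨⟨i, h4.2⟩, (monomial_single y i).symm.trans (congrArg _ h5.symm)⟩

/-- A skew derivation along a ring homomorphism vanishes if it vanishes on the coordinates. -/
theorem eq_zero_of_leibniz {N : Type*} [Ring N] (ρ : 𝓔.O U →+* N) (F : 𝓔.O U →+ N) (ε : ℤˣ)
    (hF : ∀ (i : ℕ) (a b : 𝓔.O U), a ∈ 𝓔.deg U i → F (a * b) = F a * ρ b + ε ^ i • (ρ a * F b))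
    (hconst : ∀ c, F (algebraMap (SmoothFn n U) (𝓔.O U) c) = 0) (hy : ∀ i, F (y i) = 0) : F = 0 := by
  ext a
  have ha : a ∈ Submodule.span (SmoothFn n U) (Set.range fun m : Expo d => monomial y m.1) := by
    rw [hc.span']; trivial
  induction ha using Submodule.span_induction with
  | zero => simp
  | add a b _ _ ha hb => rw [map_add, map_add, ha, hb]
  | smul c a _ ha =>
    rw [AddMonoidHom.zero_apply] at ha ⊢
    rw [Algebra.smul_def, hF 0 _ _ (SetLike.algebraMap_mem_graded _ _), hconst, ha]
    simp
  | mem _ h =>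
    obtain ⟨m, rfl⟩ := h
    have h1 : F 1 = 0 := by rw [← map_one (algebraMap (SmoothFn n U) (𝓔.O U)), hconst]
    have := monomial_mul_mem y d (fun _ => {a | F a = 0})
      (fun i k b hb => by
        simp only [Set.mem_ofPred_eq] at hb ⊢
        rw [hF _ _ _ (hc.mem i), hy, hb]
        simp) m.1 0 1 h1
    simpa using this

theorem ringHom_ext {N : Type*} [Ring N] (φ ψ : 𝓔.O U →+* N)
    (hconst : ∀ c, φ (algebraMap (SmoothFn n U) (𝓔.O U) c) = ψ (algebraMap _ _ c))
    (hy : ∀ i, φ (y i) = ψ (y i)) : φ = ψ := by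
  ext a
  have ha : a ∈ Submodule.span (SmoothFn n U) (Set.range fun m : Expo d => monomial y m.1) := by
    rw [hc.span']; trivial
  induction ha using Submodule.span_induction with
  | zero => simp
  | add a b _ _ ha hb => rw [map_add, map_add, ha, hb]
  | smul c a _ ha => rw [Algebra.smul_def, map_mul, map_mul, ha, hconst]
  | mem _ h =>
    obtain ⟨m, rfl⟩ := h
    simp only [map_monomial, hy]

/-- The pairs `(y i, g i)` in the square zero extension twisted by `(-1) ^ k` satisfy the
commutation relations of the `y i`. By `exists_algHom` they define a homomorphism whose first
component is the identity; its second component is the derivation. -/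
theorem exists_skew_derivation (k : ℤ) (g : Fin r → 𝓔.O U) (hg : ∀ i, g i ∈ degZ 𝓔 U (d i + k)) :
    ∃ D : 𝓔.O U →+ 𝓔.O U, (∀ c, D (algebraMap (SmoothFn n U) (𝓔.O U) c) = 0) ∧ (∀ i, D (y i) = g i) ∧
      (∀ (i : ℕ) (a : 𝓔.O U), a ∈ 𝓔.deg U i → D a ∈ degZ 𝓔 U (i + k)) ∧
      ∀ (i : ℕ) (a b : 𝓔.O U), a ∈ 𝓔.deg U i →
        D (a * b) = D a * b + (k * i).negOnePow • (a * D b) := by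
  let σ := signHom (𝓔.deg U) k.negOnePow
  have hσ : ∀ {i : ℕ} {a : 𝓔.O U}, a ∈ 𝓔.deg U i → σ a = (k * i).negOnePow • a := fun ha => by
    rw [signHom_apply _ _ ha, negOnePow_pow]
  -- Scalars enter through the zero derivation, so that `D` kills the smooth functions.
  let _ : Algebra (SmoothFn n U) (TwistExt (σ : 𝓔.O U →+* 𝓔.O U)) :=
    TwistExt.algebra 0 (fun _ _ => by simp) (fun f => σ.commutes f) (fun _ _ => by simp)
  let z : Fin r → TwistExt (σ : 𝓔.O U →+* 𝓔.O U) := fun i => (y i, g i)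
  have hy : ∀ i j, y i * y j = ((d i : ℤ) * d j).negOnePow • (y j * y i) := fun i j =>
    𝓔.graded_comm U _ _ _ _ (hc.mem i) (hc.mem j)
  have hz : ∀ i j, z i * z j = ((d i : ℤ) * d j).negOnePow • (z j * z i) := fun i j => by
    refine TwistExt.ext (hy i j) ?_
    change g i * y j + σ (y i) * g j
      = ((d i : ℤ) * d j).negOnePow • (g j * y i + σ (y j) * g i)
    rw [hσ (hc.mem i), hσ (hc.mem j), graded_commZ U _ (d j) _ _ (hg i) (hc.mem j),
      graded_commZ U _ (d i) _ _ (hg j) (hc.mem i), smul_mul_assoc, smul_mul_assoc, smul_add,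
      smul_smul, smul_smul, ← Int.negOnePow_add, ← Int.negOnePow_add, add_comm]
    congr 2
    · rw [show (d i : ℤ) * d j + (d j + k) * d i = (d i * d j + d i * d j) + k * d i by ring,
        Int.negOnePow_add, Int.negOnePow_add, Int.units_mul_self, one_mul]
    · congr 1
      ring
  have hodd : ∀ i, Odd (d i) → ((d i : ℤ) * d i).negOnePow = -1 := fun i hi =>
    Int.negOnePow_odd _ (by exact_mod_cast hi.mul hi)
  obtain ⟨φ, hφ⟩ := exists_algHom hc.linearIndependent' hc.span' _ hy
    (fun i hi => eq_zero_of_eq_neg (n := n) (U := U) (by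
      have := hy i i
      rwa [hodd i hi, Units.neg_smul, one_smul] at this)) z hz
    (fun i hi => by
      have := hz i i
      rw [hodd i hi, Units.neg_smul, one_smul] at this
      exact TwistExt.ext (eq_zero_of_eq_neg (n := n) (U := U) (congrArg Prod.fst this))
        (eq_zero_of_eq_neg (n := n) (U := U) (congrArg Prod.snd this)))
  have hfst : ∀ a, (φ a).1 = a := by
    refine fun a => RingHom.congr_fun (hc.ringHom_ext
      ((TwistExt.fstHom (σ : 𝓔.O U →+* 𝓔.O U)).comp (φ : 𝓔.O U →+* TwistExt (σ : 𝓔.O U →+* 𝓔.O U)))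
      (RingHom.id _)
      (fun c => ?_) fun i => ?_) a
    · change (φ (algebraMap (SmoothFn n U) (𝓔.O U) c)).1 = _
      rw [φ.commutes]
      rfl
    · change (φ (y i)).1 = _
      rw [hφ]
      rfl
  have hconst : ∀ c, (φ (algebraMap (SmoothFn n U) (𝓔.O U) c)).2 = 0 := fun c => by
    rw [φ.commutes]
    rfl
  have hleib : ∀ (i : ℕ) (a b : 𝓔.O U), a ∈ 𝓔.deg U i →
      (φ (a * b)).2 = (φ a).2 * b + (k * i).negOnePow • (a * (φ b).2) := fun i a b ha => by
    rw [map_mul, TwistExt.snd_mul, hfst, hfst]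
    change _ + σ a * _ = _
    rw [hσ ha, smul_mul_assoc]
  refine ⟨(TwistExt.sndHom _).comp (φ : 𝓔.O U →+* TwistExt (σ : 𝓔.O U →+* 𝓔.O U)).toAddMonoidHom,
    hconst, fun i => ?_, fun i a ha => ?_, hleib⟩
  · change (φ (y i)).2 = g i
    rw [hφ]
  · change (φ a).2 ∈ _
    let S : Submodule (SmoothFn n U) (𝓔.O U) :=
      { carrier := {a | (φ a).2 ∈ degZ 𝓔 U (i + k)}
        zero_mem' := by
          change (φ 0).2 ∈ degZ 𝓔 U (i + k)
          rw [map_zero]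
          exact Submodule.zero_mem _
        add_mem' := fun {a b} ha hb => by
          change (φ (a + b)).2 ∈ degZ 𝓔 U (i + k)
          rw [map_add]
          exact Submodule.add_mem _ ha hb
        smul_mem' := fun c a ha => by
          change (φ (c • a)).2 ∈ degZ 𝓔 U (i + k)
          rw [Algebra.smul_def, hleib 0 _ _ (SetLike.algebraMap_mem_graded _ _), hconst]
          simp only [zero_mul, Nat.cast_zero, mul_zero, Int.negOnePow_zero, one_smul, zero_add]
          rw [← Algebra.smul_def]
          exact Submodule.smul_mem _ c ha }
    suffices h : _ ≤ S from h (hc.mem_span_of_mem_deg ha)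
    rw [Submodule.span_le]
    rintro _ ⟨m, hm, rfl⟩
    -- The degree of `a` is carried along with that of its derivative, since moving `g j` past `b`
    -- uses the degree of `b`.
    have := monomial_mul_mem y d
      (fun l => {a | a ∈ 𝓔.deg U l ∧ (φ a).2 ∈ degZ 𝓔 U (l + k)})
      (fun j l b hb => by
        refine ⟨SetLike.mul_mem_graded (hc.mem j) hb.1, ?_⟩
        rw [hleib _ _ _ (hc.mem j), hφ]
        refine Submodule.add_mem _ ?_ ?_
        · rw [graded_commZ U (d j + k) l (g j) b (hg j) hb.1]
          have := mul_mem_degZ hb.1 (hg j)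
          rw [show (l : ℤ) + (d j + k) = ((d j + l : ℕ) : ℤ) + k by push_cast; ring] at this
          exact zsmul_mem this _
        · have := mul_mem_degZ (hc.mem j) hb.2
          rw [show (d j : ℤ) + (l + k) = ((d j + l : ℕ) : ℤ) + k by push_cast; ring] at this
          exact zsmul_mem this _) m.1 0 1
      ⟨SetLike.GradedOne.one_mem, by
        rw [← map_one (algebraMap (SmoothFn n U) (𝓔.O U)), hconst]
        exact Submodule.zero_mem _⟩
    rw [add_zero, mul_one, hm] at this
    exact this.2

end IsCoordinates

end CoordinateDomains

/-! ### Coordinate vector fields and frames of `E`. -/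

section CoordinateVectorFields

variable {n : ℕ} {M : Type v} [TopologicalSpace M]
  [ChartedSpace (EuclideanSpace ℝ (Fin n)) M] {𝓔 : GradedManifold.{u, v} n M}

theorem eq_zero_of_mem_degZ_neg {U : Opens M} {k : ℤ} (hk : k < 0) {a : 𝓔.O U}
    (ha : a ∈ degZ 𝓔 U k) : a = 0 := by
  rcases degZ_cases ha with h | ⟨i, rfl, -⟩
  · exact h
  · omega

theorem res_mem_degZ {U W : Opens M} (h : W ≤ U) {k : ℤ} {a : 𝓔.O U} (ha : a ∈ degZ 𝓔 U k) :
    𝓔.res h a ∈ degZ 𝓔 W k := by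
  rcases degZ_cases ha with rfl | ⟨i, rfl, hi⟩
  · rw [map_zero]; exact Submodule.zero_mem _
  · exact 𝓔.res_mem_deg h i a hi

section App

variable {U : Opens M} {k : ℤ} (X Y : Der 𝓔 U k) {W : Opens M} (h : W ≤ U)

theorem app_add (a b : 𝓔.O W) : app X h (a + b) = app X h a + app X h b := map_add _ _ _

theorem app_zero : app X h 0 = 0 := map_zero _

theorem app_sum {ι : Type*} (s : Finset ι) (a : ι → 𝓔.O W) :
    app X h (∑ i ∈ s, a i) = ∑ i ∈ s, app X h (a i) := map_sum _ _ _

theorem res_app {W' : Opens M} (h' : W' ≤ W) (a : 𝓔.O W) :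
    𝓔.res h' (app X h a) = app X (h'.trans h) (𝓔.res h' a) :=
  X.2.res ⟨W, h⟩ ⟨W', h'.trans h⟩ h' a

theorem app_mul {i : ℕ} {a : 𝓔.O W} (ha : a ∈ 𝓔.deg W i) (b : 𝓔.O W) :
    app X h (a * b) = app X h a * b + (k * i).negOnePow • (a * app X h b) :=
  X.2.leibniz ⟨W, h⟩ i a b ha

theorem app_mem {i : ℕ} {a : 𝓔.O W} (ha : a ∈ 𝓔.deg W i) : app X h a ∈ degZ 𝓔 W (i + k) :=
  X.2.degree ⟨W, h⟩ i a ha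

variable {X Y} in
theorem Der.ext (e : ∀ (W : Opens M) (h : W ≤ U) (a : 𝓔.O W), app X h a = app Y h a) : X = Y :=
  Subtype.ext (funext fun W => AddMonoidHom.ext fun a => e W.1 W.2 a)

theorem app_algebraMap_of_neg (hk : k < 0) (c : SmoothFn n W) :
    app X h (algebraMap _ (𝓔.O W) c) = 0 :=
  eq_zero_of_mem_degZ_neg (by simpa using hk)
    (app_mem X h (SetLike.algebraMap_mem_graded (𝓔.deg W) c))

theorem app_smul (c : SmoothFn n W) (a : 𝓔.O W) :
    app X h (c • a) = app X h (algebraMap _ (𝓔.O W) c) * a + c • app X h a := by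
  rw [Algebra.smul_def, app_mul X h (SetLike.algebraMap_mem_graded (𝓔.deg W) c),
    Algebra.smul_def]
  simp

theorem app_smul_of_neg (hk : k < 0) (c : SmoothFn n W) (a : 𝓔.O W) :
    app X h (c • a) = c • app X h a := by
  rw [app_smul, app_algebraMap_of_neg X h hk, zero_mul, zero_add]

/-- Transport of vector fields along an equality of degrees. -/
def Der.cast {l : ℤ} (e : k = l) (X : Der 𝓔 U k) : Der 𝓔 U l := e ▸ X

theorem app_cast {l : ℤ} (e : k = l) (a : 𝓔.O W) : app (Der.cast e X) h a = app X h a := by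
  subst e; rfl

theorem form_cast_left (Ω : SymplecticForm 𝓔) {l : ℤ} (e : k = l) {m : ℤ} (Z : Der 𝓔 U m) :
    Ω.form U l m (Der.cast e X) Z = Ω.form U k m X Z := by
  subst e; rfl

theorem app_sum_left {ι : Type*} (s : Finset ι) (F : ι → Der 𝓔 U k) (a : 𝓔.O W) :
    app (∑ i ∈ s, F i) h a = ∑ i ∈ s, app (F i) h a := by
  classical
  induction s using Finset.induction_on with
  | empty => simp; rfl
  | insert i s hi ih => rw [Finset.sum_insert hi, Finset.sum_insert hi, ← ih]; rfl

theorem app_smulDer {i : ℕ} (f : 𝓔.O U) (hf : f ∈ 𝓔.deg U i) (a : 𝓔.O W) :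
    app (smulDer f hf X) h a = 𝓔.res h f * app X h a := rfl

end App

namespace IsCoordinates

variable {U : Opens M} {r : ℕ} {d : Fin r → ℕ} {y : Fin r → 𝓔.O U}
  (hc : IsCoordinates 𝓔.toGradedPresheaf U d y)

include hc

/-- A derivation is built over each smaller open set from the restricted coordinates. These are
compatible with restriction because a skew derivation vanishing on `C^∞` and on the coordinates is
zero. -/
theorem exists_der (k : ℤ) (g : Fin r → 𝓔.O U) (hg : ∀ i, g i ∈ degZ 𝓔 U (d i + k)) :
    ∃ D : Der 𝓔 U k, (∀ i, app D le_rfl (y i) = g i) ∧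
      ∀ (W : Opens M) (h : W ≤ U) (c : SmoothFn n W), app D h (algebraMap _ (𝓔.O W) c) = 0 := by
  choose D hD using fun W : {W : Opens M // W ≤ U} =>
    (hc.restrict W.2).exists_skew_derivation (𝓔 := 𝓔) k (fun i => 𝓔.res W.2 (g i))
      (fun i => res_mem_degZ W.2 (hg i))
  have hres : ∀ (W W' : {W : Opens M // W ≤ U}) (h : W'.1 ≤ W.1) (a : 𝓔.O W.1),
      𝓔.res h (D W a) = D W' (𝓔.res h a) := by
    intro W W' h a
    have := (hc.restrict W.2).eq_zero_of_leibniz (𝓔 := 𝓔) (𝓔.res h)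
      ((𝓔.res h).toAddMonoidHom.comp (D W) - (D W').comp (𝓔.res h).toAddMonoidHom) k.negOnePow
      (fun i a b ha => by
        change 𝓔.res h (D W (a * b)) - D W' (𝓔.res h (a * b))
          = (𝓔.res h (D W a) - D W' (𝓔.res h a)) * 𝓔.res h b
            + k.negOnePow ^ i • (𝓔.res h a * (𝓔.res h (D W b) - D W' (𝓔.res h b)))
        rw [(hD W).2.2.2 i a b ha, map_mul, (hD W').2.2.2 i _ _ (𝓔.res_mem_deg h i a ha), map_add,
          map_mul, Units.smul_def, map_zsmul, ← Units.smul_def, map_mul, negOnePow_pow, sub_mul,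
          mul_sub, smul_sub]
        abel)
      (fun c => by
        change 𝓔.res h (D W _) - D W' (𝓔.res h _) = 0
        rw [(hD W).1, 𝓔.res_algebraMap, (hD W').1, map_zero, sub_zero])
      (fun i => by
        change 𝓔.res h (D W _) - D W' (𝓔.res h _) = 0
        rw [(hD W).2.1, 𝓔.res_res W.2, 𝓔.res_res W.2, (hD W').2.1, sub_self])
    exact sub_eq_zero.1 (DFunLike.congr_fun this a)
  refine ⟨⟨D, ⟨hres, fun W c => (hD W).1 _, fun W i a ha => (hD W).2.2.1 i a ha,
    fun W i a b ha => (hD W).2.2.2 i a b ha⟩⟩, fun i => ?_, fun W h c => (hD ⟨W, h⟩).1 c⟩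
  have := (hD ⟨U, le_rfl⟩).2.1 i
  rwa [𝓔.res_self, 𝓔.res_self] at this

/-- A field of negative degree kills `C^∞` for degree reasons, so its values on the coordinates are
all there is to know. For `k ≥ 0` the action on `C^∞` would be further data. -/
theorem der_ext {k : ℤ} (hk : k < 0) {X Y : Der 𝓔 U k}
    (hXY : ∀ i, app X le_rfl (y i) = app Y le_rfl (y i)) : X = Y := by
  refine Der.ext fun W h a => ?_
  have := (hc.restrict h).eq_zero_of_leibniz (𝓔 := 𝓔) (RingHom.id _)
    (X.1 ⟨W, h⟩ - Y.1 ⟨W, h⟩) k.negOnePow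
    (fun i a b ha => by
      change app X h (a * b) - app Y h (a * b) = (app X h a - app Y h a) * b
        + k.negOnePow ^ i • (a * (app X h b - app Y h b))
      rw [app_mul X h ha, app_mul Y h ha, negOnePow_pow, sub_mul, mul_sub, smul_sub]
      abel)
    (fun c => by
      change app X h _ - app Y h _ = 0
      rw [app_algebraMap_of_neg X h hk, app_algebraMap_of_neg Y h hk, sub_zero])
    (fun i => by
      change app X h _ - app Y h _ = 0
      rw [← res_app X le_rfl h, ← res_app Y le_rfl h, hXY, sub_self])
  exact sub_eq_zero.1 (DFunLike.congr_fun this a)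

/-- The symplectic form on vector fields of degree `-1` depends only on their action on functions
of degree 1. -/
theorem form_eq_zero (Ω : SymplecticForm 𝓔) (Z Y : Der 𝓔 U (-1))
    (hZ : ∀ i, d i = 1 → app Z le_rfl (y i) = 0) : Ω.form U (-1) (-1) Z Y = 0 := by
  classical
  -- `P j` is the coordinate field `∂/∂yⱼ`, of degree `-d j`.
  have hP := fun j => hc.exists_der (𝓔 := 𝓔) (-(d j : ℤ)) (Pi.single j 1) (fun i => by
    by_cases h : i = j
    · subst h
      rw [Pi.single_eq_same, add_neg_cancel]
      exact SetLike.GradedOne.one_mem (A := 𝓔.deg U)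
    · rw [Pi.single_eq_of_ne h]
      exact Submodule.zero_mem _)
  choose P hP1 hP2 using hP
  have hmem : ∀ j, app Z le_rfl (y j) ∈ 𝓔.deg U (d j - 1) := fun j => by
    have := app_mem Z le_rfl (hc.mem j)
    rw [show (d j : ℤ) + -1 = ((d j - 1 : ℕ) : ℤ) by have := hc.pos j; omega] at this
    exact this
  have hdeg : ∀ j, ((d j - 1 : ℕ) : ℤ) + -(d j : ℤ) = -1 := fun j => by
    have := hc.pos j; omega
  -- This is `Z = Σ Z(yⱼ) ∂/∂yⱼ`; the cast identifies the degree `(d j - 1) - d j` with `-1`.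
  have hsum : Z = ∑ j, Der.cast (hdeg j) (smulDer _ (hmem j) (P j)) := by
    refine hc.der_ext (by norm_num) fun i => ?_
    rw [app_sum_left, Finset.sum_eq_single i]
    · rw [app_cast, app_smulDer, hP1, Pi.single_eq_same, mul_one, 𝓔.res_self]
    · intro j _ hj
      rw [app_cast, app_smulDer, hP1, Pi.single_eq_of_ne hj.symm, mul_zero]
    · simp
  rw [hsum, map_sum, AddMonoidHom.finsetSum_apply]
  refine Finset.sum_eq_zero fun j _ => ?_
  rw [form_cast_left, Ω.smul_left]
  by_cases hj : d j = 1
  · rw [hZ j hj, zero_mul]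
  -- For `d j ≥ 2` the function `ω(∂/∂yⱼ, Y)` has degree `-d j - 1 + 2 < 0`, hence vanishes. This is
  -- where the degree of `ω` being 2 matters.
  · rw [eq_zero_of_mem_degZ_neg _ (Ω.degree U _ _ (P j) Y), mul_zero]
    have := hc.pos j
    omega

end IsCoordinates

/-- A frame of the functions of degree 1, with dual vector fields of degree `-1`. -/
structure Frame (𝓔 : GradedManifold.{u, v} n M) (U : Opens M) where
  I : Type
  [fintype : Fintype I]
  y : I → 𝓔.O U
  mem : ∀ i, y i ∈ 𝓔.deg U 1
  der : I → Der 𝓔 U (-1)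
  expand : ∀ (W : Opens M) (h : W ≤ U) (f : 𝓔.O W), f ∈ 𝓔.deg W 1 →
    f = ∑ i, app (der i) h f * 𝓔.res h (y i)
  form_expand : ∀ (Ω : SymplecticForm 𝓔) (X Y : Der 𝓔 U (-1)),
    Ω.form U (-1) (-1) X Y = ∑ i, app X le_rfl (y i) * Ω.form U (-1) (-1) (der i) Y

attribute [instance] Frame.fintype

theorem app_mem_deg_zero {U W : Opens M} (X : Der 𝓔 U (-1)) (h : W ≤ U) {f : 𝓔.O W}
    (hf : f ∈ 𝓔.deg W 1) : app X h f ∈ 𝓔.deg W 0 := by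
  have := app_mem X h hf
  rwa [show ((1 : ℕ) : ℤ) + -1 = ((0 : ℕ) : ℤ) by norm_num] at this

theorem IsCoordDomain.nonempty_frame {U : Opens M} (hU : IsCoordDomain 𝓔.toGradedPresheaf U) :
    Nonempty (Frame 𝓔 U) := by
  classical
  obtain ⟨r, d, y, hc⟩ := hU
  have hP := fun j : {i : Fin r // d i = 1} => hc.exists_der (𝓔 := 𝓔) (-1) (Pi.single j.1 1)
    (fun i => by
      by_cases h : i = j.1
      · subst h
        rw [Pi.single_eq_same, j.2]
        exact SetLike.GradedOne.one_mem (A := 𝓔.deg U)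
      · rw [Pi.single_eq_of_ne h]
        exact Submodule.zero_mem _)
  choose P hP1 hP2 using hP
  have hmem : ∀ i : {i : Fin r // d i = 1}, y i.1 ∈ 𝓔.deg U 1 := fun i => by
    have := hc.mem i.1
    rwa [i.2] at this
  refine ⟨⟨{i : Fin r // d i = 1}, fun i => y i.1, fun i => hmem i, P, ?_, ?_⟩⟩
  · intro W h f hf
    have hf' := (hc.restrict h).mem_span_of_mem_deg_one (𝓔 := 𝓔) hf
    clear hf
    induction hf' using Submodule.span_induction with
    | zero => simp [app_zero]
    | add a b _ _ ha hb =>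
      simp only [app_add, add_mul, Finset.sum_add_distrib]
      rw [← ha, ← hb]
    | smul c a _ ha =>
      simp only [app_smul_of_neg _ h (show (-1 : ℤ) < 0 by norm_num), smul_mul_assoc]
      rw [← Finset.smul_sum, ← ha]
    | mem _ hx =>
      obtain ⟨j, rfl⟩ := hx
      rw [Finset.sum_eq_single j]
      · rw [← res_app (P j) le_rfl h, hP1, Pi.single_eq_same, map_one, one_mul]
      · intro i _ hi
        rw [← res_app (P i) le_rfl h, hP1, Pi.single_eq_of_ne, map_zero, zero_mul]
        exact fun h => hi (Subtype.ext h.symm)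
      · simp
  · intro Ω X Y
    have hm : ∀ i : {i : Fin r // d i = 1}, app X le_rfl (y i.1) ∈ 𝓔.deg U 0 := fun i =>
      app_mem_deg_zero X le_rfl (hmem i)
    have hdeg : ((0 : ℕ) : ℤ) + -1 = -1 := by norm_num
    -- `X` minus its expansion kills the coordinates of degree 1. It may still act on those of
    -- degree 2, which `form_eq_zero` allows.
    have key := hc.form_eq_zero Ω
      (X - ∑ i : {i : Fin r // d i = 1}, Der.cast hdeg (smulDer _ (hm i) (P i))) Y (fun i hi => by
        change app X le_rfl (y i) - app (∑ i : {i : Fin r // d i = 1},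
          Der.cast hdeg (smulDer _ (hm i) (P i))) le_rfl (y i) = 0
        rw [app_sum_left, Finset.sum_eq_single ⟨i, hi⟩]
        · rw [app_cast, app_smulDer, hP1, Pi.single_eq_same, mul_one, 𝓔.res_self, sub_self]
        · intro j _ hj
          rw [app_cast, app_smulDer, hP1, Pi.single_eq_of_ne, mul_zero]
          exact fun h => hj (Subtype.ext h.symm)
        · simp)
    rw [map_sub, AddMonoidHom.sub_apply, sub_eq_zero, map_sum,
      AddMonoidHom.finsetSum_apply] at key
    rw [key]
    refine Finset.sum_congr rfl fun i _ => ?_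
    rw [form_cast_left, Ω.smul_left]

/-- The chosen frame of a coordinate domain. -/
def IsCoordDomain.frame {U : Opens M} (hU : IsCoordDomain 𝓔.toGradedPresheaf U) : Frame 𝓔 U :=
  hU.nonempty_frame.some

/-- Functions of degree 0 on a coordinate domain are smooth functions. -/
def IsCoordDomain.body {U : Opens M} (hU : IsCoordDomain 𝓔.toGradedPresheaf U) :
    𝓔.deg U 0 →ₗ[SmoothFn n U] SmoothFn n U :=
  (LinearEquiv.ofBijective ((Algebra.linearMap (SmoothFn n U) (𝓔.O U)).codRestrict (𝓔.deg U 0)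
    fun c => SetLike.algebraMap_mem_graded (𝓔.deg U) c) ⟨fun a b h => by
      obtain ⟨r, d, y, hc⟩ := hU
      exact hc.algebraMap_injective (congrArg Subtype.val h), fun a => by
      obtain ⟨r, d, y, hc⟩ := hU
      obtain ⟨c, h⟩ := hc.exists_of_mem_deg_zero a.2
      exact ⟨c, Subtype.ext h⟩⟩).symm.toLinearMap

theorem IsCoordDomain.algebraMap_body {U : Opens M} (hU : IsCoordDomain 𝓔.toGradedPresheaf U)
    (a : 𝓔.deg U 0) : algebraMap _ (𝓔.O U) (hU.body a) = a :=
  congrArg Subtype.val (LinearEquiv.apply_symm_apply (LinearEquiv.ofBijective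
    ((Algebra.linearMap (SmoothFn n U) (𝓔.O U)).codRestrict (𝓔.deg U 0) _) _) a)

theorem IsCoordDomain.algebraMap_injective {U : Opens M}
    (hU : IsCoordDomain 𝓔.toGradedPresheaf U) :
    Function.Injective (algebraMap (SmoothFn n U) (𝓔.O U)) := by
  obtain ⟨r, d, y, hc⟩ := hU
  exact hc.algebraMap_injective

/-- The section of `E` given by a vector field of degree `-1`. -/
def IsCoordDomain.secOfDer {U : Opens M} (hU : IsCoordDomain 𝓔.toGradedPresheaf U)
    (X : Der 𝓔 U (-1)) : SecE 𝓔 U :=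
  ⟨fun W => (hU.mono W.2).body ∘ₗ
      ({ toFun := fun f => ⟨app X W.2 f, app_mem_deg_zero X W.2 f.2⟩
         map_add' := fun f g => Subtype.ext (app_add X W.2 _ _)
         map_smul' := fun c f => Subtype.ext (app_smul_of_neg X W.2 (by norm_num) c _) } :
        𝓔.deg W.1 1 →ₗ[SmoothFn n W.1] 𝓔.deg W.1 0),
    fun W W' h f => (hU.mono W'.2).algebraMap_injective (by
      rw [← 𝓔.res_algebraMap, LinearMap.comp_apply, LinearMap.comp_apply,
        IsCoordDomain.algebraMap_body, IsCoordDomain.algebraMap_body]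
      exact res_app X W.2 h _)⟩

theorem IsCoordDomain.algebraMap_pair_secOfDer {U : Opens M}
    (hU : IsCoordDomain 𝓔.toGradedPresheaf U) (X : Der 𝓔 U (-1)) {W : Opens M} (h : W ≤ U)
    (f : 𝓔.deg W 1) :
    algebraMap _ (𝓔.O W) (pair (hU.secOfDer X) h f) = app X h f :=
  (hU.mono h).algebraMap_body _

end CoordinateVectorFields

/-! ### Bump functions, and gluing and extension of sections of `E`. -/

section Gluing

variable {n : ℕ} {M : Type v} [TopologicalSpace M]
  [ChartedSpace (EuclideanSpace ℝ (Fin n)) M] {𝓔 : GradedManifold.{u, v} n M}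

theorem exists_smoothFn {U : Opens M} (g : M → ℝ)
    (hg : ∀ x ∈ U, ∃ W : Opens M, x ∈ W ∧ ∃ f : SmoothFn n W,
      ∀ (y : M) (hy : y ∈ W), y ∈ U → g y = f ⟨y, hy⟩) :
    ∃ F : SmoothFn n U, ∀ (y : M) (hy : y ∈ U), F ⟨y, hy⟩ = g y := by
  refine ⟨⟨fun y => g y, fun x => ?_⟩, fun _ _ => rfl⟩
  rw [contMDiffAt_subtype_iff]
  obtain ⟨W, hxW, f, hf⟩ := hg x x.2
  classical
  let f' : M → ℝ := fun y => if hy : y ∈ W then f ⟨y, hy⟩ else 0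
  have h1 : ContMDiffAt (𝓡 n) 𝓘(ℝ) ∞ f' x := by
    have := f.contMDiff ⟨x, hxW⟩
    have e : (f : W → ℝ) = fun y : W => f' y := by
      funext y
      simp [f']
    rw [e] at this
    exact (contMDiffAt_subtype_iff (x := (⟨x, hxW⟩ : W))).1 this
  refine h1.congr_of_eventuallyEq ?_
  filter_upwards [W.isOpen.mem_nhds hxW, U.isOpen.mem_nhds x.2] with y hy hyU
  rw [hf y hy hyU]
  simp only [f']
  rw [dif_pos (show y ∈ W from hy)]

/-- The condition `U ⊔ V = ⊤` allows `χ • s`, for a section `s` over `U`, to be glued with the zero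
section over `V`. -/
theorem exists_bump [IsManifold (𝓡 n) ∞ M] [T2Space M] {U : Opens M} {x : M} (hx : x ∈ U) :
    ∃ (χ : SmoothFn n (⊤ : Opens M)) (W V : Opens M), x ∈ W ∧ W ≤ U ∧ U ⊔ V = ⊤ ∧
      (resFn n le_top χ : SmoothFn n W) = 1 ∧ (resFn n le_top χ : SmoothFn n V) = 0 := by
  obtain ⟨f, -, hf⟩ := (SmoothBumpFunction.nhds_basis_tsupport (I := 𝓡 n) x).mem_iff.1
    (U.isOpen.mem_nhds hx)
  obtain ⟨W', hW', hW'o, hxW'⟩ := mem_nhds_iff.1 f.eventuallyEq_one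
  refine ⟨⟨fun y => f y, f.contMDiff.comp contMDiff_subtype_val⟩, ⟨W', hW'o⟩ ⊓ U,
    ⟨(tsupport f)ᶜ, (isClosed_tsupport f).isOpen_compl⟩, ⟨hxW', hx⟩, inf_le_right, ?_, ?_, ?_⟩
  · rw [eq_top_iff]
    intro y _
    by_cases hy : y ∈ tsupport f
    · exact Or.inl (hf hy)
    · exact Or.inr hy
  · ext y
    exact hW' y.2.1
  · ext y
    exact image_eq_zero_of_notMem_tsupport (f := f) y.2

/-- Restriction of functions of degree 1. -/
def resDeg {U W : Opens M} (h : W ≤ U) (f : 𝓔.deg U 1) : 𝓔.deg W 1 :=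
  ⟨𝓔.res h f, 𝓔.res_mem_deg h 1 f f.2⟩

theorem resFn_pair {U W V : Opens M} (s : SecE 𝓔 U) (h : W ≤ U) (h' : V ≤ W) (f : 𝓔.deg W 1) :
    resFn n h' (pair s h f) = pair s (h'.trans h) (resDeg h' f) :=
  s.2 ⟨W, h⟩ ⟨V, h'.trans h⟩ h' f

theorem pair_apply {U W V : Opens M} (s : SecE 𝓔 U) (h : W ≤ U) (h' : V ≤ W) (f : 𝓔.deg W 1)
    {x : M} (hx : x ∈ V) :
    pair s h f ⟨x, h' hx⟩ = pair s (h'.trans h) (resDeg h' f) ⟨x, hx⟩ := by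
  rw [← resFn_pair]
  rfl

theorem resDeg_resDeg {U W V : Opens M} (h : W ≤ U) (h' : V ≤ W) (f : 𝓔.deg U 1) :
    resDeg h' (resDeg h f) = resDeg (h'.trans h) f :=
  Subtype.ext (𝓔.res_res h h' _)

theorem resDeg_add {U W : Opens M} (h : W ≤ U) (f g : 𝓔.deg U 1) :
    resDeg h (f + g) = resDeg h f + resDeg h g :=
  Subtype.ext (map_add (𝓔.res h) _ _)

theorem resDeg_smul {U W : Opens M} (h : W ≤ U) (c : SmoothFn n U) (f : 𝓔.deg U 1) :
    resDeg h (c • f) = resFn n h c • resDeg h f :=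
  Subtype.ext (𝓔.res_smul h c _)

theorem SmoothFn.ext_local {U : Opens M} {f g : SmoothFn n U}
    (e : ∀ x ∈ U, ∃ (W : Opens M) (h : W ≤ U), x ∈ W ∧ resFn n h f = resFn n h g) : f = g := by
  ext x
  obtain ⟨W, h, hx, e⟩ := e x x.2
  exact congrArg (fun f : SmoothFn n W => f ⟨x, hx⟩) e

/-- Sections of `E` form a sheaf. -/
theorem SecE.exists_glue {U : Opens M} {J : Type*} (W : J → Opens M) (hU : ∀ x ∈ U, ∃ j, x ∈ W j)
    (s : ∀ j, SecE 𝓔 (W j))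
    (hs : ∀ (i j : J) (V : Opens M) (hi : V ≤ W i) (hj : V ≤ W j) (f : 𝓔.deg V 1),
      pair (s i) hi f = pair (s j) hj f) :
    ∃ t : SecE 𝓔 U, ∀ (j : J) (V : Opens M) (h : V ≤ U) (hj : V ≤ W j) (f : 𝓔.deg V 1),
      pair t h f = pair (s j) hj f := by
  classical
  have main : ∀ (V : {V : Opens M // V ≤ U}) (f : 𝓔.deg V.1 1), ∃ F : SmoothFn n V.1,
      ∀ (j : J) (x : M) (hx : x ∈ V.1 ⊓ W j),
        F ⟨x, hx.1⟩ = pair (s j) inf_le_right (resDeg inf_le_left f) ⟨x, hx⟩ := by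
    intro V f
    -- The value at `x` is read off from an arbitrary section defined near `x`. By `hg` the choice
    -- is irrelevant, so near each point the function coincides with a smooth one.
    choose j hj using fun x : V.1 => hU x (V.2 x.2)
    let g : M → ℝ := fun x => if h : x ∈ V.1 then
      pair (s (j ⟨x, h⟩)) inf_le_right (resDeg (inf_le_left : V.1 ⊓ W (j ⟨x, h⟩) ≤ V.1) f)
        ⟨x, h, hj ⟨x, h⟩⟩ else 0
    have hg : ∀ (i : J) (x : M) (hx : x ∈ V.1 ⊓ W i),
        g x = pair (s i) inf_le_right (resDeg inf_le_left f) ⟨x, hx⟩ := by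
      intro i x hx
      have h : x ∈ V.1 := hx.1
      simp only [g, dif_pos h]
      have hx' : x ∈ (V.1 ⊓ W (j ⟨x, h⟩)) ⊓ (V.1 ⊓ W i) := ⟨⟨h, hj ⟨x, h⟩⟩, hx⟩
      rw [pair_apply (s (j ⟨x, h⟩)) inf_le_right inf_le_left _ hx',
        pair_apply (s i) inf_le_right inf_le_right _ hx', resDeg_resDeg, resDeg_resDeg,
        hs (j ⟨x, h⟩) i _ _ (inf_le_right.trans inf_le_right)]
    obtain ⟨F, hF⟩ := exists_smoothFn (n := n) (U := V.1) g (fun x hx =>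
      ⟨V.1 ⊓ W (j ⟨x, hx⟩), ⟨hx, hj ⟨x, hx⟩⟩, _, fun y hy _ => hg _ y hy⟩)
    exact ⟨F, fun i x hx => (hF x hx.1).trans (hg i x hx)⟩
  choose F hF using main
  refine ⟨⟨fun V =>
    { toFun := F V
      map_add' := fun f g => ?_
      map_smul' := fun c f => ?_ }, fun V V' h f => ?_⟩, fun j V h hj f => ?_⟩
  · ext ⟨x, hx⟩
    obtain ⟨j, hj⟩ := hU x (V.2 hx)
    rw [ContMDiffMap.coe_add, Pi.add_apply, hF V _ j x ⟨hx, hj⟩, hF V f j x ⟨hx, hj⟩,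
      hF V g j x ⟨hx, hj⟩, resDeg_add, map_add]
    rfl
  · ext ⟨x, hx⟩
    obtain ⟨j, hj⟩ := hU x (V.2 hx)
    rw [RingHom.id_apply, smul_eq_mul, ContMDiffMap.coe_mul, Pi.mul_apply, hF V _ j x ⟨hx, hj⟩,
      hF V f j x ⟨hx, hj⟩, resDeg_smul, map_smul]
    rfl
  · ext ⟨x, hx⟩
    obtain ⟨j, hj⟩ := hU x (V'.2 hx)
    have h1 := hF V f j x ⟨h hx, hj⟩
    have h2 := hF V' (resDeg h f) j x ⟨hx, hj⟩
    change F V f ⟨x, h hx⟩ = F V' (resDeg h f) ⟨x, hx⟩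
    rw [h1, h2, pair_apply (s j) inf_le_right (inf_le_inf_right (W j) h) _ ⟨hx, hj⟩,
      resDeg_resDeg, resDeg_resDeg]
  · ext ⟨x, hx⟩
    change F ⟨V, h⟩ f ⟨x, hx⟩ = _
    rw [hF ⟨V, h⟩ f j x ⟨hx, hj hx⟩, ← pair_apply (s j) hj inf_le_left f ⟨hx, hj hx⟩]

/-- Two sections of `E` agree over an open set. -/
def AgreeOn {U U' : Opens M} (V : Opens M) (s : SecE 𝓔 U) (t : SecE 𝓔 U') : Prop :=
  ∀ (W : Opens M) (_ : W ≤ V) (h : W ≤ U) (h' : W ≤ U') (f : 𝓔.deg W 1), pair s h f = pair t h' f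

theorem SecE.ext_local {U : Opens M} {s t : SecE 𝓔 U}
    (e : ∀ x ∈ U, ∃ W : Opens M, x ∈ W ∧ AgreeOn W s t) : s = t := by
  refine SecE.ext fun W h f => SmoothFn.ext_local fun x hx => ?_
  obtain ⟨V, hxV, hV⟩ := e x (h hx)
  refine ⟨V ⊓ W, inf_le_right, ⟨hxV, hx⟩, ?_⟩
  rw [resFn_pair, resFn_pair]
  exact hV _ inf_le_left _ _ _

/-- Germs of sections of `E` extend to global sections. -/
theorem SecE.exists_extension [IsManifold (𝓡 n) ∞ M] [T2Space M] {U : Opens M} (s : SecE 𝓔 U)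
    {x : M} (hx : x ∈ U) :
    ∃ (t : SecE 𝓔 ⊤) (W : Opens M), x ∈ W ∧ W ≤ U ∧ AgreeOn W t s := by
  obtain ⟨χ, W, V, hxW, hWU, hUV, h1, h0⟩ := exists_bump (n := n) hx
  let W' : Bool → Opens M := fun b => if b then U else V
  let s' : ∀ b, SecE 𝓔 (W' b) := fun b => match b with
    | true => (resFn n le_top χ : SmoothFn n U) • s
    | false => (0 : SecE 𝓔 V)
  have hzero : ∀ (V' : Opens M) (hV : V' ≤ V) (hU : V' ≤ U) (f : 𝓔.deg V' 1),
      pair ((resFn n le_top χ : SmoothFn n U) • s) hU f = pair (0 : SecE 𝓔 V) hV f := by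
    intro V' hV hU f
    rw [pair_smul, resFn_resFn, LinearMap.smul_apply, ← resFn_resFn le_top hV, h0, map_zero,
      zero_smul]
    rfl
  obtain ⟨t, ht⟩ := SecE.exists_glue (U := ⊤) W' (fun y _ => by
      have : y ∈ U ⊔ V := by rw [hUV]; trivial
      rcases this with h | h
      · exact ⟨true, h⟩
      · exact ⟨false, h⟩) s' (fun i j V' hi hj f => by
      cases i <;> cases j
      · rfl
      · exact (hzero V' hi hj f).symm
      · exact hzero V' hj hi f
      · rfl)
  refine ⟨t, W, hxW, hWU, fun V' hV' h h' f => ?_⟩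
  rw [ht true V' h h' f]
  change pair ((resFn n le_top χ : SmoothFn n U) • s) h' f = _
  rw [pair_smul, resFn_resFn, LinearMap.smul_apply, ← resFn_resFn le_top hV', h1, map_one,
    one_smul]

end Gluing

/-! ### The splitting of `E` by the involution, and sections of `V₊`. -/

section PlusPart

variable {n : ℕ} {M : Type v} [TopologicalSpace M]
  [ChartedSpace (EuclideanSpace ℝ (Fin n)) M] {𝓔 : GradedManifold.{u, v} n M}
  (ι : BaseInvolution 𝓔)

/-- The action of the involution on functions of degree 1. -/
def invDeg (U : Opens M) : 𝓔.deg U 1 →ₗ[SmoothFn n U] 𝓔.deg U 1 :=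
  (ι.inv U).toLinearMap.restrict fun f hf => ι.inv_mem_deg U 1 f hf

theorem invDeg_invDeg {U : Opens M} (f : 𝓔.deg U 1) : invDeg ι U (invDeg ι U f) = f :=
  Subtype.ext (ι.inv_inv U f)

theorem resDeg_invDeg {U W : Opens M} (h : W ≤ U) (f : 𝓔.deg U 1) :
    resDeg h (invDeg ι U f) = invDeg ι W (resDeg h f) :=
  Subtype.ext (ι.res_inv h f)

/-- The invariant part of a function of degree 1. -/
def plusDual (U : Opens M) : 𝓔.deg U 1 →ₗ[SmoothFn n U] PlusDual ι U :=
  (half n U • ((𝓔.deg U 1).subtype + (𝓔.deg U 1).subtype ∘ₗ invDeg ι U)).codRestrict _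
    fun f => ⟨Submodule.smul_mem _ _ (Submodule.add_mem _ f.2 (invDeg ι U f).2), by
      change ι.inv U (half n U • ((f : 𝓔.O U) + ι.inv U f)) = half n U • ((f : 𝓔.O U) + ι.inv U f)
      rw [map_smul, map_add, ι.inv_inv, add_comm]⟩

theorem coe_plusDual {U : Opens M} (f : 𝓔.deg U 1) :
    (plusDual ι U f : 𝓔.O U) = half n U • ((f : 𝓔.O U) + ι.inv U f) := rfl

theorem plusDual_of_mem {U : Opens M} (ξ : PlusDual ι U) :
    plusDual ι U ⟨ξ, plusDual_le ι U ξ.2⟩ = ξ := by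
  apply Subtype.ext
  rw [coe_plusDual]
  change half n U • ((ξ : 𝓔.O U) + ι.inv U ξ) = ξ
  rw [ξ.2.2, half_smul_add_self]

theorem res_plusDual {U W : Opens M} (h : W ≤ U) (f : 𝓔.deg U 1) :
    PlusDual.res h (plusDual ι U f) = plusDual ι W (resDeg h f) := by
  apply Subtype.ext
  change 𝓔.res h (half n U • ((f : 𝓔.O U) + ι.inv U f))
    = half n W • (𝓔.res h (f : 𝓔.O U) + ι.inv W (𝓔.res h f))
  rw [𝓔.res_smul, map_add, ι.res_inv, resFn_half]

/-- A linear map on invariant functions of degree 1, extended by zero to the anti-invariant ones. -/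
theorem SecPlus.exists_of_pairing {U : Opens M}
    (φ : ∀ W : {W : Opens M // W ≤ U}, PlusDual ι W.1 →ₗ[SmoothFn n W.1] SmoothFn n W.1)
    (hφ : ∀ (W W' : {W : Opens M // W ≤ U}) (h : W'.1 ≤ W.1) (ξ : PlusDual ι W.1),
      resFn n h (φ W ξ) = φ W' (PlusDual.res h ξ)) :
    ∃ u : SecPlus ι U, ∀ (W : Opens M) (h : W ≤ U) (ξ : PlusDual ι W),
      pairPlus u h ξ = φ ⟨W, h⟩ ξ := by
  refine ⟨⟨⟨fun W => φ W ∘ₗ plusDual ι W.1, fun W W' h f => ?_⟩, fun W h f => ?_⟩,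
    fun W h ξ => ?_⟩
  · change resFn n h (φ W (plusDual ι W.1 f)) = φ W' (plusDual ι W'.1 (resDeg h f))
    rw [hφ W W' h, res_plusDual]
  · change φ ⟨W, h⟩ (plusDual ι W (invDeg ι W f)) = φ ⟨W, h⟩ (plusDual ι W f)
    congr 1
    apply Subtype.ext
    rw [coe_plusDual, coe_plusDual]
    change half n W • (ι.inv W f + ι.inv W (ι.inv W f)) = _
    rw [ι.inv_inv, add_comm]
  · change φ ⟨W, h⟩ (plusDual ι W ⟨ξ, plusDual_le ι W ξ.2⟩) = _
    rw [plusDual_of_mem]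

variable {ι}

theorem pair_invDeg {U W : Opens M} (u : SecPlus ι U) (h : W ≤ U) (f : 𝓔.deg W 1) :
    pair u.1 h (invDeg ι W f) = pair u.1 h f :=
  u.2 W h f

/-- An invariant section annihilates anti-invariant functions, so only the invariant part of `f`
contributes. Sections of `V₊` may therefore be tested on `PlusDual` alone. -/
theorem pair_eq_pairPlus {U W : Opens M} (u : SecPlus ι U) (h : W ≤ U) (f : 𝓔.deg W 1) :
    pair u.1 h f = pairPlus u h (plusDual ι W f) := by
  have : pairPlus u h (plusDual ι W f) = pair u.1 h (half n W • (f + invDeg ι W f)) :=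
    rfl
  rw [this, map_smul, map_add, pair_invDeg, half_smul_add_self]

theorem SecPlus.ext {U : Opens M} {u u' : SecPlus ι U}
    (e : ∀ (W : Opens M) (h : W ≤ U) (ξ : PlusDual ι W), pairPlus u h ξ = pairPlus u' h ξ) :
    u = u' :=
  Subtype.ext (SecE.ext fun W h f => by rw [pair_eq_pairPlus, pair_eq_pairPlus, e])

theorem resFn_pairPlus {U W V : Opens M} (u : SecPlus ι U) (h : W ≤ U) (h' : V ≤ W)
    (ξ : PlusDual ι W) :
    resFn n h' (pairPlus u h ξ) = pairPlus u (h'.trans h) (PlusDual.res h' ξ) :=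
  resFn_pair u.1 h h' _

/-- Coordinate domains cover `M` and are stable under shrinking, and equality of smooth functions is
local. -/
theorem SecPlus.ext_coord {U : Opens M} {u u' : SecPlus ι U}
    (e : ∀ (W : Opens M) (h : W ≤ U), IsCoordDomain 𝓔.toGradedPresheaf W → ∀ ξ : PlusDual ι W,
      pairPlus u h ξ = pairPlus u' h ξ) :
    u = u' := by
  refine SecPlus.ext fun W h ξ => SmoothFn.ext_local fun x hx => ?_
  obtain ⟨V, hxV, hV⟩ := 𝓔.locally_free x
  refine ⟨V ⊓ W, inf_le_right, ⟨hxV, hx⟩, ?_⟩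
  rw [resFn_pairPlus, resFn_pairPlus]
  exact e _ _ (hV.mono inf_le_left) _

variable (ι)

/-- The projection of a section of `E` to `V₊`. -/
def SecE.plus {U : Opens M} (s : SecE 𝓔 U) : SecPlus ι U :=
  ⟨⟨fun W => half n W.1 • (s.1 W + s.1 W ∘ₗ invDeg ι W.1), fun W W' h f => by
      change resFn n h (half n W.1 * (pair s W.2 f + pair s W.2 (invDeg ι W.1 f)))
        = half n W'.1 * (pair s W'.2 (resDeg h f) + pair s W'.2 (invDeg ι W'.1 (resDeg h f)))
      rw [map_mul, resFn_half, map_add, resFn_pair, resFn_pair, resDeg_invDeg]⟩,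
    fun W h f => by
      change half n W * (pair s h (invDeg ι W f) + pair s h (invDeg ι W (invDeg ι W f)))
        = half n W * (pair s h f + pair s h (invDeg ι W f))
      rw [invDeg_invDeg, add_comm]⟩

theorem pair_plus {U W : Opens M} (s : SecE 𝓔 U) (h : W ≤ U) (f : 𝓔.deg W 1) :
    pair (SecE.plus ι s).1 h f = half n W • (pair s h f + pair s h (invDeg ι W f)) := rfl

theorem pairPlus_plus {U W : Opens M} (s : SecE 𝓔 U) (h : W ≤ U) (ξ : PlusDual ι W) :
    pairPlus (SecE.plus ι s) h ξ = pair s h ⟨ξ, plusDual_le ι W ξ.2⟩ := by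
  change half n W • (pair s h _ + pair s h (invDeg ι W ⟨ξ, plusDual_le ι W ξ.2⟩)) = _
  have : invDeg ι W ⟨ξ, plusDual_le ι W ξ.2⟩ = ⟨ξ, plusDual_le ι W ξ.2⟩ := Subtype.ext ξ.2.2
  rw [this]
  exact half_smul_add_self _

variable {ι}

/-- An extension of `u` as a section of `E` may leave `V₊`. Projecting it to `V₊` changes nothing
where it agrees with `u`. -/
theorem SecPlus.exists_extension [IsManifold (𝓡 n) ∞ M] [T2Space M] {U : Opens M}
    (u : SecPlus ι U) {x : M} (hx : x ∈ U) :
    ∃ (t : SecPlus ι ⊤) (W : Opens M), x ∈ W ∧ W ≤ U ∧ AgreeOn W t.1 u.1 := by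
  obtain ⟨t, W, hxW, hWU, ht⟩ := u.1.exists_extension hx
  refine ⟨t.plus ι, W, hxW, hWU, fun V hV h h' f => ?_⟩
  rw [pair_plus, ht V hV h h', ht V hV h h', pair_invDeg, half_smul_add_self]

end PlusPart

/-! ### Polynomials in odd variables with graded coefficients. -/

section GradedPolynomials

variable {R O P : Type*} [CommRing R] [Ring O] [Algebra R O] [AddCommGroup P] [Module R P]

theorem exterior_graded_comm {i j : ℕ} {b b' : ExteriorAlgebra R P} (hb : b ∈ ⋀[R]^i P)
    (hb' : b' ∈ ⋀[R]^j P) : b * b' = (-1 : ℤˣ) ^ (i * j) • (b' * b) := by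
  have h1 : ∀ (ξ : P) (j : ℕ) (b' : ExteriorAlgebra R P), b' ∈ ⋀[R]^j P →
      ExteriorAlgebra.ι R ξ * b' = (-1 : ℤˣ) ^ j • (b' * ExteriorAlgebra.ι R ξ) := by
    intro ξ j b' hb'
    refine Submodule.pow_induction_on_left'
      (LinearMap.range (ExteriorAlgebra.ι R (M := P)))
      (C := fun j b' _ => ExteriorAlgebra.ι R ξ * b'
        = (-1 : ℤˣ) ^ j • (b' * ExteriorAlgebra.ι R ξ)) ?_ ?_ ?_ hb'
    · intro r
      rw [pow_zero, one_smul, Algebra.commutes]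
    · intro x y i _ _ hx hy
      rw [mul_add, add_mul, hx, hy, smul_add]
    · rintro _ ⟨η, rfl⟩ i x _ hx
      have h : ExteriorAlgebra.ι R ξ * ExteriorAlgebra.ι R η
          = (-1 : ℤˣ) • (ExteriorAlgebra.ι R η * ExteriorAlgebra.ι R ξ) := by
        rw [Units.neg_smul, one_smul]
        exact eq_neg_of_add_eq_zero_left (ExteriorAlgebra.ι_add_mul_swap ξ η)
      rw [← mul_assoc, h, smul_mul_assoc, mul_assoc, hx, mul_smul_comm, smul_smul, pow_succ',
        mul_assoc]
  refine Submodule.pow_induction_on_left' (LinearMap.range (ExteriorAlgebra.ι R (M := P)))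
    (C := fun i b _ => b * b' = (-1 : ℤˣ) ^ (i * j) • (b' * b)) ?_ ?_ ?_ hb
  · intro r
    rw [zero_mul, pow_zero, one_smul, Algebra.commutes]
  · intro x y i _ _ hx hy
    rw [mul_add, add_mul, hx, hy, smul_add]
  · rintro _ ⟨η, rfl⟩ i x _ hx
    rw [mul_assoc, hx, mul_smul_comm, ← mul_assoc, h1 η j b' hb', smul_mul_assoc, smul_smul,
      mul_assoc, Nat.succ_mul, pow_add]

variable (𝒜 : ℕ → Submodule R O) [GradedAlgebra 𝒜] (P)

/-- Polynomials in odd variables, with coefficients in a graded algebra. -/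
abbrev OddPoly : Type _ := GradedTensorProduct R 𝒜 (fun i : ℕ => ⋀[R]^i P)

/-- The homogeneous polynomials of total degree `m`. -/
def degPoly (m : ℕ) : Submodule R (OddPoly P 𝒜) :=
  Submodule.span R
    {t | ∃ (i j : ℕ) (a : O) (b : ExteriorAlgebra R P),
      i + j = m ∧ a ∈ 𝒜 i ∧ b ∈ ⋀[R]^j P ∧ t = GradedTensorProduct.tmul R a b}

variable {P 𝒜}

/-- The product of a coefficient and an exterior polynomial. -/
abbrev polyMul (a : O) (b : ExteriorAlgebra R P) : OddPoly P 𝒜 :=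
  GradedTensorProduct.tmul R a b

theorem polyMul_mem {i j : ℕ} {a : O} {b : ExteriorAlgebra R P} (ha : a ∈ 𝒜 i)
    (hb : b ∈ ⋀[R]^j P) : (polyMul a b : OddPoly P 𝒜) ∈ degPoly P 𝒜 (i + j) :=
  Submodule.subset_span ⟨i, j, a, b, rfl, ha, hb, rfl⟩

theorem exterior_one_mem : (1 : ExteriorAlgebra R P) ∈ ⋀[R]^0 P :=
  SetLike.GradedOne.one_mem (A := fun i : ℕ => ⋀[R]^i P)

theorem exterior_ι_mem (ξ : P) : ExteriorAlgebra.ι R ξ ∈ ⋀[R]^1 P := by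
  simpa only [pow_one] using LinearMap.mem_range_self (ExteriorAlgebra.ι R) ξ

theorem polyMul_mul {j i : ℕ} {a a' : O} {b b' : ExteriorAlgebra R P} (hb : b ∈ ⋀[R]^j P)
    (ha' : a' ∈ 𝒜 i) : (polyMul a b * polyMul a' b' : OddPoly P 𝒜)
      = (-1 : ℤˣ) ^ (j * i) • polyMul (a * a') (b * b') :=
  GradedTensorProduct.tmul_coe_mul_coe_tmul (R := R) 𝒜 (fun i : ℕ => ⋀[R]^i P) a ⟨b, hb⟩ ⟨a', ha'⟩ b'

theorem polyMul_add_left (a a' : O) (b : ExteriorAlgebra R P) :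
    (polyMul (a + a') b : OddPoly P 𝒜) = polyMul a b + polyMul a' b :=
  TensorProduct.add_tmul _ _ _

theorem polyMul_add_right (a : O) (b b' : ExteriorAlgebra R P) :
    (polyMul a (b + b') : OddPoly P 𝒜) = polyMul a b + polyMul a b' :=
  TensorProduct.tmul_add _ _ _

theorem zero_polyMul (b : ExteriorAlgebra R P) : (polyMul 0 b : OddPoly P 𝒜) = 0 :=
  TensorProduct.zero_tmul _ _

theorem polyMul_zero (a : O) : (polyMul a 0 : OddPoly P 𝒜) = 0 :=
  TensorProduct.tmul_zero _ _

theorem neg_polyMul (a : O) (b : ExteriorAlgebra R P) :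
    (polyMul (-a) b : OddPoly P 𝒜) = -polyMul a b :=
  TensorProduct.neg_tmul _ _

theorem polyMul_neg (a : O) (b : ExteriorAlgebra R P) :
    (polyMul a (-b) : OddPoly P 𝒜) = -polyMul a b :=
  TensorProduct.tmul_neg _ _

theorem smul_polyMul (r : R) (a : O) (b : ExteriorAlgebra R P) :
    (polyMul (r • a) b : OddPoly P 𝒜) = r • polyMul a b :=
  (TensorProduct.smul_tmul' _ _ _).symm

theorem polyMul_one_mul_one_polyMul (a : O) (b : ExteriorAlgebra R P) :
    (polyMul a 1 * polyMul 1 b : OddPoly P 𝒜) = polyMul a b :=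
  GradedTensorProduct.tmul_one_mul_one_tmul 𝒜 (fun i : ℕ => ⋀[R]^i P) a b

theorem polyMul_one_mul (a a' : O) (b : ExteriorAlgebra R P) :
    (polyMul a 1 * polyMul a' b : OddPoly P 𝒜) = polyMul (a * a') b := by
  induction a' using DirectSum.Decomposition.inductionOn 𝒜 with
  | zero => rw [mul_zero, zero_polyMul, mul_zero]
  | homogeneous c => exact GradedTensorProduct.tmul_one_mul_coe_tmul 𝒜 (fun i : ℕ => ⋀[R]^i P) a c b
  | add x y hx hy => rw [polyMul_add_left, mul_add, mul_add, polyMul_add_left, hx, hy]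

theorem one_polyMul_mul (b b' : ExteriorAlgebra R P) :
    (polyMul 1 b * polyMul 1 b' : OddPoly P 𝒜) = polyMul 1 (b * b') :=
  (map_mul (GradedTensorProduct.includeRight (R := R) 𝒜 (fun i : ℕ => ⋀[R]^i P)) b b').symm

theorem poly_smul_def (r : R) (t : OddPoly P 𝒜) : r • t = polyMul (algebraMap R O r) 1 * t :=
  Algebra.smul_def r t

@[elab_as_elim]
theorem OddPoly.induction {p : OddPoly P 𝒜 → Prop} (t : OddPoly P 𝒜)
    (h : ∀ (i j : ℕ) (a : O) (b : ExteriorAlgebra R P), a ∈ 𝒜 i → b ∈ ⋀[R]^j P → p (polyMul a b))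
    (hadd : ∀ s t, p s → p t → p (s + t)) : p t := by
  have h0 : p 0 := by
    have := h 0 0 0 0 (Submodule.zero_mem _) (Submodule.zero_mem _)
    rwa [zero_polyMul] at this
  refine TensorProduct.induction_on (motive := p) t h0 (fun a b => ?_) hadd
  change p (polyMul a b)
  induction a using DirectSum.Decomposition.inductionOn 𝒜 with
  | zero => exact (zero_polyMul (𝒜 := 𝒜) b).symm ▸ h0
  | add x y hx hy => rw [polyMul_add_left]; exact hadd _ _ hx hy
  | @homogeneous i c =>
    induction b using DirectSum.Decomposition.inductionOn (fun i : ℕ => ⋀[R]^i P) with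
    | zero => exact (polyMul_zero (P := P) (𝒜 := 𝒜) (c : O)).symm ▸ h0
    | add x y hx hy => rw [polyMul_add_right]; exact hadd _ _ hx hy
    | @homogeneous j e => exact h i j c e c.2 e.2

/-- Scalars are absorbed into the coefficient `a`, so `p` need only be additive. This matters
because the derivations in question are not `R`-linear. -/
theorem degPoly_induction {m : ℕ} {p : OddPoly P 𝒜 → Prop} {t : OddPoly P 𝒜}
    (ht : t ∈ degPoly P 𝒜 m) (h0 : p 0)
    (h : ∀ (i j : ℕ) (a : O) (b : ExteriorAlgebra R P), i + j = m → a ∈ 𝒜 i → b ∈ ⋀[R]^j P →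
      p (polyMul a b))
    (hadd : ∀ s t, p s → p t → p (s + t)) : p t := by
  refine Submodule.closure_induction (p := fun t _ => p t) (R := R)
    (s := {t | ∃ (i j : ℕ) (a : O) (b : ExteriorAlgebra R P),
      i + j = m ∧ a ∈ 𝒜 i ∧ b ∈ ⋀[R]^j P ∧ t = polyMul a b}) h0 (fun s t _ _ => hadd s t) ?_ ht
  rintro r _ ⟨i, j, a, b, hm, ha, hb, rfl⟩
  rw [← smul_polyMul]
  exact h i j _ b hm (Submodule.smul_mem _ r ha) hb

theorem degPoly_mul {i j : ℕ} {s t : OddPoly P 𝒜} (hs : s ∈ degPoly P 𝒜 i)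
    (ht : t ∈ degPoly P 𝒜 j) : s * t ∈ degPoly P 𝒜 (i + j) := by
  refine degPoly_induction (p := fun s => s * t ∈ degPoly P 𝒜 (i + j)) hs ?_ ?_ ?_
  · rw [zero_mul]; exact Submodule.zero_mem _
  · intro i₁ i₂ a b hi ha hb
    refine degPoly_induction (p := fun t => polyMul a b * t ∈ degPoly P 𝒜 (i + j)) ht ?_ ?_ ?_
    · rw [mul_zero]; exact Submodule.zero_mem _
    · intro j₁ j₂ a' b' hj ha' hb'
      rw [polyMul_mul hb ha']
      have := polyMul_mem (P := P) (SetLike.mul_mem_graded ha ha')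
        (SetLike.mul_mem_graded (A := fun i : ℕ => ⋀[R]^i P) hb hb')
      rw [show i₁ + j₁ + (i₂ + j₂) = i + j by omega] at this
      exact zsmul_mem this _
    · intro s t hs ht
      rw [mul_add]; exact Submodule.add_mem _ hs ht
  · intro s t hs ht
    rw [add_mul]; exact Submodule.add_mem _ hs ht

theorem degPoly_comm (h𝒜 : ∀ (i j : ℕ) (a b : O), a ∈ 𝒜 i → b ∈ 𝒜 j →
      a * b = (-1 : ℤˣ) ^ (i * j) • (b * a)) {i j : ℕ} {s t : OddPoly P 𝒜}
    (hs : s ∈ degPoly P 𝒜 i) (ht : t ∈ degPoly P 𝒜 j) :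
    s * t = (-1 : ℤˣ) ^ (i * j) • (t * s) := by
  refine degPoly_induction (p := fun s => s * t = (-1 : ℤˣ) ^ (i * j) • (t * s)) hs ?_ ?_ ?_
  · rw [zero_mul, mul_zero, smul_zero]
  · intro i₁ i₂ a b hi ha hb
    refine degPoly_induction (p := fun t => polyMul a b * t
      = (-1 : ℤˣ) ^ (i * j) • (t * polyMul a b)) ht ?_ ?_ ?_
    · rw [zero_mul, mul_zero, smul_zero]
    · intro j₁ j₂ a' b' hj ha' hb'
      rw [polyMul_mul hb ha', polyMul_mul hb' ha, h𝒜 i₁ j₁ a a' ha ha',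
        exterior_graded_comm hb hb', smul_smul]
      have e : ∀ (η η' : ℤˣ) (a : O) (b : ExteriorAlgebra R P),
          (polyMul (η • a) (η' • b) : OddPoly P 𝒜) = (η * η') • polyMul a b := by
        intro η η' a b
        rcases Int.units_eq_one_or η with rfl | rfl <;> rcases Int.units_eq_one_or η' with rfl | rfl
        all_goals simp only [one_smul, Units.neg_smul, neg_polyMul, polyMul_neg, neg_neg, one_mul, mul_one,
          neg_mul_neg]
      rw [e, smul_smul, ← pow_add, ← pow_add, ← pow_add]
      congr 1
      rw [← hi, ← hj, show i₂ * j₁ + (i₁ * j₁ + i₂ * j₂) = i₂ * j₁ + i₁ * j₁ + i₂ * j₂ by ring,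
        show (i₁ + i₂) * (j₁ + j₂) + j₂ * i₁
          = (i₂ * j₁ + i₁ * j₁ + i₂ * j₂) + (i₁ * j₂ + i₁ * j₂) by ring, pow_add _ _ (_ + _),
        pow_add _ (i₁ * j₂), Int.units_mul_self, mul_one]
    · intro s t hs ht
      rw [mul_add, add_mul, hs, ht, smul_add]
  · intro s t hs ht
    rw [mul_add, add_mul, hs, ht, smul_add]

/-- A skew derivation along a ring homomorphism vanishes if it vanishes on the coefficients and on
the variables. -/
theorem OddPoly.eq_zero_of_leibniz {N : Type*} [Ring N] (ρ : OddPoly P 𝒜 →+* N)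
    (F : OddPoly P 𝒜 →+ N)
    (hF : ∀ (m : ℕ) (s t : OddPoly P 𝒜), s ∈ degPoly P 𝒜 m →
      F (s * t) = F s * ρ t + (-1 : ℤˣ) ^ m • (ρ s * F t))
    (hcoeff : ∀ a : O, F (polyMul a 1) = 0)
    (hvar : ∀ ξ : P, F (polyMul 1 (ExteriorAlgebra.ι R ξ)) = 0) : F = 0 := by
  have h1 : ∀ b : ExteriorAlgebra R P, F (polyMul 1 b) = 0 := by
    intro b
    induction b using CliffordAlgebra.left_induction with
    | algebraMap r =>
      have := hcoeff (algebraMap R O r)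
      rwa [show (polyMul (algebraMap R O r) 1 : OddPoly P 𝒜) = polyMul 1 (algebraMap R _ r) from
        GradedTensorProduct.algebraMap_def' 𝒜 (fun i : ℕ => ⋀[R]^i P) r] at this
    | add x y hx hy => rw [polyMul_add_right, map_add, hx, hy, add_zero]
    | ι_mul x ξ hx =>
      have hξ : (polyMul 1 (ExteriorAlgebra.ι R ξ) : OddPoly P 𝒜) ∈ degPoly P 𝒜 (0 + 1) :=
        polyMul_mem (SetLike.GradedOne.one_mem (A := 𝒜)) (exterior_ι_mem ξ)
      have h := hF (0 + 1) _ (polyMul 1 x) hξ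
      rw [one_polyMul_mul, hvar, hx, zero_mul, mul_zero, smul_zero, add_zero] at h
      exact h
  ext t
  refine OddPoly.induction (p := fun t => F t = 0) t ?_ ?_
  · intro i j a b ha hb
    rw [← polyMul_one_mul_one_polyMul, hF i _ _ (polyMul_mem (j := 0) ha exterior_one_mem),
      hcoeff, h1]
    simp
  · intro s t hs ht
    rw [map_add, hs, ht, add_zero]

/-- Two maps satisfying the same Leibniz rule agree if they agree on generators. -/
theorem OddPoly.ext_of_leibniz {N : Type*} [Ring N] (ρ : OddPoly P 𝒜 →+* N)
    (F G : OddPoly P 𝒜 →+ N)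
    (hF : ∀ (m : ℕ) (s t : OddPoly P 𝒜), s ∈ degPoly P 𝒜 m →
      F (s * t) = F s * ρ t + (-1 : ℤˣ) ^ m • (ρ s * F t))
    (hG : ∀ (m : ℕ) (s t : OddPoly P 𝒜), s ∈ degPoly P 𝒜 m →
      G (s * t) = G s * ρ t + (-1 : ℤˣ) ^ m • (ρ s * G t))
    (hcoeff : ∀ a : O, F (polyMul a 1) = G (polyMul a 1))
    (hvar : ∀ ξ : P, F (polyMul 1 (ExteriorAlgebra.ι R ξ)) = G (polyMul 1 (ExteriorAlgebra.ι R ξ))) :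
    F = G := by
  refine sub_eq_zero.1 (OddPoly.eq_zero_of_leibniz ρ (F - G) (fun m s t hs => ?_)
    (fun a => sub_eq_zero.2 (hcoeff a)) fun ξ => sub_eq_zero.2 (hvar ξ))
  rw [AddMonoidHom.sub_apply, AddMonoidHom.sub_apply, AddMonoidHom.sub_apply, hF m s t hs,
    hG m s t hs, sub_mul, mul_sub, smul_sub]
  abel

/-- A ring homomorphism intertwines derivations if it does so on generators. -/
theorem OddPoly.map_comm_of_leibniz {N : Type*} [Ring N] (ρ : OddPoly P 𝒜 →+* N)
    (D : OddPoly P 𝒜 →+ OddPoly P 𝒜) (D' : N →+ N)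
    (hD : ∀ (m : ℕ) (s t : OddPoly P 𝒜), s ∈ degPoly P 𝒜 m →
      D (s * t) = D s * t + (-1 : ℤˣ) ^ m • (s * D t))
    (hD' : ∀ (m : ℕ) (s t : OddPoly P 𝒜), s ∈ degPoly P 𝒜 m →
      D' (ρ s * ρ t) = D' (ρ s) * ρ t + (-1 : ℤˣ) ^ m • (ρ s * D' (ρ t)))
    (hcoeff : ∀ a : O, ρ (D (polyMul a 1)) = D' (ρ (polyMul a 1)))
    (hvar : ∀ ξ : P, ρ (D (polyMul 1 (ExteriorAlgebra.ι R ξ)))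
      = D' (ρ (polyMul 1 (ExteriorAlgebra.ι R ξ)))) (t : OddPoly P 𝒜) : ρ (D t) = D' (ρ t) := by
  have key : ρ.toAddMonoidHom.comp D = D'.comp ρ.toAddMonoidHom := by
    refine OddPoly.ext_of_leibniz ρ _ _ (fun m s t hs => ?_) (fun m s t hs => ?_) hcoeff hvar
    · change ρ (D (s * t)) = ρ (D s) * ρ t + (-1 : ℤˣ) ^ m • (ρ s * ρ (D t))
      rw [hD m s t hs, map_add, map_mul, Units.smul_def, map_zsmul, map_mul, Units.smul_def]
    · change D' (ρ (s * t)) = D' (ρ s) * ρ t + (-1 : ℤˣ) ^ m • (ρ s * D' (ρ t))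
      rw [map_mul, hD' m s t hs]
  exact DFunLike.congr_fun key t

end GradedPolynomials

/-! ### Derivations of degree 1 of polynomials in odd variables. -/

section OddPolyDerivations

variable {R O P : Type*} [CommRing R] [Ring O] [Algebra R O] [AddCommGroup P] [Module R P]
  {𝒜 : ℕ → Submodule R O} [GradedAlgebra 𝒜]

variable (P 𝒜) in
/-- The parity automorphism of the polynomials in odd variables. -/
def polySign : OddPoly P 𝒜 →ₐ[R] OddPoly P 𝒜 :=
  GradedTensorProduct.lift 𝒜 (fun i : ℕ => ⋀[R]^i P)
    ((GradedTensorProduct.includeLeft 𝒜 (fun i : ℕ => ⋀[R]^i P)).comp (signHom 𝒜 (-1)))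
    ((GradedTensorProduct.includeRight 𝒜 (fun i : ℕ => ⋀[R]^i P)).comp
      (signHom (fun i : ℕ => ⋀[R]^i P) (-1)))
    (fun i j a b => by
      change (polyMul (signHom 𝒜 (-1) a) 1
          * polyMul 1 (signHom (fun i : ℕ => ⋀[R]^i P) (-1) b) : OddPoly P 𝒜)
        = (-1 : ℤˣ) ^ (j * i) • (polyMul 1 (signHom (fun i : ℕ => ⋀[R]^i P) (-1) b)
          * polyMul (signHom 𝒜 (-1) a) 1)
      have ha : signHom 𝒜 (-1) (a : O) ∈ 𝒜 i := by
        rw [signHom_apply _ _ a.2]; exact zsmul_mem a.2 _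
      have hb : signHom (fun i : ℕ => ⋀[R]^i P) (-1) (b : ExteriorAlgebra R P) ∈ ⋀[R]^j P := by
        rw [signHom_apply (fun i : ℕ => ⋀[R]^i P) _ b.2]; exact zsmul_mem b.2 _
      rw [polyMul_one_mul_one_polyMul, polyMul_mul hb ha, smul_smul, Int.units_mul_self, one_smul,
        one_mul, mul_one])

theorem units_smul_polyMul (η η' : ℤˣ) (a : O) (b : ExteriorAlgebra R P) :
    (polyMul (η • a) (η' • b) : OddPoly P 𝒜) = (η * η') • polyMul a b := by
  rcases Int.units_eq_one_or η with rfl | rfl <;> rcases Int.units_eq_one_or η' with rfl | rfl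
  all_goals simp only [one_smul, Units.neg_smul, neg_polyMul, polyMul_neg, neg_neg, one_mul, mul_one,
    neg_mul_neg]

theorem polySign_apply {m : ℕ} {t : OddPoly P 𝒜} (ht : t ∈ degPoly P 𝒜 m) :
    polySign P 𝒜 t = (-1 : ℤˣ) ^ m • t := by
  refine degPoly_induction (p := fun t => polySign P 𝒜 t = (-1 : ℤˣ) ^ m • t) ht ?_ ?_ ?_
  · rw [map_zero, smul_zero]
  · intro i j a b hm ha hb
    have : polySign P 𝒜 (polyMul a b) = polyMul (signHom 𝒜 (-1) a) 1
        * polyMul 1 (signHom (fun i : ℕ => ⋀[R]^i P) (-1) b) := rfl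
    rw [this, polyMul_one_mul_one_polyMul, signHom_apply _ _ ha, signHom_apply (fun i : ℕ => ⋀[R]^i P) _ hb,
      units_smul_polyMul, ← pow_add, hm]
  · intro s t hs ht
    rw [map_add, hs, ht, smul_add]

theorem polySign_polyMul_one (a : O) :
    polySign P 𝒜 (polyMul a 1) = polyMul (signHom 𝒜 (-1) a) 1 := by
  have : polySign P 𝒜 (polyMul a 1) = polyMul (signHom 𝒜 (-1) a) 1
    * polyMul 1 (signHom (fun i : ℕ => ⋀[R]^i P) (-1) 1) := rfl
  rw [this, map_one]
  exact mul_one _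

variable (h𝒜 : ∀ (i j : ℕ) (a b : O), a ∈ 𝒜 i → b ∈ 𝒜 j → a * b = (-1 : ℤˣ) ^ (i * j) • (b * a))

include h𝒜

/-- This is the centrality condition of `TwistExt.algebra` for the degree 1 elements `q r`; the
parity automorphism lets `t` be inhomogeneous. -/
theorem mul_eq_polySign_mul {s : OddPoly P 𝒜} (hs : s ∈ degPoly P 𝒜 1) (t : OddPoly P 𝒜) :
    s * t = polySign P 𝒜 t * s := by
  refine OddPoly.induction (p := fun t => s * t = polySign P 𝒜 t * s) t ?_ ?_
  · intro i j a b ha hb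
    have := polyMul_mem (P := P) ha hb
    rw [polySign_apply this, degPoly_comm h𝒜 hs this, one_mul, smul_mul_assoc]
  · intro t t' ht ht'
    rw [mul_add, map_add, add_mul, ht, ht']

/-- Derivations of degree 1 of the polynomials in odd variables are given by a derivation of the
coefficients and the values on the variables. -/
theorem OddPoly.exists_derivation (q : O →+ O)
    (hqdeg : ∀ (i : ℕ) (a : O), a ∈ 𝒜 i → q a ∈ 𝒜 (i + 1))
    (hq : ∀ (i : ℕ) (a b : O), a ∈ 𝒜 i → q (a * b) = q a * b + (-1 : ℤˣ) ^ i • (a * q b))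
    (θ : P →+ OddPoly P 𝒜) (hθ : ∀ ξ, θ ξ ∈ degPoly P 𝒜 2)
    (hθs : ∀ (r : R) (ξ : P),
      θ (r • ξ) = polyMul (q (algebraMap R O r)) (ExteriorAlgebra.ι R ξ) + r • θ ξ) :
    ∃ D : OddPoly P 𝒜 →+ OddPoly P 𝒜, (∀ a, D (polyMul a 1) = polyMul (q a) 1) ∧
      (∀ ξ, D (polyMul 1 (ExteriorAlgebra.ι R ξ)) = θ ξ) ∧
      (∀ (m : ℕ) (t : OddPoly P 𝒜), t ∈ degPoly P 𝒜 m → D t ∈ degPoly P 𝒜 (m + 1)) ∧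
      ∀ (m : ℕ) (s t : OddPoly P 𝒜), s ∈ degPoly P 𝒜 m →
        D (s * t) = D s * t + (-1 : ℤˣ) ^ m • (s * D t) := by
  have hcoeff : ∀ {i : ℕ} {a : O}, a ∈ 𝒜 i → (polyMul a 1 : OddPoly P 𝒜) ∈ degPoly P 𝒜 i :=
    fun ha => polyMul_mem (j := 0) ha exterior_one_mem
  have hext : ∀ {j : ℕ} {b : ExteriorAlgebra R P}, b ∈ ⋀[R]^j P →
      (polyMul 1 b : OddPoly P 𝒜) ∈ degPoly P 𝒜 j := fun {j b} hb => by
    have := polyMul_mem (P := P) (SetLike.GradedOne.one_mem (A := 𝒜)) hb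
    rwa [zero_add] at this
  have hR : ∀ r : R, algebraMap R O r ∈ 𝒜 0 := SetLike.algebraMap_mem_graded 𝒜
  have hqsign : ∀ a b : O, q (a * b) = q a * b + signHom 𝒜 (-1) a * q b := by
    intro a b
    induction a using DirectSum.Decomposition.inductionOn 𝒜 with
    | zero => simp
    | homogeneous c => rw [hq _ _ _ c.2, signHom_apply _ _ c.2, smul_mul_assoc]
    | add x y hx hy => rw [add_mul, map_add, map_add, map_add, hx, hy, add_mul, add_mul]; abel
  let σ : OddPoly P 𝒜 →+* OddPoly P 𝒜 := (polySign P 𝒜 : OddPoly P 𝒜 →+* OddPoly P 𝒜)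
  have hσ : ∀ {m : ℕ} {t : OddPoly P 𝒜}, t ∈ degPoly P 𝒜 m → σ t = (-1 : ℤˣ) ^ m • t :=
    fun ht => polySign_apply ht
  let incl : O →+* OddPoly P 𝒜 := GradedTensorProduct.includeLeftRingHom 𝒜 (fun i : ℕ => ⋀[R]^i P)
  have hincl : ∀ a, incl a = polyMul a 1 := fun _ => rfl
  let qR : R →+ OddPoly P 𝒜 :=
    (incl.toAddMonoidHom.comp q).comp (algebraMap R O).toAddMonoidHom
  have hqR : ∀ r, qR r = polyMul (q (algebraMap R O r)) 1 := fun _ => rfl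
  have hqRdeg : ∀ r, qR r ∈ degPoly P 𝒜 1 := fun r => hcoeff (hqdeg 0 _ (hR r))
  -- The derivation sought is not `R`-linear, since `q` need not kill scalars. Letting `r` act as
  -- `(r, q r)` makes `a ↦ (a, q a)` and `ξ ↦ (ξ, θ ξ)` linear all the same; for the second map this
  -- is exactly `hθs`.
  let _ : Algebra R (TwistExt σ) := TwistExt.algebra qR
    (fun f g => by
      change incl (q (algebraMap R O (f * g))) = incl (q (algebraMap R O f)) * incl (algebraMap R O g)
        + incl (algebraMap R O f) * incl (q (algebraMap R O g))
      rw [map_mul, hq 0 _ _ (hR f), pow_zero, one_smul, map_add, map_mul, map_mul])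
    (fun f => (polySign P 𝒜).commutes f)
    (fun f t => mul_eq_polySign_mul h𝒜 (hqRdeg f) t)
  have halg : ∀ r : R, algebraMap R (TwistExt σ) r = (incl (algebraMap R O r), qR r) := fun _ => rfl
  let fO : O →ₐ[R] TwistExt σ :=
    { toFun := fun a => (incl a, incl (q a))
      map_one' := by
        have := halg 1
        rw [map_one, hqR, map_one, ← hincl] at this
        exact this.symm
      map_mul' := fun a b => TwistExt.ext (map_mul incl a b) (by
        change incl (q (a * b)) = incl (q a) * incl b + σ (incl a) * incl (q b)
        rw [hqsign, map_add, map_mul, map_mul]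
        congr 2
        exact (polySign_polyMul_one a).symm)
      map_zero' := TwistExt.ext (map_zero incl) (by
        change incl (q 0) = 0
        rw [map_zero, map_zero])
      map_add' := fun a b => TwistExt.ext (map_add incl a b) (by
        change incl (q (a + b)) = incl (q a) + incl (q b)
        rw [map_add, map_add])
      commutes' := fun r => rfl }
  let fι : P →ₗ[R] TwistExt σ :=
    { toFun := fun ξ => (polyMul 1 (ExteriorAlgebra.ι R ξ), θ ξ)
      map_add' := fun ξ η => TwistExt.ext (by
        change polyMul 1 (ExteriorAlgebra.ι R (ξ + η)) = polyMul 1 _ + polyMul 1 _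
        rw [map_add, polyMul_add_right]) (map_add θ ξ η)
      map_smul' := fun r ξ => by
        refine TwistExt.ext ?_ ?_
        · change polyMul 1 (ExteriorAlgebra.ι R (r • ξ))
            = polyMul (algebraMap R O r) 1 * polyMul 1 (ExteriorAlgebra.ι R ξ)
          rw [map_smul, ← poly_smul_def]
          exact TensorProduct.tmul_smul _ _ _
        · change θ (r • ξ) = polyMul (q (algebraMap R O r)) 1 * polyMul 1 (ExteriorAlgebra.ι R ξ)
            + σ (polyMul (algebraMap R O r) 1) * θ ξ
          rw [hθs, polyMul_one_mul_one_polyMul, hσ (hcoeff (hR r)), pow_zero, one_smul,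
            ← poly_smul_def] }
  -- The second component is `θ ξ * ξ - ξ * θ ξ`, with the minus sign from the parity of `ξ`. It
  -- vanishes because `θ ξ` has even degree and so commutes with `ξ`.
  have hfι : ∀ ξ, fι ξ * fι ξ = 0 := fun ξ => by
    have hξ : (polyMul 1 (ExteriorAlgebra.ι R ξ) : OddPoly P 𝒜) ∈ degPoly P 𝒜 1 :=
      hext (exterior_ι_mem ξ)
    refine TwistExt.ext ?_ ?_
    · change polyMul 1 (ExteriorAlgebra.ι R ξ) * polyMul 1 (ExteriorAlgebra.ι R ξ) = 0
      rw [one_polyMul_mul, ExteriorAlgebra.ι_sq_zero, polyMul_zero]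
    · change θ ξ * polyMul 1 (ExteriorAlgebra.ι R ξ) + σ (polyMul 1 (ExteriorAlgebra.ι R ξ)) * θ ξ = 0
      rw [hσ hξ, degPoly_comm h𝒜 (hθ ξ) hξ, pow_one, smul_mul_assoc, Units.neg_smul, one_smul]
      norm_num
  let fΛ : ExteriorAlgebra R P →ₐ[R] TwistExt σ := ExteriorAlgebra.lift R ⟨fι, hfι⟩
  have hfΛι : ∀ ξ, fΛ (ExteriorAlgebra.ι R ξ) = fι ξ := ExteriorAlgebra.lift_ι_apply R fι hfι
  have hfΛ1 : ∀ b, (fΛ b).1 = polyMul 1 b := by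
    intro b
    induction b using ExteriorAlgebra.induction with
    | algebraMap r =>
      rw [fΛ.commutes, halg]
      exact GradedTensorProduct.algebraMap_def' 𝒜 (fun i : ℕ => ⋀[R]^i P) r
    | ι ξ => rw [hfΛι]; rfl
    | mul a b ha hb => rw [map_mul, TwistExt.fst_mul, ha, hb, one_polyMul_mul]
    | add a b ha hb =>
      rw [map_add, polyMul_add_right, ← ha, ← hb]; rfl
  have hfΛ2 : ∀ (j : ℕ) (b : ExteriorAlgebra R P), b ∈ ⋀[R]^j P →
      (fΛ b).2 ∈ degPoly P 𝒜 (j + 1) := by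
    intro j b hb
    refine Submodule.pow_induction_on_left' (LinearMap.range (ExteriorAlgebra.ι R (M := P)))
      (C := fun j b _ => (fΛ b).2 ∈ degPoly P 𝒜 (j + 1)) ?_ ?_ ?_ hb
    · intro r
      rw [fΛ.commutes, halg]
      exact hqRdeg r
    · intro x y i _ _ hx hy
      rw [map_add]
      exact Submodule.add_mem _ hx hy
    · rintro _ ⟨η, rfl⟩ i x hx' hx
      rw [map_mul, hfΛι, TwistExt.snd_mul, hfΛ1]
      refine Submodule.add_mem _ ?_ ?_
      · have := degPoly_mul (hθ η) (hext hx')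
        rw [show 2 + i = i.succ + 1 by omega] at this
        exact this
      · change σ (polyMul 1 (ExteriorAlgebra.ι R η)) * (fΛ x).2 ∈ _
        rw [hσ (hext (exterior_ι_mem η)), smul_mul_assoc]
        have := degPoly_mul (hext (exterior_ι_mem η)) hx
        rw [show 1 + (i + 1) = i.succ + 1 by omega] at this
        exact zsmul_mem this _
  -- The lift requires the images of coefficients and of exterior elements to commute up to sign;
  -- for the second components this follows from their degrees `i + 1` and `j + 1`.
  let Φ : OddPoly P 𝒜 →ₐ[R] TwistExt σ := GradedTensorProduct.lift 𝒜 (fun i : ℕ => ⋀[R]^i P) fO fΛ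
    (fun i j a b => by
      refine TwistExt.ext ?_ ?_
      · change polyMul a.1 1 * (fΛ b).1 = (-1 : ℤˣ) ^ (j * i) • ((fΛ b).1 * polyMul a.1 1)
        rw [hfΛ1, degPoly_comm h𝒜 (hcoeff a.2) (hext b.2), mul_comm i j]
      · change polyMul (q a.1) 1 * (fΛ b).1 + σ (polyMul a.1 1) * (fΛ b).2
          = (-1 : ℤˣ) ^ (j * i) • ((fΛ b).2 * polyMul a.1 1 + σ (fΛ b).1 * polyMul (q a.1) 1)
        rw [hfΛ1, hσ (hcoeff a.2), hσ (hext b.2),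
          degPoly_comm h𝒜 (hcoeff (hqdeg i _ a.2)) (hext b.2), smul_mul_assoc, smul_mul_assoc,
          degPoly_comm h𝒜 (hcoeff a.2) (hfΛ2 j b b.2), smul_add, smul_smul, smul_smul, ← pow_add,
          ← pow_add, add_comm]
        congr 2
        · rw [show i + i * (j + 1) = j * i + (i + i) by ring, pow_add _ _ (i + i), pow_add _ i i,
            Int.units_mul_self, mul_one]
        · congr 1
          ring)
  have hΦ : ∀ a b, Φ (polyMul a b) = fO a * fΛ b := fun _ _ => rfl
  have hΦ1 : ∀ t, (Φ t).1 = t := by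
    intro t
    refine OddPoly.induction (p := fun t => (Φ t).1 = t) t ?_ ?_
    · intro i j a b _ _
      rw [hΦ, TwistExt.fst_mul, hfΛ1]
      exact polyMul_one_mul_one_polyMul a b
    · intro s t hs ht
      rw [map_add]
      change (Φ s).1 + (Φ t).1 = s + t
      rw [hs, ht]
  have hleib : ∀ (m : ℕ) (s t : OddPoly P 𝒜), s ∈ degPoly P 𝒜 m →
      (Φ (s * t)).2 = (Φ s).2 * t + (-1 : ℤˣ) ^ m • (s * (Φ t).2) := fun m s t hs => by
    rw [map_mul, TwistExt.snd_mul, hΦ1, hΦ1, hσ hs, smul_mul_assoc]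
  refine ⟨(TwistExt.sndHom σ).comp (Φ : OddPoly P 𝒜 →+* TwistExt σ).toAddMonoidHom, fun a => ?_,
    fun ξ => ?_, fun m t ht => ?_, hleib⟩
  · change (Φ (polyMul a 1)).2 = _
    rw [hΦ, map_one, mul_one]
    rfl
  · change (Φ (polyMul 1 _)).2 = _
    rw [hΦ, map_one, one_mul, hfΛι]
    rfl
  · change (Φ t).2 ∈ _
    refine degPoly_induction (p := fun t => (Φ t).2 ∈ degPoly P 𝒜 (m + 1)) ht ?_ ?_ ?_
    · rw [map_zero]; exact Submodule.zero_mem _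
    · intro i j a b hm ha hb
      rw [hΦ, TwistExt.snd_mul, hfΛ1]
      refine Submodule.add_mem _ ?_ ?_
      · have := degPoly_mul (hcoeff (hqdeg i a ha)) (hext hb)
        rw [show i + 1 + j = m + 1 by omega] at this
        exact this
      · change σ (polyMul a 1) * (fΛ b).2 ∈ _
        rw [hσ (hcoeff ha), smul_mul_assoc]
        have := degPoly_mul (hcoeff ha) (hfΛ2 j b hb)
        rw [show i + (j + 1) = m + 1 by omega] at this
        exact zsmul_mem this _
    · intro s t hs ht
      rw [map_add]
      exact Submodule.add_mem _ hs ht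

end OddPolyDerivations

/-! ### Functions on `𝓥` that are linear along the fibres, and their contractions. -/

section LinearFunctions

variable {n : ℕ} {M : Type v} [TopologicalSpace M]
  [ChartedSpace (EuclideanSpace ℝ (Fin n)) M] {𝓔 : GradedManifold.{u, v} n M}

theorem graded_comm_pow (U : Opens M) (i j : ℕ) (a b : 𝓔.O U) (ha : a ∈ 𝓔.deg U i)
    (hb : b ∈ 𝓔.deg U j) : a * b = (-1 : ℤˣ) ^ (i * j) • (b * a) := by
  rw [𝓔.graded_comm U i j a b ha hb, Int.negOnePow_def, ← Nat.cast_mul, zpow_natCast]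

/-- `ιInv` is the second component of the map to the trivial square zero extension, in which scalars
have no second component and a product of two variables is zero. -/
theorem ιInv_eq_zero {R P : Type*} [CommRing R] [AddCommGroup P] [Module R P] {j : ℕ} (hj : j ≠ 1)
    {b : ExteriorAlgebra R P} (hb : b ∈ ⋀[R]^j P) : ExteriorAlgebra.ιInv b = 0 := by
  let _ : Module Rᵐᵒᵖ P := Module.compHom _ ((RingHom.id R).fromOpposite mul_comm)
  have _ : IsCentralScalar R P := ⟨fun r m => rfl⟩
  change (ExteriorAlgebra.toTrivSqZeroExt b).snd = 0
  -- The first component belongs in the induction: left multiplication by a variable feeds it into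
  -- the second one.
  have key : (j = 0 → (ExteriorAlgebra.toTrivSqZeroExt b : TrivSqZeroExt R P).snd = 0) ∧
      (1 ≤ j → (ExteriorAlgebra.toTrivSqZeroExt b : TrivSqZeroExt R P).fst = 0) ∧
      (2 ≤ j → (ExteriorAlgebra.toTrivSqZeroExt b : TrivSqZeroExt R P).snd = 0) := by
    refine Submodule.pow_induction_on_left' (LinearMap.range (ExteriorAlgebra.ι R (M := P)))
      (C := fun j b _ => (j = 0 → (ExteriorAlgebra.toTrivSqZeroExt b : TrivSqZeroExt R P).snd = 0) ∧
        (1 ≤ j → (ExteriorAlgebra.toTrivSqZeroExt b : TrivSqZeroExt R P).fst = 0) ∧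
        (2 ≤ j → (ExteriorAlgebra.toTrivSqZeroExt b : TrivSqZeroExt R P).snd = 0)) ?_ ?_ ?_ hb
    · intro r
      rw [AlgHom.commutes]
      exact ⟨fun _ => rfl, fun h => by omega, fun h => by omega⟩
    · intro x y i _ _ hx hy
      rw [map_add, TrivSqZeroExt.snd_add, TrivSqZeroExt.fst_add]
      exact ⟨fun h => by rw [hx.1 h, hy.1 h, add_zero],
        fun h => by rw [hx.2.1 h, hy.2.1 h, add_zero],
        fun h => by rw [hx.2.2 h, hy.2.2 h, add_zero]⟩
    · rintro _ ⟨η, rfl⟩ i x _ hx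
      rw [map_mul, ExteriorAlgebra.toTrivSqZeroExt_ι, TrivSqZeroExt.snd_mul, TrivSqZeroExt.fst_mul,
        TrivSqZeroExt.fst_inr]
      refine ⟨fun h => by omega, fun _ => zero_mul _, fun h => ?_⟩
      rw [hx.2.1 (by omega)]
      simp
  rcases Nat.lt_or_ge j 1 with h | h
  · exact key.1 (by omega)
  · exact key.2.2 (by omega)

theorem pair_sum {U W : Opens M} {I : Type*} (s : Finset I) (e : I → SecE 𝓔 U) (h : W ≤ U)
    (f : 𝓔.deg W 1) : pair (∑ i ∈ s, e i) h f = ∑ i ∈ s, pair (e i) h f := by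
  classical
  induction s using Finset.induction_on with
  | empty => simp; rfl
  | insert i s hi ih => rw [Finset.sum_insert hi, Finset.sum_insert hi, ← ih]; rfl

variable {ι : BaseInvolution 𝓔}

theorem pairPlus_add {U W : Opens M} (u u' : SecPlus ι U) (h : W ≤ U) (ξ : PlusDual ι W) :
    pairPlus (u + u') h ξ = pairPlus u h ξ + pairPlus u' h ξ := rfl

theorem pairPlus_smul {U W : Opens M} (c : SmoothFn n U) (u : SecPlus ι U) (h : W ≤ U)
    (ξ : PlusDual ι W) : pairPlus (c • u) h ξ = resFn n h c * pairPlus u h ξ := rfl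

theorem pairPlus_sum {U W : Opens M} {I : Type*} (s : Finset I) (e : I → SecPlus ι U) (h : W ≤ U)
    (ξ : PlusDual ι W) : pairPlus (∑ i ∈ s, e i) h ξ = ∑ i ∈ s, pairPlus (e i) h ξ := by
  classical
  induction s using Finset.induction_on with
  | empty => simp; rfl
  | insert i s hi ih => rw [Finset.sum_insert hi, Finset.sum_insert hi, ← ih]; rfl

theorem resFn_le_rfl {U : Opens M} (c : SmoothFn n U) : resFn n le_rfl c = c := rfl

section FunV

variable {U : Opens M}

theorem linV_eq (a : 𝓔.O U) (ξ : PlusDual ι U) :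
    linV a ξ = polyMul (𝒜 := 𝓔.deg U) a (ExteriorAlgebra.ι (SmoothFn n U) ξ) := rfl

theorem linV_add_left (a b : 𝓔.O U) (ξ : PlusDual ι U) : linV (a + b) ξ = linV a ξ + linV b ξ :=
  polyMul_add_left _ _ _

theorem linV_add_right (a : 𝓔.O U) (ξ η : PlusDual ι U) : linV a (ξ + η) = linV a ξ + linV a η := by
  rw [linV_eq, map_add]
  exact polyMul_add_right _ _ _

theorem linV_smul_left (c : SmoothFn n U) (a : 𝓔.O U) (ξ : PlusDual ι U) :
    linV (c • a) ξ = c • linV a ξ :=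
  smul_polyMul _ _ _

theorem linV_smul_right (c : SmoothFn n U) (a : 𝓔.O U) (ξ : PlusDual ι U) :
    linV a (c • ξ) = c • linV a ξ := by
  rw [linV_eq, map_smul]
  exact TensorProduct.tmul_smul _ _ _

theorem linV_zero_left (ξ : PlusDual ι U) : linV (0 : 𝓔.O U) ξ = 0 := zero_polyMul _

theorem linV_zero_right (a : 𝓔.O U) : linV a (0 : PlusDual ι U) = 0 := by
  rw [linV_eq, map_zero]
  exact polyMul_zero _

theorem linV_sum_right {I : Type*} (s : Finset I) (a : 𝓔.O U) (ξ : I → PlusDual ι U) :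
    linV a (∑ i ∈ s, ξ i) = ∑ i ∈ s, linV a (ξ i) := by
  classical
  induction s using Finset.induction_on with
  | empty => exact linV_zero_right a
  | insert i s hi ih => rw [Finset.sum_insert hi, Finset.sum_insert hi, linV_add_right, ih]

theorem linV_mem (a : 𝓔.O U) (ξ : PlusDual ι U) : linV a ξ ∈ LinFunV ι U :=
  Submodule.subset_span ⟨a, ξ, rfl⟩

theorem linV_mem_degV {i : ℕ} {a : 𝓔.O U} (ha : a ∈ 𝓔.deg U i) (ξ : PlusDual ι U) :
    linV a ξ ∈ degV ι U (i + 1) :=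
  polyMul_mem ha (exterior_ι_mem ξ)

theorem pullV_mem_degV {i : ℕ} {a : 𝓔.O U} (ha : a ∈ 𝓔.deg U i) :
    (pullV a : FunV ι U) ∈ degV ι U i :=
  polyMul_mem (j := 0) ha exterior_one_mem

theorem pullV_mul_linV (a b : 𝓔.O U) (ξ : PlusDual ι U) :
    pullV a * linV b ξ = linV (a * b) ξ :=
  polyMul_one_mul _ _ _

theorem pullV_algebraMap_mul (c : SmoothFn n U) (t : FunV ι U) :
    pullV (algebraMap _ (𝓔.O U) c) * t = c • t :=
  (poly_smul_def (𝒜 := 𝓔.deg U) c t).symm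

theorem LinFunV.induction {p : FunV ι U → Prop} {t : FunV ι U} (ht : t ∈ LinFunV ι U)
    (h : ∀ a ξ, p (linV a ξ)) (hadd : ∀ s t, p s → p t → p (s + t)) : p t := by
  refine Submodule.closure_induction (p := fun t _ => p t) (R := SmoothFn n U)
    (s := {t | ∃ (a : 𝓔.O U) (ξ : PlusDual ι U), t = linV a ξ}) ?_ (fun s t _ _ => hadd s t) ?_ ht
  · have := h 0 0
    rwa [linV_zero_left] at this
  · rintro r _ ⟨a, ξ, rfl⟩
    rw [← linV_smul_left]
    exact h _ _

theorem pullV_mul_mem_linFunV (a : 𝓔.O U) {t : FunV ι U} (ht : t ∈ LinFunV ι U) :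
    pullV a * t ∈ LinFunV ι U := by
  refine LinFunV.induction (p := fun t => pullV a * t ∈ LinFunV ι U) ht (fun b ξ => ?_)
    fun s t hs ht => ?_
  · rw [pullV_mul_linV]; exact linV_mem _ _
  · rw [mul_add]; exact Submodule.add_mem _ hs ht

theorem contract_polyMul (u : SecPlus ι U) (a : 𝓔.O U)
    (b : ExteriorAlgebra (SmoothFn n U) (PlusDual ι U)) :
    contract u (polyMul a b) = pairPlus u le_rfl (ExteriorAlgebra.ιInv b) • a := rfl

theorem contract_pullV_mul (u : SecPlus ι U) (a : 𝓔.O U) (t : FunV ι U) :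
    contract u (pullV a * t) = a * contract u t := by
  refine OddPoly.induction (p := fun t => contract u (pullV a * t) = a * contract u t) t ?_ ?_
  · intro i j a' b _ _
    have : pullV a * polyMul a' b = (polyMul (a * a') b : FunV ι U) := polyMul_one_mul _ _ _
    rw [this, contract_polyMul, contract_polyMul, mul_smul_comm]
  · intro s t hs ht
    rw [mul_add, map_add, map_add, hs, ht, mul_add]

theorem contract_invV (u : SecPlus ι U) (t : FunV ι U) :
    contract u (invV ι U t) = ι.inv U (contract u t) := by
  refine OddPoly.induction (p := fun t => contract u (invV ι U t) = ι.inv U (contract u t)) t ?_ ?_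
  · intro i j a b _ _
    have : invV ι U (polyMul a b) = (polyMul (ι.inv U a) b : FunV ι U) := rfl
    rw [this, contract_polyMul, contract_polyMul, map_smul]
  · intro s t hs ht
    rw [map_add, map_add, map_add, map_add, hs, ht]

/-- Contraction sees only the terms with exactly one fibre coordinate, and removes it. -/
theorem contract_mem (u : SecPlus ι U) {m : ℕ} {t : FunV ι U} (ht : t ∈ degV ι U (m + 1)) :
    contract u t ∈ 𝓔.deg U m := by
  refine degPoly_induction (p := fun t => contract u t ∈ 𝓔.deg U m) ht ?_ ?_ ?_
  · rw [map_zero]; exact Submodule.zero_mem _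
  · intro i j a b hm ha hb
    rw [contract_polyMul]
    by_cases hj : j = 1
    · obtain rfl : i = m := by omega
      exact Submodule.smul_mem _ _ ha
    · rw [ιInv_eq_zero hj hb, map_zero, zero_smul]
      exact Submodule.zero_mem _
  · intro s t hs ht
    rw [map_add]; exact Submodule.add_mem _ hs ht

theorem contract_add (u u' : SecPlus ι U) (t : FunV ι U) :
    contract (u + u') t = contract u t + contract u' t := by
  refine OddPoly.induction (p := fun t => contract (u + u') t = contract u t + contract u' t) t ?_ ?_
  · intro i j a b _ _
    rw [contract_polyMul, contract_polyMul, contract_polyMul, pairPlus_add, add_smul]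
  · intro s t hs ht
    rw [map_add, map_add, map_add, hs, ht]; abel

theorem contract_smul (c : SmoothFn n U) (u : SecPlus ι U) (t : FunV ι U) :
    contract (c • u) t = c • contract u t := by
  refine OddPoly.induction (p := fun t => contract (c • u) t = c • contract u t) t ?_ ?_
  · intro i j a b _ _
    rw [contract_polyMul, contract_polyMul, pairPlus_smul, resFn_le_rfl, mul_smul]
  · intro s t hs ht
    rw [map_add, map_add, smul_add, hs, ht]

variable {W : Opens M} (h : W ≤ U)

theorem resV_linV (a : 𝓔.O U) (ξ : PlusDual ι U) :
    resV ι h (linV a ξ) = linV (𝓔.res h a) (PlusDual.res h ξ) := by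
  rw [linV, resV_tmul, resExt_ι, linV]

theorem resV_pullV (a : 𝓔.O U) : resV ι h (pullV a) = pullV (𝓔.res h a) := by
  rw [pullV, resV_tmul, map_one, pullV]

theorem resV_mem_linFunV {t : FunV ι U} (ht : t ∈ LinFunV ι U) : resV ι h t ∈ LinFunV ι W := by
  refine LinFunV.induction (p := fun t => resV ι h t ∈ LinFunV ι W) ht (fun a ξ => ?_)
    fun s t hs ht => ?_
  · rw [resV_linV]; exact linV_mem _ _
  · rw [map_add]; exact Submodule.add_mem _ hs ht

theorem resV_mem_degV {m : ℕ} {t : FunV ι U} (ht : t ∈ degV ι U m) : resV ι h t ∈ degV ι W m := by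
  refine degPoly_induction (p := fun t => resV ι h t ∈ degV ι W m) ht ?_ ?_ ?_
  · rw [map_zero]; exact Submodule.zero_mem _
  · intro i j a b hm ha hb
    change resV ι h (GradedTensorProduct.tmul _ a b) ∈ _
    rw [resV_tmul, ← hm]
    exact polyMul_mem (𝓔.res_mem_deg h i a ha) (resExt_mem ι h j b hb)
  · intro s t hs ht
    rw [map_add]; exact Submodule.add_mem _ hs ht

theorem res_contract (u : SecPlus ι U) {t : FunV ι U} (ht : t ∈ LinFunV ι U) :
    𝓔.res h (contract u t) = contract (SecPlus.res h u) (resV ι h t) := by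
  refine LinFunV.induction
    (p := fun t => 𝓔.res h (contract u t) = contract (SecPlus.res h u) (resV ι h t)) ht
    (fun a ξ => ?_) fun s t hs ht => ?_
  · rw [resV_linV, contract_linV, contract_linV, 𝓔.res_smul, resFn_pairPlus]
    rfl
  · rw [map_add, map_add, map_add, map_add, hs, ht]

end FunV

section Frames

variable {U : Opens M} (hU : IsCoordDomain 𝓔.toGradedPresheaf U)

/-- The frame of `E*` over a coordinate domain. -/
def IsCoordDomain.y (i : hU.frame.I) : 𝓔.deg U 1 := ⟨hU.frame.y i, hU.frame.mem i⟩

/-- The dual frame of `E`. -/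
def IsCoordDomain.e (i : hU.frame.I) : SecE 𝓔 U := hU.secOfDer (hU.frame.der i)

/-- The dual basis identity for `E*`, valid over every smaller open set. The other expansions below
follow from it by duality or by projection to `V₊`. -/
theorem IsCoordDomain.deg_expand {W : Opens M} (h : W ≤ U) (f : 𝓔.deg W 1) :
    f = ∑ i, pair (hU.e i) h f • resDeg h (hU.y i) := by
  apply Subtype.ext
  rw [AddSubmonoidClass.coe_finsetSum]
  nth_rewrite 1 [hU.frame.expand W h f f.2]
  refine Finset.sum_congr rfl fun i _ => ?_
  rw [← hU.algebraMap_pair_secOfDer (hU.frame.der i) h f, ← Algebra.smul_def]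
  rfl

theorem IsCoordDomain.secE_expand {W : Opens M} (h : W ≤ U) (s : SecE 𝓔 W) :
    s = ∑ i, pair s le_rfl (resDeg h (hU.y i)) • SecE.res h (hU.e i) := by
  refine SecE.ext fun V h' f => ?_
  rw [pair_sum]
  nth_rewrite 1 [hU.deg_expand (h'.trans h) f]
  rw [map_sum]
  refine Finset.sum_congr rfl fun i _ => ?_
  rw [map_smul, pair_smul, LinearMap.smul_apply, resFn_pair, smul_eq_mul, smul_eq_mul, mul_comm,
    resDeg_resDeg]
  rfl

variable (ι)

/-- The invariant parts of the frame of `E*`. -/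
def IsCoordDomain.yPlus (i : hU.frame.I) : PlusDual ι U := plusDual ι U (hU.y i)

/-- The projections to `V₊` of the frame of `E`. -/
def IsCoordDomain.ePlus (i : hU.frame.I) : SecPlus ι U := (hU.e i).plus ι

variable {ι}

/-- The projected families `yPlus` and `ePlus` may be linearly dependent. A dual basis identity
nevertheless survives the projection, and no frame adapted to `V₊` has to be constructed. -/
theorem IsCoordDomain.plusDual_expand {W : Opens M} (h : W ≤ U) (ξ : PlusDual ι W) :
    ξ = ∑ i, pairPlus (hU.ePlus ι i) h ξ • PlusDual.res h (hU.yPlus ι i) := by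
  nth_rewrite 1 [← plusDual_of_mem ι ξ]
  nth_rewrite 1 [hU.deg_expand h ⟨ξ, plusDual_le ι W ξ.2⟩]
  rw [map_sum]
  refine Finset.sum_congr rfl fun i _ => ?_
  rw [map_smul, yPlus, res_plusDual, ePlus, pairPlus_plus]

theorem IsCoordDomain.secPlus_expand {W : Opens M} (h : W ≤ U) (u : SecPlus ι W) :
    u = ∑ i, pairPlus u le_rfl (PlusDual.res h (hU.yPlus ι i)) • SecPlus.res h (hU.ePlus ι i) := by
  refine SecPlus.ext fun V h' ξ => ?_
  rw [pairPlus_sum]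
  nth_rewrite 1 [hU.plusDual_expand (h'.trans h) ξ]
  rw [map_sum]
  refine Finset.sum_congr rfl fun i _ => ?_
  rw [map_smul, pairPlus_smul, resFn_pairPlus, smul_eq_mul, mul_comm,
    show PlusDual.res h' (PlusDual.res h (hU.yPlus ι i)) = PlusDual.res (h'.trans h) _ from
      Subtype.ext (𝓔.res_res h h' _)]
  rfl

theorem IsCoordDomain.linFunV_expand {W : Opens M} (h : W ≤ U) {t : FunV ι W}
    (ht : t ∈ LinFunV ι W) :
    t = ∑ i, linV (contract (SecPlus.res h (hU.ePlus ι i)) t) (PlusDual.res h (hU.yPlus ι i)) := by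
  refine LinFunV.induction (p := fun t => t = ∑ i, linV
    (contract (SecPlus.res h (hU.ePlus ι i)) t) (PlusDual.res h (hU.yPlus ι i))) ht
    (fun a ξ => ?_) fun s t hs ht => ?_
  · nth_rewrite 1 [hU.plusDual_expand h ξ]
    rw [linV_sum_right]
    refine Finset.sum_congr rfl fun i _ => ?_
    rw [contract_linV, linV_smul_left, linV_smul_right]
    rfl
  · nth_rewrite 1 [hs, ht]
    simp only [map_add, linV_add_left, Finset.sum_add_distrib]

/-- A linear function of degree 2 on `𝓥` is determined by its contractions. -/
theorem IsCoordDomain.linFunV_ext {W : Opens M} (h : W ≤ U) {s t : FunV ι W}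
    (hs : s ∈ LinFunV ι W) (ht : t ∈ LinFunV ι W)
    (hs' : s ∈ degV ι W 2) (ht' : t ∈ degV ι W 2)
    (hst : ∀ i j, pair (hU.e i) h (proj₁ 𝓔 W (contract (SecPlus.res h (hU.ePlus ι j)) s))
      = pair (hU.e i) h (proj₁ 𝓔 W (contract (SecPlus.res h (hU.ePlus ι j)) t))) : s = t := by
  -- In total degree 2 the coefficient of each fibre coordinate has degree 1, so `proj₁` loses
  -- nothing.
  have hp : ∀ a : 𝓔.O W, a ∈ 𝓔.deg W 1 → (proj₁ 𝓔 W a : 𝓔.O W) = a := fun a ha =>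
    DirectSum.decompose_of_mem_same _ ha
  rw [hU.linFunV_expand h hs, hU.linFunV_expand h ht]
  refine Finset.sum_congr rfl fun j _ => ?_
  congr 1
  rw [← hp _ (contract_mem (m := 1) _ hs'), ← hp _ (contract_mem (m := 1) _ ht')]
  congr 1
  rw [hU.deg_expand h (proj₁ 𝓔 W (contract (SecPlus.res h (hU.ePlus ι j)) s)),
    hU.deg_expand h (proj₁ 𝓔 W (contract (SecPlus.res h (hU.ePlus ι j)) t))]
  simp only [hst]

end Frames

end LinearFunctions

/-! ### From a connection on `𝓥*` to a Courant algebroid connection. -/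

section DualConnection

variable {n : ℕ} {M : Type v} [TopologicalSpace M]
  [ChartedSpace (EuclideanSpace ℝ (Fin n)) M]

theorem coe_proj₁ {𝓔 : GradedManifold.{u, v} n M} {U : Opens M} {a : 𝓔.O U} (ha : a ∈ 𝓔.deg U 1) :
    (proj₁ 𝓔 U a : 𝓔.O U) = a :=
  DirectSum.decompose_of_mem_same _ ha

theorem proj₁_eq {𝓔 : GradedManifold.{u, v} n M} {U : Opens M} {a : 𝓔.O U} (ha : a ∈ 𝓔.deg U 1) :
    proj₁ 𝓔 U a = ⟨a, ha⟩ :=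
  Subtype.ext (coe_proj₁ ha)

theorem resDeg_proj₁ {𝓔 : GradedManifold.{u, v} n M} {U W : Opens M} (h : W ≤ U) {a : 𝓔.O U}
    (ha : a ∈ 𝓔.deg U 1) : resDeg h (proj₁ 𝓔 U a) = proj₁ 𝓔 W (𝓔.res h a) := by
  rw [proj₁_eq ha, proj₁_eq (𝓔.res_mem_deg h 1 a ha)]
  rfl

/-- Over each coordinate domain the pairing defines a section of `V₊`. These agree on overlaps, glue
as sections of `E`, and the result is projected to `V₊`. -/
theorem SecPlus.exists_of_coord_pairing {𝓔 : GradedManifold.{u, v} n M} (ι : BaseInvolution 𝓔)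
    (φ : ∀ U : {U : Opens M // IsCoordDomain 𝓔.toGradedPresheaf U},
      PlusDual ι U.1 →ₗ[SmoothFn n U.1] SmoothFn n U.1)
    (hφ : ∀ (U W : {U : Opens M // IsCoordDomain 𝓔.toGradedPresheaf U}) (h : W.1 ≤ U.1)
      (ξ : PlusDual ι U.1), resFn n h (φ U ξ) = φ W (PlusDual.res h ξ)) :
    ∃ u : SecPlus ι ⊤, ∀ (U : {U : Opens M // IsCoordDomain 𝓔.toGradedPresheaf U})
      (ξ : PlusDual ι U.1), pairPlus u le_top ξ = φ U ξ := by
  choose s hs using fun U : {U : Opens M // IsCoordDomain 𝓔.toGradedPresheaf U} =>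
    SecPlus.exists_of_pairing ι (U := U.1) (fun W => φ ⟨W.1, U.2.mono W.2⟩)
      (fun W W' h ξ => hφ ⟨W.1, U.2.mono W.2⟩ ⟨W'.1, U.2.mono W'.2⟩ h ξ)
  obtain ⟨t, ht⟩ := SecE.exists_glue (U := (⊤ : Opens M))
    (fun U : {U : Opens M // IsCoordDomain 𝓔.toGradedPresheaf U} => U.1)
    (fun x _ => by
      obtain ⟨U, hx, hU⟩ := 𝓔.locally_free x
      exact ⟨⟨U, hU⟩, hx⟩) (fun U => (s U).1)
    (fun U U' V h h' f => by
      rw [pair_eq_pairPlus, pair_eq_pairPlus, hs, hs])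
  refine ⟨t.plus ι, fun U ξ => ?_⟩
  rw [pairPlus_plus, ht U U.1 le_top le_rfl]
  exact hs U U.1 le_rfl ξ

variable {𝓔 : NQSymplecticManifold.{u, v} n M}

variable (𝓔) in
/-- The function `Q f` of degree 1, for a smooth function `f`. -/
def dFn (U : Opens M) (f : SmoothFn n U) : 𝓔.deg U 1 :=
  proj₁ 𝓔.toGradedManifold U (app 𝓔.Q le_top (algebraMap _ (𝓔.O U) f))

theorem app_Q_mem {U : Opens M} {i : ℕ} {a : 𝓔.O U} (ha : a ∈ 𝓔.deg U i) :
    app 𝓔.Q le_top a ∈ 𝓔.deg U (i + 1) := by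
  have := app_mem 𝓔.Q le_top ha
  exact_mod_cast this

theorem app_Q_algebraMap_mem {U : Opens M} (f : SmoothFn n U) :
    app 𝓔.Q le_top (algebraMap _ (𝓔.O U) f) ∈ 𝓔.deg U 1 :=
  app_Q_mem (SetLike.algebraMap_mem_graded (𝓔.deg U) f)

theorem coe_dFn {U : Opens M} (f : SmoothFn n U) :
    (dFn 𝓔 U f : 𝓔.O U) = app 𝓔.Q le_top (algebraMap _ (𝓔.O U) f) :=
  coe_proj₁ (app_Q_algebraMap_mem f)

theorem dFn_add {U : Opens M} (f g : SmoothFn n U) : dFn 𝓔 U (f + g) = dFn 𝓔 U f + dFn 𝓔 U g := by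
  rw [dFn, map_add, app_add, map_add]; rfl

theorem dFn_mul {U : Opens M} (f g : SmoothFn n U) :
    dFn 𝓔 U (f * g) = f • dFn 𝓔 U g + g • dFn 𝓔 U f := by
  apply Subtype.ext
  rw [coe_dFn, map_mul, app_mul 𝓔.Q le_top (SetLike.algebraMap_mem_graded (𝓔.deg U) f),
    Submodule.coe_add, Submodule.coe_smul, Submodule.coe_smul, coe_dFn, coe_dFn, Algebra.smul_def,
    Algebra.smul_def, Algebra.commutes g]
  simp [add_comm]

theorem resDeg_dFn {U W : Opens M} (h : W ≤ U) (f : SmoothFn n U) :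
    resDeg h (dFn 𝓔 U f) = dFn 𝓔 W (resFn n h f) := by
  rw [dFn, resDeg_proj₁ h (app_Q_algebraMap_mem f), res_app, 𝓔.res_algebraMap]
  rfl

theorem resFn_anchor {U : Opens M} (e : SecE 𝓔.toGradedManifold ⊤) (f : SmoothFn n (⊤ : Opens M)) :
    resFn n (le_top : U ≤ ⊤) (anchor e f) = pair e le_top (dFn 𝓔 U (resFn n le_top f)) := by
  rw [← resDeg_dFn le_top, ← resFn_pair e le_rfl le_top]
  rfl

variable {ι : GeneralizedMetric 𝓔}

namespace Connection

variable (Q : Connection ι) (U : {U : Opens M // IsCoordDomain 𝓔.toGradedPresheaf U})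

theorem D_linV {i : ℕ} {a : 𝓔.O U.1} (ha : a ∈ 𝓔.deg U.1 i) (ξ : PlusDual ι.toBaseInvolution U.1) :
    Q.D U (linV a ξ) = linV (app 𝓔.Q le_top a) ξ
      + (-1 : ℤˣ) ^ i • (pullV a * Q.D U (linV 1 ξ)) := by
  have h := Q.leibniz U i (pullV a) (linV 1 ξ) (pullV_mem_degV ha)
  rwa [pullV_mul_linV, mul_one, Q.projects, pullV_mul_linV, mul_one] at h

/-- A smooth function can be moved between the coefficient and the fibre coordinate; as a
coefficient it falls under the Leibniz rule. -/
theorem D_linV_one_smul (c : SmoothFn n U.1) (ξ : PlusDual ι.toBaseInvolution U.1) :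
    Q.D U (linV 1 (c • ξ)) = linV (dFn 𝓔 U.1 c : 𝓔.O U.1) ξ + c • Q.D U (linV 1 ξ) := by
  have h := Q.D_linV U (SetLike.algebraMap_mem_graded (𝓔.deg U.1) c) ξ
  rwa [pow_zero, one_smul, pullV_algebraMap_mul, ← coe_dFn, Algebra.algebraMap_eq_smul_one,
    linV_smul_left, ← linV_smul_right] at h

theorem D_linV_one_mem (ξ : PlusDual ι.toBaseInvolution U.1) :
    Q.D U (linV 1 ξ) ∈ LinFunV ι.toBaseInvolution U.1 :=
  Q.linear U _ (linV_mem _ _)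

theorem D_linV_one_mem_degV (ξ : PlusDual ι.toBaseInvolution U.1) :
    Q.D U (linV 1 ξ) ∈ degV ι.toBaseInvolution U.1 2 :=
  Q.degree U 1 _ (linV_mem_degV (SetLike.GradedOne.one_mem (A := 𝓔.deg U.1)) ξ)

theorem contract_D_mem (u : SecPlus ι.toBaseInvolution U.1) (ξ : PlusDual ι.toBaseInvolution U.1) :
    contract u (Q.D U (linV 1 ξ)) ∈ 𝓔.deg U.1 1 :=
  contract_mem u (Q.D_linV_one_mem_degV U ξ)

theorem resV_D_linV_one (W : {U : Opens M // IsCoordDomain 𝓔.toGradedPresheaf U}) (h : W.1 ≤ U.1)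
    (ξ : PlusDual ι.toBaseInvolution U.1) :
    resV ι.toBaseInvolution h (Q.D U (linV 1 ξ)) = Q.D W (linV 1 (PlusDual.res h ξ)) := by
  rw [Q.res_D U W h, resV_linV, map_one]

theorem proj₁_contract_D_smul {V : Opens M} (h : U.1 ≤ V) (u : SecPlus ι.toBaseInvolution V)
    (c : SmoothFn n U.1) (ξ : PlusDual ι.toBaseInvolution U.1) :
    proj₁ 𝓔.toGradedManifold U.1 (contract (SecPlus.res h u) (Q.D U (linV 1 (c • ξ))))
      = pairPlus u h ξ • dFn 𝓔 U.1 c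
        + c • proj₁ 𝓔.toGradedManifold U.1 (contract (SecPlus.res h u) (Q.D U (linV 1 ξ))) := by
  have h1 := congrArg (contract (SecPlus.res h u)) (Q.D_linV_one_smul U c ξ)
  rw [(contract (SecPlus.res h u)).map_add, (contract (SecPlus.res h u)).map_smul,
    contract_linV] at h1
  rw [h1, (proj₁ 𝓔.toGradedManifold U.1).map_add, (proj₁ 𝓔.toGradedManifold U.1).map_smul,
    (proj₁ 𝓔.toGradedManifold U.1).map_smul]
  have h2 : proj₁ 𝓔.toGradedManifold U.1 (dFn 𝓔 U.1 c : 𝓔.O U.1) = dFn 𝓔 U.1 c :=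
    proj₁_eq (dFn 𝓔 U.1 c).2
  exact congrArg (fun z => pairPlus u h ξ • z + _) h2

/-- The local expression `⟨∇ₑ u, ξ⟩ = ⟨e, Q⟨u, ξ⟩⟩ - ⟨e, ⟨u, Q ξ⟩⟩`. -/
def dualForm {V : Opens M} (h : U.1 ≤ V) (e : SecE 𝓔.toGradedManifold V)
    (u : SecPlus ι.toBaseInvolution V) :
    PlusDual ι.toBaseInvolution U.1 →ₗ[SmoothFn n U.1] SmoothFn n U.1 where
  toFun ξ := pair e h (dFn 𝓔 U.1 (pairPlus u h ξ))
    - pair e h (proj₁ 𝓔.toGradedManifold U.1 (contract (SecPlus.res h u) (Q.D U (linV 1 ξ))))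
  map_add' ξ η := by
    simp only [map_add, dFn_add, linV_add_right]
    ring
  -- The term `⟨u, ξ⟩ ⟨e, dFn c⟩` occurs in both summands and cancels, which makes the difference
  -- linear in `ξ`.
  map_smul' c ξ := by
    rw [proj₁_contract_D_smul, map_smul, smul_eq_mul, dFn_mul, map_add, map_smul, map_smul,
      map_add, map_smul, map_smul, RingHom.id_apply, smul_sub, add_comm, add_sub_add_left_eq_sub]

theorem resFn_dualForm {V : Opens M} (W : {U : Opens M // IsCoordDomain 𝓔.toGradedPresheaf U})
    (hU : U.1 ≤ V) (h : W.1 ≤ U.1) (e : SecE 𝓔.toGradedManifold V)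
    (u : SecPlus ι.toBaseInvolution V) (ξ : PlusDual ι.toBaseInvolution U.1) :
    resFn n h (Q.dualForm U hU e u ξ) = Q.dualForm W (h.trans hU) e u (PlusDual.res h ξ) := by
  change resFn n h (pair e hU _ - pair e hU _) = pair e _ _ - pair e _ _
  rw [map_sub, resFn_pair, resFn_pair, resDeg_dFn, resFn_pairPlus,
    resDeg_proj₁ h (Q.contract_D_mem U _ ξ), res_contract h _ (Q.D_linV_one_mem U ξ),
    resV_D_linV_one Q U W]
  rfl

theorem exists_nabla (e : SecE 𝓔.toGradedManifold ⊤) (u : SecPlus ι.toBaseInvolution ⊤) :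
    ∃ w : SecPlus ι.toBaseInvolution ⊤,
      ∀ (U : {U : Opens M // IsCoordDomain 𝓔.toGradedPresheaf U})
        (ξ : PlusDual ι.toBaseInvolution U.1),
        pairPlus w le_top ξ = Q.dualForm U le_top e u ξ :=
  SecPlus.exists_of_coord_pairing ι.toBaseInvolution (fun U => Q.dualForm U le_top e u)
    fun U W h ξ => Q.resFn_dualForm U W le_top h e u ξ

theorem dualForm_apply {V : Opens M} (h : U.1 ≤ V) (e : SecE 𝓔.toGradedManifold V)
    (u : SecPlus ι.toBaseInvolution V) (ξ : PlusDual ι.toBaseInvolution U.1) :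
    Q.dualForm U h e u ξ = pair e h (dFn 𝓔 U.1 (pairPlus u h ξ))
    - pair e h (proj₁ 𝓔.toGradedManifold U.1 (contract (SecPlus.res h u) (Q.D U (linV 1 ξ)))) :=
  rfl

theorem dualForm_add_left {V : Opens M} (h : U.1 ≤ V) (e e' : SecE 𝓔.toGradedManifold V)
    (u : SecPlus ι.toBaseInvolution V) (ξ : PlusDual ι.toBaseInvolution U.1) :
    Q.dualForm U h (e + e') u ξ = Q.dualForm U h e u ξ + Q.dualForm U h e' u ξ := by
  rw [dualForm_apply, dualForm_apply, dualForm_apply, pair_add, LinearMap.add_apply,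
    LinearMap.add_apply]
  ring

theorem dualForm_smul_left {V : Opens M} (h : U.1 ≤ V) (f : SmoothFn n V)
    (e : SecE 𝓔.toGradedManifold V) (u : SecPlus ι.toBaseInvolution V)
    (ξ : PlusDual ι.toBaseInvolution U.1) :
    Q.dualForm U h (f • e) u ξ = resFn n h f * Q.dualForm U h e u ξ := by
  rw [dualForm_apply, dualForm_apply, pair_smul, LinearMap.smul_apply, LinearMap.smul_apply,
    smul_eq_mul, smul_eq_mul, mul_sub]

theorem proj₁_contract_add {W : Opens M} (u u' : SecPlus ι.toBaseInvolution W)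
    (t : FunV ι.toBaseInvolution W) :
    proj₁ 𝓔.toGradedManifold W (contract (u + u') t)
      = proj₁ 𝓔.toGradedManifold W (contract u t)
        + proj₁ 𝓔.toGradedManifold W (contract u' t) := by
  rw [contract_add]
  exact (proj₁ 𝓔.toGradedManifold W).map_add _ _

theorem proj₁_contract_smul {W : Opens M} (f : SmoothFn n W) (u : SecPlus ι.toBaseInvolution W)
    (t : FunV ι.toBaseInvolution W) :
    proj₁ 𝓔.toGradedManifold W (contract (f • u) t)
      = f • proj₁ 𝓔.toGradedManifold W (contract u t) := by
  rw [contract_smul]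
  exact (proj₁ 𝓔.toGradedManifold W).map_smul _ _

theorem dualForm_add_right {V : Opens M} (h : U.1 ≤ V) (e : SecE 𝓔.toGradedManifold V)
    (u u' : SecPlus ι.toBaseInvolution V) (ξ : PlusDual ι.toBaseInvolution U.1) :
    Q.dualForm U h e (u + u') ξ = Q.dualForm U h e u ξ + Q.dualForm U h e u' ξ := by
  rw [dualForm_apply, dualForm_apply, dualForm_apply, pairPlus_add, dFn_add,
    show SecPlus.res h (u + u') = SecPlus.res h u + SecPlus.res h u' from rfl,
    proj₁_contract_add, (pair e h).map_add, (pair e h).map_add]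
  ring

/-- Contraction is linear in `u`, so only `dFn (pairPlus u h ξ)` differentiates `f`. The additional
term becomes the anchor term in the Leibniz rule of `∇`. -/
theorem dualForm_smul_right {V : Opens M} (h : U.1 ≤ V) (f : SmoothFn n V)
    (e : SecE 𝓔.toGradedManifold V) (u : SecPlus ι.toBaseInvolution V)
    (ξ : PlusDual ι.toBaseInvolution U.1) :
    Q.dualForm U h e (f • u) ξ = resFn n h f * Q.dualForm U h e u ξ
      + pair e h (dFn 𝓔 U.1 (resFn n h f)) * pairPlus u h ξ := by
  rw [dualForm_apply, dualForm_apply, pairPlus_smul, dFn_mul,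
    show SecPlus.res h (f • u) = resFn n h f • SecPlus.res h u from rfl,
    proj₁_contract_smul, (pair e h).map_add, (pair e h).map_smul, (pair e h).map_smul,
    (pair e h).map_smul, smul_eq_mul, smul_eq_mul, smul_eq_mul]
  ring

theorem exists_courantConnection : ∃ C : CourantConnection ι,
    ∀ (e : SecE 𝓔.toGradedManifold ⊤) (u : SecPlus ι.toBaseInvolution ⊤)
      (U : {U : Opens M // IsCoordDomain 𝓔.toGradedPresheaf U})
      (ξ : PlusDual ι.toBaseInvolution U.1),
      pairPlus (C.nabla e u) le_top ξ = Q.dualForm U le_top e u ξ := by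
  choose N hN using Q.exists_nabla
  refine ⟨⟨N, fun e e' u => ?_, fun e u u' => ?_, fun f e u => ?_, fun f e u => ?_⟩, hN⟩
  · refine SecPlus.ext_coord fun U _ hU ξ => ?_
    rw [pairPlus_add, hN _ _ ⟨U, hU⟩, hN _ _ ⟨U, hU⟩, hN _ _ ⟨U, hU⟩, dualForm_add_left]
  · refine SecPlus.ext_coord fun U _ hU ξ => ?_
    rw [pairPlus_add, hN _ _ ⟨U, hU⟩, hN _ _ ⟨U, hU⟩, hN _ _ ⟨U, hU⟩, dualForm_add_right]
  · refine SecPlus.ext_coord fun U _ hU ξ => ?_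
    rw [pairPlus_smul, hN _ _ ⟨U, hU⟩, hN _ _ ⟨U, hU⟩, dualForm_smul_left]
  · refine SecPlus.ext_coord fun U _ hU ξ => ?_
    rw [pairPlus_add, pairPlus_smul, pairPlus_smul, hN _ _ ⟨U, hU⟩, hN _ _ ⟨U, hU⟩,
      dualForm_smul_right, resFn_anchor]

/-- The Courant algebroid connection dual to a connection. -/
def toCourant : CourantConnection ι :=
  Q.exists_courantConnection.choose

theorem pairPlus_toCourant (e : SecE 𝓔.toGradedManifold ⊤) (u : SecPlus ι.toBaseInvolution ⊤)
    (ξ : PlusDual ι.toBaseInvolution U.1) :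
    pairPlus (Q.toCourant.nabla e u) le_top ξ = Q.dualForm U le_top e u ξ :=
  Q.exists_courantConnection.choose_spec e u U ξ

/-- Duality prescribes the pairings of `∇ₑ u` over all coordinate domains, and these determine it.
-/
theorem isDual_iff (C : CourantConnection ι) : IsDual Q C ↔ Q.toCourant = C := by
  constructor
  · intro h
    ext e u
    refine SecPlus.ext_coord fun U _ hU ξ => ?_
    rw [Q.pairPlus_toCourant ⟨U, hU⟩]
    change pair e _ _ - pair e _ _ = _
    rw [sub_eq_iff_eq_add]
    exact h e u ⟨U, hU⟩ ξ
  · rintro rfl e u U ξ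
    rw [Q.pairPlus_toCourant U]
    exact (sub_add_cancel _ _).symm

/-- A connection is determined by its values on the fibre coordinates. -/
theorem ext_linV {Q Q' : Connection ι}
    (h : ∀ (U : {U : Opens M // IsCoordDomain 𝓔.toGradedPresheaf U})
      (ξ : PlusDual ι.toBaseInvolution U.1), Q.D U (linV 1 ξ) = Q'.D U (linV 1 ξ)) : Q = Q' := by
  ext1
  funext U
  exact OddPoly.ext_of_leibniz (𝒜 := 𝓔.deg U.1) (P := PlusDual ι.toBaseInvolution U.1)
    (RingHom.id (FunV ι.toBaseInvolution U.1)) (Q.D U) (Q'.D U) (Q.leibniz U) (Q'.leibniz U)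
    (fun a => (Q.projects U a).trans (Q'.projects U a).symm) (h U)

end Connection

end DualConnection

/-! ### Localisation of Courant algebroid connections. -/

section LocalNabla

variable {n : ℕ} {M : Type v} [TopologicalSpace M]
  [ChartedSpace (EuclideanSpace ℝ (Fin n)) M]

theorem AgreeOn.mono {𝓔 : GradedManifold.{u, v} n M} {U U' V V' : Opens M} {s : SecE 𝓔 U}
    {t : SecE 𝓔 U'} (h : AgreeOn V s t) (hV : V' ≤ V) : AgreeOn V' s t :=
  fun W hW => h W (hW.trans hV)

theorem AgreeOn.symm {𝓔 : GradedManifold.{u, v} n M} {U U' V : Opens M} {s : SecE 𝓔 U}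
    {t : SecE 𝓔 U'} (h : AgreeOn V s t) : AgreeOn V t s :=
  fun W hW h₁ h₂ f => (h W hW h₂ h₁ f).symm

theorem AgreeOn.add {𝓔 : GradedManifold.{u, v} n M} {U U' V : Opens M} {s s' : SecE 𝓔 U}
    {t t' : SecE 𝓔 U'} (h : AgreeOn V s t) (h' : AgreeOn V s' t') :
    AgreeOn V (s + s') (t + t') :=
  fun W hW h₁ h₂ f => congrArg₂ (· + ·) (h W hW h₁ h₂ f) (h' W hW h₁ h₂ f)

theorem AgreeOn.smul {𝓔 : GradedManifold.{u, v} n M} {U V : Opens M} {s : SecE 𝓔 ⊤}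
    {t : SecE 𝓔 U} (h : AgreeOn V s t) {c : SmoothFn n (⊤ : Opens M)} {d : SmoothFn n U}
    (hV : V ≤ U) (hc : resFn n (le_top : V ≤ ⊤) c = resFn n hV d) : AgreeOn V (c • s) (d • t) := by
  intro W hW h₁ h₂ f
  have hc' := congrArg (resFn n hW) hc
  rw [resFn_resFn, resFn_resFn] at hc'
  rw [pair_smul, pair_smul, LinearMap.smul_apply, LinearMap.smul_apply, h W hW h₁ h₂ f, hc']

/-- `AgreeOn` tests only open sets on which both sections are defined, hence the condition that the
middle section be defined on all of `V`. -/
theorem AgreeOn.trans_left {𝓔 : GradedManifold.{u, v} n M} {U₁ U₂ U₃ V : Opens M} {s : SecE 𝓔 U₁}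
    {s' : SecE 𝓔 U₂} {t : SecE 𝓔 U₃} (hV : V ≤ U₂) (h : AgreeOn V s s') (h' : AgreeOn V s' t) :
    AgreeOn V s t :=
  fun W hW h₁ h₂ f => (h W hW h₁ (hW.trans hV) f).trans (h' W hW _ h₂ f)

theorem AgreeOn.res_right {𝓔 : GradedManifold.{u, v} n M} {U U' V W : Opens M} {s : SecE 𝓔 U}
    {t : SecE 𝓔 U'} (h : AgreeOn V s t) (hW : W ≤ U') : AgreeOn V s (SecE.res hW t) :=
  fun V' hV h₁ h₂ f => h V' hV h₁ (h₂.trans hW) f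

theorem AgreeOn.pairPlus {𝓔 : GradedManifold.{u, v} n M} {ι : BaseInvolution 𝓔}
    {U U' V : Opens M} {s : SecPlus ι U} {t : SecPlus ι U'} (h : AgreeOn V s.1 t.1)
    {W : Opens M} (hW : W ≤ V) (h₁ : W ≤ U) (h₂ : W ≤ U') (ξ : PlusDual ι W) :
    NQ.pairPlus s h₁ ξ = NQ.pairPlus t h₂ ξ :=
  h W hW h₁ h₂ _

theorem SmoothFn.exists_extension [IsManifold (𝓡 n) ∞ M] [T2Space M] {U : Opens M}
    (c : SmoothFn n U) {x : M} (hx : x ∈ U) :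
    ∃ (d : SmoothFn n (⊤ : Opens M)) (W : Opens M) (h : W ≤ U), x ∈ W ∧
      resFn n le_top d = resFn n h c := by
  obtain ⟨χ, W, V, hxW, hWU, hUV, h1, h0⟩ := exists_bump (n := n) hx
  classical
  obtain ⟨d, hd⟩ := exists_smoothFn (n := n) (U := (⊤ : Opens M))
    (fun y => if hy : y ∈ U then χ ⟨y, trivial⟩ * c ⟨y, hy⟩ else 0) (fun y _ => by
      have : y ∈ U ⊔ V := by rw [hUV]; trivial
      rcases this with h | h
      · refine ⟨U, h, resFn n le_top χ * c, fun z hz _ => ?_⟩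
        rw [dif_pos hz]
        rfl
      · refine ⟨V, h, 0, fun z hz _ => ?_⟩
        have : χ ⟨z, trivial⟩ = 0 := congrArg (fun f : SmoothFn n V => f ⟨z, hz⟩) h0
        split_ifs
        · rw [this, zero_mul]; rfl
        · rfl)
  refine ⟨d, W, hWU, hxW, ?_⟩
  ext y
  refine (hd y trivial).trans ?_
  have : χ ⟨y, trivial⟩ = 1 := congrArg (fun f : SmoothFn n W => f y) h1
  rw [dif_pos (hWU y.2), this, one_mul]
  rfl

/-- A section vanishing on `V` is annihilated by a function which is 1 near a point of `V`. -/
theorem SecE.exists_annihilator [IsManifold (𝓡 n) ∞ M] [T2Space M] {𝓔 : GradedManifold.{u, v} n M}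
    {V : Opens M} {s : SecE 𝓔 ⊤} (hs : AgreeOn V s (0 : SecE 𝓔 ⊤)) {x : M} (hx : x ∈ V) :
    ∃ (χ : SmoothFn n (⊤ : Opens M)) (W : Opens M), x ∈ W ∧ W ≤ V ∧
      (resFn n le_top χ : SmoothFn n W) = 1 ∧ χ • s = 0 := by
  obtain ⟨χ, W, V', hxW, hWV, hVV, h1, h0⟩ := exists_bump (n := n) hx
  refine ⟨χ, W, hxW, hWV, h1, SecE.ext_local fun y _ => ?_⟩
  have : y ∈ V ⊔ V' := by rw [hVV]; trivial
  rcases this with h | h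
  · refine ⟨V, h, fun V₁ hV₁ h₁ h₂ f => ?_⟩
    rw [pair_smul, LinearMap.smul_apply, hs V₁ hV₁ h₁ h₂ f]
    exact smul_zero _
  · refine ⟨V', h, fun V₁ hV₁ h₁ h₂ f => ?_⟩
    rw [pair_smul, LinearMap.smul_apply, ← resFn_resFn le_top hV₁, h0, map_zero, zero_smul]
    rfl

variable {𝓔 : NQSymplecticManifold.{u, v} n M} {ι : GeneralizedMetric 𝓔}

namespace CourantConnection

variable (C : CourantConnection ι)

theorem nabla_zero_left (u : SecPlus ι.toBaseInvolution ⊤) : C.nabla 0 u = 0 := by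
  have h := C.nabla_add_left 0 0 u
  rwa [add_zero, left_eq_add] at h

theorem nabla_zero_right (e : SecE 𝓔.toGradedManifold ⊤) : C.nabla e 0 = 0 := by
  have h := C.nabla_add_right e 0 0
  rwa [add_zero, left_eq_add] at h

variable [IsManifold (𝓡 n) ∞ M] [T2Space M]

/-- With `χ • e = 0` and `χ = 1` near the point, linearity gives `0 = χ • ∇ₑ u`, which is `∇ₑ u`
there. -/
theorem agreeOn_zero_left {V : Opens M} {e : SecE 𝓔.toGradedManifold ⊤}
    (he : AgreeOn V e (0 : SecE 𝓔.toGradedManifold ⊤)) (u : SecPlus ι.toBaseInvolution ⊤) :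
    AgreeOn V (C.nabla e u).1 (0 : SecE 𝓔.toGradedManifold ⊤) := by
  intro V' hV' h₁ h₂ f
  refine SmoothFn.ext_local fun x hx => ?_
  obtain ⟨χ, W, hxW, hWV, h1, h0⟩ := SecE.exists_annihilator (he.mono hV') hx
  refine ⟨W, hWV, hxW, ?_⟩
  have h := C.nabla_smul_left χ e u
  rw [h0, C.nabla_zero_left] at h
  have h' := congrArg (fun s : SecPlus ι.toBaseInvolution ⊤ => pair s.1 (le_top : W ≤ ⊤)
    (resDeg hWV f)) h
  change (0 : SmoothFn n W) = (resFn n le_top χ : SmoothFn n W) • pair (C.nabla e u).1 le_top (resDeg hWV f) at h'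
  rw [h1, one_smul] at h'
  rw [resFn_pair, resFn_pair]
  exact h'.symm

/-- With `χ • u = 0`, the Leibniz rule gives `0 = χ • ∇ₑ u + anchor e χ • u`. Near the point `χ =
1`, and the last term is zero because `u` itself vanishes there. -/
theorem agreeOn_zero_right {V : Opens M} (e : SecE 𝓔.toGradedManifold ⊤)
    {u : SecPlus ι.toBaseInvolution ⊤} (hu : AgreeOn V u.1 (0 : SecE 𝓔.toGradedManifold ⊤)) :
    AgreeOn V (C.nabla e u).1 (0 : SecE 𝓔.toGradedManifold ⊤) := by
  intro V' hV' h₁ h₂ f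
  refine SmoothFn.ext_local fun x hx => ?_
  obtain ⟨χ, W, hxW, hWV, h1, h0⟩ := SecE.exists_annihilator (hu.mono hV') hx
  refine ⟨W, hWV, hxW, ?_⟩
  have h := C.leibniz χ e u
  rw [show χ • u = 0 from Subtype.ext h0, C.nabla_zero_right] at h
  have h' := congrArg (fun s : SecPlus ι.toBaseInvolution ⊤ => pair s.1 (le_top : W ≤ ⊤)
    (resDeg hWV f)) h
  change (0 : SmoothFn n W) = (resFn n le_top χ : SmoothFn n W) • pair (C.nabla e u).1 le_top (resDeg hWV f)
    + (resFn n le_top (anchor e χ) : SmoothFn n W) • pair u.1 le_top (resDeg hWV f) at h'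
  rw [h1, one_smul, hu W (hWV.trans hV') le_top le_top] at h'
  rw [resFn_pair, resFn_pair]
  refine Eq.trans ?_ (h'.symm.trans rfl)
  exact ((congrArg _ (smul_zero _)).trans (add_zero _)).symm

/-- `∇ₑ u` depends only on the germs of `e` and `u`. -/
theorem agreeOn_nabla {V : Opens M} {e e' : SecE 𝓔.toGradedManifold ⊤}
    {u u' : SecPlus ι.toBaseInvolution ⊤} (he : AgreeOn V e e') (hu : AgreeOn V u.1 u'.1) :
    AgreeOn V (C.nabla e u).1 (C.nabla e' u').1 := by
  have hsub : AgreeOn V (e - e') (0 : SecE 𝓔.toGradedManifold ⊤) :=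
    fun W hW h₁ h₂ f => sub_eq_zero.2 (he W hW h₁ h₂ f)
  have hsub' : AgreeOn V (u - u').1 (0 : SecE 𝓔.toGradedManifold ⊤) :=
    fun W hW h₁ h₂ f => sub_eq_zero.2 (hu W hW h₁ h₂ f)
  have h1 := C.nabla_add_left (e - e') e' u
  have h2 := C.nabla_add_right e' (u - u') u'
  rw [sub_add_cancel] at h1 h2
  intro W hW h₁ h₂ f
  rw [h1, h2]
  change pair (C.nabla (e - e') u).1 _ f + (pair (C.nabla e' (u - u')).1 _ f
    + pair (C.nabla e' u').1 _ f) = _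
  rw [C.agreeOn_zero_left hsub u W hW h₁ h₂ f, C.agreeOn_zero_right e' hsub' W hW h₁ h₂ f]
  change 0 + (0 + _) = _
  rw [zero_add, zero_add]

/-- Near each point `e` and `u` have global extensions. By `agreeOn_nabla` the derivatives of
different extensions agree where the extensions do, so they glue. -/
theorem exists_localNabla {U : Opens M} (e : SecE 𝓔.toGradedManifold U)
    (u : SecPlus ι.toBaseInvolution U) :
    ∃ w : SecPlus ι.toBaseInvolution U, ∀ (e' : SecE 𝓔.toGradedManifold ⊤)
      (u' : SecPlus ι.toBaseInvolution ⊤) (W : Opens M) (h : W ≤ U),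
      AgreeOn W e' e → AgreeOn W u'.1 u.1 → ∀ ξ : PlusDual ι.toBaseInvolution W,
      pairPlus w h ξ = pairPlus (C.nabla e' u') le_top ξ := by
  choose ε W₁ hx₁ hW₁ hε using fun x : U => e.exists_extension x.2
  choose υ W₂ hx₂ hW₂ hυ using fun x : U => u.exists_extension x.2
  have hεx : ∀ x, AgreeOn (W₁ x ⊓ W₂ x) (ε x) e := fun x => (hε x).mono inf_le_left
  have hυx : ∀ x, AgreeOn (W₁ x ⊓ W₂ x) (υ x).1 u.1 := fun x => (hυ x).mono inf_le_right
  have key : ∀ (x : U) (e' : SecE 𝓔.toGradedManifold ⊤) (u' : SecPlus ι.toBaseInvolution ⊤)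
      (V : Opens M) (_ : V ≤ U), AgreeOn V e' e → AgreeOn V u'.1 u.1 → V ≤ W₁ x ⊓ W₂ x →
      AgreeOn V (C.nabla (ε x) (υ x)).1 (C.nabla e' u').1 := by
    intro x e' u' V hVU he hu hV
    exact C.agreeOn_nabla (((hεx x).mono hV).trans_left hVU he.symm)
      (((hυx x).mono hV).trans_left hVU hu.symm)
  obtain ⟨t, ht⟩ := SecE.exists_glue (fun x : U => W₁ x ⊓ W₂ x)
    (fun x hx => ⟨⟨x, hx⟩, hx₁ _, hx₂ _⟩)
    (fun x => SecE.res le_top (C.nabla (ε x) (υ x)).1) (fun x y V hx hy f =>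
      key x (ε y) (υ y) V (hx.trans (inf_le_left.trans (hW₁ x))) ((hεx y).mono hy)
        ((hυx y).mono hy) hx V le_rfl _ _ f)
  refine ⟨t.plus ι.toBaseInvolution, fun e' u' W h he hu ξ => ?_⟩
  refine SmoothFn.ext_local fun x hx => ?_
  let V := W ⊓ (W₁ ⟨x, h hx⟩ ⊓ W₂ ⟨x, h hx⟩)
  refine ⟨V, inf_le_left, ⟨hx, hx₁ _, hx₂ _⟩, ?_⟩
  rw [pairPlus_plus, resFn_pair, resFn_pairPlus, ht ⟨x, h hx⟩ V (inf_le_left.trans h) inf_le_right]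
  exact key ⟨x, h hx⟩ e' u' V (inf_le_left.trans h) (he.mono inf_le_left) (hu.mono inf_le_left)
    inf_le_right V le_rfl _ _ _

/-- The covariant derivative of local sections. -/
def localNabla {U : Opens M} (e : SecE 𝓔.toGradedManifold U) (u : SecPlus ι.toBaseInvolution U) :
    SecPlus ι.toBaseInvolution U :=
  (C.exists_localNabla e u).choose

theorem pairPlus_localNabla {U : Opens M} {e : SecE 𝓔.toGradedManifold U}
    {u : SecPlus ι.toBaseInvolution U} {e' : SecE 𝓔.toGradedManifold ⊤}
    {u' : SecPlus ι.toBaseInvolution ⊤} {W : Opens M} (h : W ≤ U) (he : AgreeOn W e' e)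
    (hu : AgreeOn W u'.1 u.1) (ξ : PlusDual ι.toBaseInvolution W) :
    pairPlus (C.localNabla e u) h ξ = pairPlus (C.nabla e' u') le_top ξ :=
  (C.exists_localNabla e u).choose_spec e' u' W h he hu ξ

/-- Here and in the rules that follow, the identity is checked near each point, on a neighbourhood
where all the data involved have global extensions, and is there inherited from `nabla`. -/
theorem localNabla_add_left {U : Opens M} (e e' : SecE 𝓔.toGradedManifold U)
    (u : SecPlus ι.toBaseInvolution U) :
    C.localNabla (e + e') u = C.localNabla e u + C.localNabla e' u := by
  refine SecPlus.ext fun V h ξ => SmoothFn.ext_local fun x hx => ?_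
  obtain ⟨ε, W₁, hx₁, -, hε⟩ := e.exists_extension (h hx)
  obtain ⟨ε', W₂, hx₂, -, hε'⟩ := e'.exists_extension (h hx)
  obtain ⟨υ, W₃, hx₃, -, hυ⟩ := u.exists_extension (h hx)
  refine ⟨V ⊓ (W₁ ⊓ (W₂ ⊓ W₃)), inf_le_left, ⟨hx, hx₁, hx₂, hx₃⟩, ?_⟩
  have h₁ := hε.mono (show V ⊓ (W₁ ⊓ (W₂ ⊓ W₃)) ≤ W₁ from fun _ h => h.2.1)
  have h₂ := hε'.mono (show V ⊓ (W₁ ⊓ (W₂ ⊓ W₃)) ≤ W₂ from fun _ h => h.2.2.1)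
  have h₃ := hυ.mono (show V ⊓ (W₁ ⊓ (W₂ ⊓ W₃)) ≤ W₃ from fun _ h => h.2.2.2)
  rw [pairPlus_add, map_add, resFn_pairPlus, resFn_pairPlus, resFn_pairPlus,
    C.pairPlus_localNabla _ (h₁.add h₂) h₃, C.pairPlus_localNabla _ h₁ h₃,
    C.pairPlus_localNabla _ h₂ h₃, C.nabla_add_left, pairPlus_add]

theorem localNabla_add_right {U : Opens M} (e : SecE 𝓔.toGradedManifold U)
    (u u' : SecPlus ι.toBaseInvolution U) :
    C.localNabla e (u + u') = C.localNabla e u + C.localNabla e u' := by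
  refine SecPlus.ext fun V h ξ => SmoothFn.ext_local fun x hx => ?_
  obtain ⟨ε, W₁, hx₁, -, hε⟩ := e.exists_extension (h hx)
  obtain ⟨υ, W₂, hx₂, -, hυ⟩ := u.exists_extension (h hx)
  obtain ⟨υ', W₃, hx₃, -, hυ'⟩ := u'.exists_extension (h hx)
  refine ⟨V ⊓ (W₁ ⊓ (W₂ ⊓ W₃)), inf_le_left, ⟨hx, hx₁, hx₂, hx₃⟩, ?_⟩
  have h₁ := hε.mono (show V ⊓ (W₁ ⊓ (W₂ ⊓ W₃)) ≤ W₁ from fun _ h => h.2.1)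
  have h₂ := hυ.mono (show V ⊓ (W₁ ⊓ (W₂ ⊓ W₃)) ≤ W₂ from fun _ h => h.2.2.1)
  have h₃ := hυ'.mono (show V ⊓ (W₁ ⊓ (W₂ ⊓ W₃)) ≤ W₃ from fun _ h => h.2.2.2)
  have h₂₃ : AgreeOn (V ⊓ (W₁ ⊓ (W₂ ⊓ W₃))) (υ + υ').1 (u + u').1 := h₂.add h₃
  rw [pairPlus_add, map_add, resFn_pairPlus, resFn_pairPlus, resFn_pairPlus,
    C.pairPlus_localNabla _ h₁ h₂₃, C.pairPlus_localNabla _ h₁ h₂,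
    C.pairPlus_localNabla _ h₁ h₃, C.nabla_add_right, pairPlus_add]

theorem localNabla_smul_left {U : Opens M} (c : SmoothFn n U) (e : SecE 𝓔.toGradedManifold U)
    (u : SecPlus ι.toBaseInvolution U) : C.localNabla (c • e) u = c • C.localNabla e u := by
  refine SecPlus.ext fun V h ξ => SmoothFn.ext_local fun x hx => ?_
  obtain ⟨ε, W₁, hx₁, -, hε⟩ := e.exists_extension (h hx)
  obtain ⟨d, W₂, hWU, hx₂, hd⟩ := c.exists_extension (h hx)
  obtain ⟨υ, W₃, hx₃, -, hυ⟩ := u.exists_extension (h hx)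
  refine ⟨V ⊓ (W₁ ⊓ (W₂ ⊓ W₃)), inf_le_left, ⟨hx, hx₁, hx₂, hx₃⟩, ?_⟩
  have h₁ := hε.mono (show V ⊓ (W₁ ⊓ (W₂ ⊓ W₃)) ≤ W₁ from fun _ h => h.2.1)
  have h₂ := congrArg (resFn n (show V ⊓ (W₁ ⊓ (W₂ ⊓ W₃)) ≤ W₂ from fun _ h => h.2.2.1)) hd
  have h₃ := hυ.mono (show V ⊓ (W₁ ⊓ (W₂ ⊓ W₃)) ≤ W₃ from fun _ h => h.2.2.2)
  rw [resFn_resFn, resFn_resFn] at h₂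
  rw [pairPlus_smul, map_mul, resFn_pairPlus, resFn_pairPlus,
    C.pairPlus_localNabla _ (h₁.smul (inf_le_left.trans h) h₂) h₃, C.pairPlus_localNabla _ h₁ h₃,
    C.nabla_smul_left, pairPlus_smul, h₂, resFn_resFn]

theorem localNabla_leibniz {U : Opens M} (c : SmoothFn n U) (e : SecE 𝓔.toGradedManifold U)
    (u : SecPlus ι.toBaseInvolution U) :
    C.localNabla e (c • u) = c • C.localNabla e u + pair e le_rfl (dFn 𝓔 U c) • u := by
  refine SecPlus.ext fun V h ξ => SmoothFn.ext_local fun x hx => ?_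
  obtain ⟨ε, W₁, hx₁, -, hε⟩ := e.exists_extension (h hx)
  obtain ⟨d, W₂, hWU, hx₂, hd⟩ := c.exists_extension (h hx)
  obtain ⟨υ, W₃, hx₃, -, hυ⟩ := u.exists_extension (h hx)
  refine ⟨V ⊓ (W₁ ⊓ (W₂ ⊓ W₃)), inf_le_left, ⟨hx, hx₁, hx₂, hx₃⟩, ?_⟩
  have h₁ := hε.mono (show V ⊓ (W₁ ⊓ (W₂ ⊓ W₃)) ≤ W₁ from fun _ h => h.2.1)
  have h₂ := congrArg (resFn n (show V ⊓ (W₁ ⊓ (W₂ ⊓ W₃)) ≤ W₂ from fun _ h => h.2.2.1)) hd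
  have h₃ := hυ.mono (show V ⊓ (W₁ ⊓ (W₂ ⊓ W₃)) ≤ W₃ from fun _ h => h.2.2.2)
  rw [resFn_resFn, resFn_resFn] at h₂
  have h₄ : AgreeOn (V ⊓ (W₁ ⊓ (W₂ ⊓ W₃))) (d • υ).1 (c • u).1 :=
    h₃.smul (inf_le_left.trans h) h₂
  rw [pairPlus_add, pairPlus_smul, pairPlus_smul, map_add, map_mul, map_mul, resFn_pairPlus,
    resFn_pairPlus, resFn_pairPlus, C.pairPlus_localNabla _ h₁ h₄, C.pairPlus_localNabla _ h₁ h₃,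
    C.leibniz, pairPlus_add, pairPlus_smul, pairPlus_smul, h₂, resFn_resFn, resFn_resFn,
    resFn_anchor, h₂, resFn_pair, resDeg_dFn, h₁ _ le_rfl le_top (inf_le_left.trans h),
    h₃.pairPlus le_rfl le_top (inf_le_left.trans h)]

theorem pairPlus_localNabla_res {U W : Opens M} (h : W ≤ U) (e : SecE 𝓔.toGradedManifold U)
    (u : SecPlus ι.toBaseInvolution U) (ξ : PlusDual ι.toBaseInvolution W) :
    pairPlus (C.localNabla (SecE.res h e) (SecPlus.res h u)) le_rfl ξ
      = pairPlus (C.localNabla e u) h ξ := by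
  refine SmoothFn.ext_local fun x hx => ?_
  obtain ⟨ε, W₁, hx₁, -, hε⟩ := e.exists_extension (h hx)
  obtain ⟨υ, W₂, hx₂, -, hυ⟩ := u.exists_extension (h hx)
  refine ⟨W ⊓ (W₁ ⊓ W₂), inf_le_left, ⟨hx, hx₁, hx₂⟩, ?_⟩
  have h₁ := hε.mono (show W ⊓ (W₁ ⊓ W₂) ≤ W₁ from fun _ h => h.2.1)
  have h₂ := hυ.mono (show W ⊓ (W₁ ⊓ W₂) ≤ W₂ from fun _ h => h.2.2)
  rw [resFn_pairPlus, resFn_pairPlus, C.pairPlus_localNabla _ h₁ h₂,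
    C.pairPlus_localNabla _ (h₁.res_right h) (h₂.res_right h)]

end CourantConnection

end LocalNabla

/-! ### From a Courant algebroid connection to a connection on `𝓥*`. -/

section InverseConstruction

variable {n : ℕ} {M : Type v} [TopologicalSpace M]
  [ChartedSpace (EuclideanSpace ℝ (Fin n)) M]

/-- Linear functions of degree 2 on `𝓥` with prescribed contractions. -/
theorem IsCoordDomain.exists_linFunV {𝓔 : GradedManifold.{u, v} n M} {ι : BaseInvolution 𝓔}
    {U : Opens M} (hU : IsCoordDomain 𝓔.toGradedPresheaf U)
    (B : SecE 𝓔 U →ₗ[SmoothFn n U] SecPlus ι U →ₗ[SmoothFn n U] SmoothFn n U) :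
    ∃ t : FunV ι U, t ∈ LinFunV ι U ∧ t ∈ degV ι U 2 ∧
      ∀ e u, pair e le_rfl (proj₁ 𝓔 U (contract u t)) = B e u := by
  -- The coefficients are those of `Σ B(eᵢ, eⱼ⁺) yᵢ yⱼ⁺`, the candidate suggested by the two dual
  -- basis identities.
  let b : hU.frame.I → 𝓔.deg U 1 := fun j => ∑ i, B (hU.e i) (hU.ePlus ι j) • hU.y i
  refine ⟨∑ j, linV (b j : 𝓔.O U) (hU.yPlus ι j), Submodule.sum_mem _ fun j _ => linV_mem _ _,
    Submodule.sum_mem _ fun j _ => linV_mem_degV (b j).2 _, fun e u => ?_⟩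
  have hc : contract u (∑ j, linV (b j : 𝓔.O U) (hU.yPlus ι j))
      = ((∑ j, pairPlus u le_rfl (hU.yPlus ι j) • b j : 𝓔.deg U 1) : 𝓔.O U) := by
    rw [map_sum, AddSubmonoidClass.coe_finsetSum]
    exact Finset.sum_congr rfl fun j _ => contract_linV _ _ _
  rw [hc, proj₁_eq (Subtype.prop _)]
  have hB : B e u = ∑ i, ∑ j, pair e le_rfl (hU.y i) * (pairPlus u le_rfl (hU.yPlus ι j)
      * B (hU.e i) (hU.ePlus ι j)) := by
    nth_rewrite 1 [hU.secE_expand le_rfl e, hU.secPlus_expand le_rfl u]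
    rw [map_sum B, LinearMap.sum_apply]
    refine Finset.sum_congr rfl fun i _ => ?_
    rw [map_sum]
    refine Finset.sum_congr rfl fun j _ => ?_
    rw [map_smul, LinearMap.map_smul, LinearMap.smul_apply, smul_eq_mul, smul_eq_mul]
    rw [mul_left_comm]
    have h1 : resDeg le_rfl (hU.y i) = hU.y i := Subtype.ext (𝓔.res_self U _)
    have h2 : PlusDual.res le_rfl (hU.yPlus ι j) = hU.yPlus ι j := Subtype.ext (𝓔.res_self U _)
    rw [h1, h2]
    rfl
  rw [hB, Finset.sum_comm, Subtype.coe_eta, map_sum]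
  refine Finset.sum_congr rfl fun j _ => ?_
  rw [map_smul, map_sum, Finset.smul_sum]
  refine Finset.sum_congr rfl fun i _ => ?_
  rw [map_smul, smul_eq_mul, smul_eq_mul]
  ring

theorem proj₁_contract_add_right {𝓔 : GradedManifold.{u, v} n M}
    {ι : BaseInvolution 𝓔} {W : Opens M} (u : SecPlus ι W)
    (s t : FunV ι W) :
    proj₁ 𝓔 W (contract u (s + t))
      = proj₁ 𝓔 W (contract u s)
        + proj₁ 𝓔 W (contract u t) := by
  rw [(contract u).map_add]
  exact (proj₁ 𝓔 W).map_add _ _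

theorem proj₁_contract_smul_right {𝓔 : GradedManifold.{u, v} n M}
    {ι : BaseInvolution 𝓔} {W : Opens M} (f : SmoothFn n W)
    (u : SecPlus ι W) (t : FunV ι W) :
    proj₁ 𝓔 W (contract u (f • t))
      = f • proj₁ 𝓔 W (contract u t) := by
  rw [(contract u).map_smul]
  exact (proj₁ 𝓔 W).map_smul _ _

/-- A derivation preserves the linear functions if it maps functions on `𝓔` to functions on `𝓔` and
fibre coordinates to linear functions. -/
theorem LinFunV.map_mem_of_leibniz {𝓔 : GradedManifold.{u, v} n M} {ι : BaseInvolution 𝓔}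
    {U : Opens M} (D : FunV ι U →+ FunV ι U)
    (hD : ∀ (m : ℕ) (s t : FunV ι U), s ∈ degV ι U m →
      D (s * t) = D s * t + (-1 : ℤˣ) ^ m • (s * D t))
    (hcoeff : ∀ a : 𝓔.O U, ∃ b : 𝓔.O U, D (pullV a) = pullV b)
    (hvar : ∀ ξ : PlusDual ι U, D (linV 1 ξ) ∈ LinFunV ι U) {t : FunV ι U} (ht : t ∈ LinFunV ι U) :
    D t ∈ LinFunV ι U := by
  refine LinFunV.induction (p := fun t => D t ∈ LinFunV ι U) ht (fun a ξ => ?_) fun s t hs ht => ?_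
  · induction a using DirectSum.Decomposition.inductionOn (𝓔.deg U) with
    | zero =>
      rw [linV_zero_left, map_zero]
      exact Submodule.zero_mem _
    | @homogeneous i a =>
      have h := hD i (pullV (a : 𝓔.O U)) (linV 1 ξ) (pullV_mem_degV a.2)
      obtain ⟨b, hb⟩ := hcoeff a
      rw [pullV_mul_linV, mul_one, hb, pullV_mul_linV] at h
      rw [h]
      exact Submodule.add_mem _ (linV_mem _ _)
        (zsmul_mem (pullV_mul_mem_linFunV _ (hvar ξ)) _)
    | add a b ha hb =>
      rw [linV_add_left, map_add]
      exact Submodule.add_mem _ ha hb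
  · rw [map_add]
    exact Submodule.add_mem _ hs ht

/-- Derivations commute with restriction if they do so on generators. -/
theorem resV_comm_of_leibniz {𝓔 : GradedManifold.{u, v} n M} {ι : BaseInvolution 𝓔}
    {U W : Opens M} (h : W ≤ U) (D : FunV ι U →+ FunV ι U) (D' : FunV ι W →+ FunV ι W)
    (hD : ∀ (m : ℕ) (s t : FunV ι U), s ∈ degV ι U m →
      D (s * t) = D s * t + (-1 : ℤˣ) ^ m • (s * D t))
    (hD' : ∀ (m : ℕ) (s t : FunV ι W), s ∈ degV ι W m →
      D' (s * t) = D' s * t + (-1 : ℤˣ) ^ m • (s * D' t))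
    (hcoeff : ∀ a : 𝓔.O U, resV ι h (D (pullV a)) = D' (resV ι h (pullV a)))
    (hvar : ∀ ξ : PlusDual ι U, resV ι h (D (linV 1 ξ)) = D' (resV ι h (linV 1 ξ)))
    (t : FunV ι U) : resV ι h (D t) = D' (resV ι h t) := by
  exact OddPoly.map_comm_of_leibniz (𝒜 := 𝓔.deg U) (P := PlusDual ι U) (resV ι h) D D' hD
    (fun m s t hs => hD' m _ _ (resV_mem_degV h hs)) hcoeff hvar t

variable {𝓔 : NQSymplecticManifold.{u, v} n M} {ι : GeneralizedMetric 𝓔}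

/-- The action of the vector field of the NQ symplectic manifold. -/
def homQ (W : Opens M) : 𝓔.O W →+ 𝓔.O W :=
  AddMonoidHom.mk' (app 𝓔.Q (le_top : W ≤ ⊤)) (app_add 𝓔.Q le_top)

namespace CourantConnection

variable [IsManifold (𝓡 n) ∞ M] [T2Space M]

variable (C : CourantConnection ι)

/-- The bilinear form `⟨e, Q⟨u, ξ⟩⟩ - ⟨∇ₑ u, ξ⟩`. -/
def dualBilin {U : Opens M} (ξ : PlusDual ι.toBaseInvolution U) :
    SecE 𝓔.toGradedManifold U →ₗ[SmoothFn n U]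
      SecPlus ι.toBaseInvolution U →ₗ[SmoothFn n U] SmoothFn n U :=
  LinearMap.mk₂ (SmoothFn n U)
    (fun e u => pair e le_rfl (dFn 𝓔 U (pairPlus u le_rfl ξ))
      - pairPlus (C.localNabla e u) le_rfl ξ)
    (fun e e' u => by
      rw [localNabla_add_left, pairPlus_add, pair_add, LinearMap.add_apply]
      ring)
    (fun c e u => by
      rw [localNabla_smul_left, pairPlus_smul, pair_smul, LinearMap.smul_apply, smul_eq_mul,
        smul_eq_mul, resFn_le_rfl]
      ring)
    (fun e u u' => by
      rw [localNabla_add_right, pairPlus_add, pairPlus_add, dFn_add, map_add]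
      ring)
    -- Both terms contribute `⟨e, dFn c⟩ ⟨u, ξ⟩`, one by the product rule and one by the Leibniz
    -- rule of `∇`; these cancel.
    fun c e u => by
      rw [localNabla_leibniz, pairPlus_add, pairPlus_smul, pairPlus_smul, pairPlus_smul,
        resFn_le_rfl, resFn_le_rfl, dFn_mul, map_add, map_smul, map_smul, smul_eq_mul, smul_eq_mul,
        smul_eq_mul]
      ring

theorem dualBilin_apply {U : Opens M} (ξ : PlusDual ι.toBaseInvolution U)
    (e : SecE 𝓔.toGradedManifold U) (u : SecPlus ι.toBaseInvolution U) :
    C.dualBilin ξ e u = pair e le_rfl (dFn 𝓔 U (pairPlus u le_rfl ξ))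
      - pairPlus (C.localNabla e u) le_rfl ξ := rfl

theorem resFn_dualBilin {U W : Opens M} (h : W ≤ U) (ξ : PlusDual ι.toBaseInvolution U)
    (e : SecE 𝓔.toGradedManifold U) (u : SecPlus ι.toBaseInvolution U) :
    resFn n h (C.dualBilin ξ e u)
      = C.dualBilin (PlusDual.res h ξ) (SecE.res h e) (SecPlus.res h u) := by
  rw [dualBilin_apply, dualBilin_apply, map_sub, resFn_pair, resFn_pairPlus, resDeg_dFn,
    resFn_pairPlus, pairPlus_localNabla_res]
  rfl

variable (U : {U : Opens M // IsCoordDomain 𝓔.toGradedPresheaf U})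

/-- The derivative of a fibre coordinate for the connection dual to `∇`. -/
def dualVar (ξ : PlusDual ι.toBaseInvolution U.1) : FunV ι.toBaseInvolution U.1 :=
  (U.2.exists_linFunV (C.dualBilin ξ)).choose

theorem dualVar_mem_linFunV (ξ : PlusDual ι.toBaseInvolution U.1) :
    C.dualVar U ξ ∈ LinFunV ι.toBaseInvolution U.1 :=
  (U.2.exists_linFunV (C.dualBilin ξ)).choose_spec.1

theorem dualVar_mem_degV (ξ : PlusDual ι.toBaseInvolution U.1) :
    C.dualVar U ξ ∈ degV ι.toBaseInvolution U.1 2 :=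
  (U.2.exists_linFunV (C.dualBilin ξ)).choose_spec.2.1

theorem pair_contract_dualVar (ξ : PlusDual ι.toBaseInvolution U.1)
    (e : SecE 𝓔.toGradedManifold U.1) (u : SecPlus ι.toBaseInvolution U.1) :
    pair e le_rfl (proj₁ 𝓔.toGradedManifold U.1 (contract u (C.dualVar U ξ)))
      = C.dualBilin ξ e u :=
  (U.2.exists_linFunV (C.dualBilin ξ)).choose_spec.2.2 e u

/-- `dualVar` is only a chosen element. Its rules follow by comparing contractions, since
`linFunV_ext` makes the choice unique. -/
theorem dualVar_add (ξ η : PlusDual ι.toBaseInvolution U.1) :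
    C.dualVar U (ξ + η) = C.dualVar U ξ + C.dualVar U η := by
  refine U.2.linFunV_ext le_rfl (C.dualVar_mem_linFunV U _)
    (Submodule.add_mem _ (C.dualVar_mem_linFunV U _) (C.dualVar_mem_linFunV U _))
    (C.dualVar_mem_degV U _)
    (Submodule.add_mem _ (C.dualVar_mem_degV U _) (C.dualVar_mem_degV U _)) fun i j => ?_
  rw [proj₁_contract_add_right, map_add, pair_contract_dualVar, pair_contract_dualVar,
    pair_contract_dualVar, dualBilin_apply, dualBilin_apply, dualBilin_apply, map_add, map_add,
    dFn_add, map_add]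
  ring

/-- This is the compatibility with scalars demanded by `OddPoly.exists_derivation`. -/
theorem dualVar_smul (c : SmoothFn n U.1) (ξ : PlusDual ι.toBaseInvolution U.1) :
    C.dualVar U (c • ξ) = linV (dFn 𝓔 U.1 c : 𝓔.O U.1) ξ + c • C.dualVar U ξ := by
  have hd : (linV (dFn 𝓔 U.1 c : 𝓔.O U.1) ξ : FunV ι.toBaseInvolution U.1)
      ∈ degV ι.toBaseInvolution U.1 2 := linV_mem_degV (dFn 𝓔 U.1 c).2 ξ
  refine U.2.linFunV_ext le_rfl (C.dualVar_mem_linFunV U _)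
    (Submodule.add_mem _ (linV_mem _ _) (Submodule.smul_mem _ _ (C.dualVar_mem_linFunV U _)))
    (C.dualVar_mem_degV U _)
    (Submodule.add_mem _ hd (Submodule.smul_mem _ _ (C.dualVar_mem_degV U _))) fun i j => ?_
  have h1 : ∀ u : SecPlus ι.toBaseInvolution U.1, proj₁ 𝓔.toGradedManifold U.1
      (contract u (linV (dFn 𝓔 U.1 c : 𝓔.O U.1) ξ)) = pairPlus u le_rfl ξ • dFn 𝓔 U.1 c := by
    intro u
    rw [contract_linV, (proj₁ 𝓔.toGradedManifold U.1).map_smul, proj₁_eq (dFn 𝓔 U.1 c).2]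
  rw [proj₁_contract_add_right, proj₁_contract_smul_right, h1, map_add, map_smul, map_smul,
    pair_contract_dualVar, pair_contract_dualVar, dualBilin_apply, dualBilin_apply, map_smul,
    map_smul, smul_eq_mul, dFn_mul, map_add, map_smul, map_smul, smul_eq_mul, smul_eq_mul,
    smul_eq_mul, smul_eq_mul]
  ring

theorem resV_dualVar (W : {U : Opens M // IsCoordDomain 𝓔.toGradedPresheaf U}) (h : W.1 ≤ U.1)
    (ξ : PlusDual ι.toBaseInvolution U.1) :
    resV ι.toBaseInvolution h (C.dualVar U ξ) = C.dualVar W (PlusDual.res h ξ) := by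
  refine U.2.linFunV_ext h (resV_mem_linFunV h (C.dualVar_mem_linFunV U _))
    (C.dualVar_mem_linFunV W _) (resV_mem_degV h (C.dualVar_mem_degV U _))
    (C.dualVar_mem_degV W _) fun i j => ?_
  rw [← res_contract h _ (C.dualVar_mem_linFunV U _),
    ← resDeg_proj₁ h (contract_mem (m := 1) _ (C.dualVar_mem_degV U _)),
    ← resFn_pair _ le_rfl, pair_contract_dualVar, resFn_dualBilin, ← pair_contract_dualVar]
  rfl

theorem exists_dualDer : ∃ D : FunV ι.toBaseInvolution U.1 →+ FunV ι.toBaseInvolution U.1,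
    (∀ a : 𝓔.O U.1, D (pullV a) = pullV (app 𝓔.Q le_top a)) ∧
    (∀ ξ, D (linV 1 ξ) = C.dualVar U ξ) ∧
    (∀ (m : ℕ) (t : FunV ι.toBaseInvolution U.1), t ∈ degV ι.toBaseInvolution U.1 m →
      D t ∈ degV ι.toBaseInvolution U.1 (m + 1)) ∧
    ∀ (m : ℕ) (s t : FunV ι.toBaseInvolution U.1), s ∈ degV ι.toBaseInvolution U.1 m →
      D (s * t) = D s * t + (-1 : ℤˣ) ^ m • (s * D t) := by
  refine OddPoly.exists_derivation (𝒜 := 𝓔.deg U.1) (P := PlusDual ι.toBaseInvolution U.1)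
    (graded_comm_pow (𝓔 := 𝓔.toGradedManifold) U.1) (homQ U.1) (fun i a ha => app_Q_mem ha)
    (fun i a b ha => ?_) (AddMonoidHom.mk' (C.dualVar U) (C.dualVar_add U))
    (C.dualVar_mem_degV U) fun c ξ => ?_
  · have := app_mul 𝓔.Q (le_top : U.1 ≤ ⊤) ha b
    rw [one_mul, Int.negOnePow_def, zpow_natCast] at this
    exact this
  · exact (C.dualVar_smul U c ξ).trans (by rw [coe_dFn]; rfl)

theorem exists_isDual : ∃ Q : Connection ι, IsDual Q C := by
  choose D hD₁ hD₂ hD₃ hD₄ using C.exists_dualDer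
  have hlin : ∀ (U : {U : Opens M // IsCoordDomain 𝓔.toGradedPresheaf U})
      (t : FunV ι.toBaseInvolution U.1), t ∈ LinFunV ι.toBaseInvolution U.1 →
      D U t ∈ LinFunV ι.toBaseInvolution U.1 := by
    intro U t ht
    refine LinFunV.map_mem_of_leibniz (D U) (hD₄ U) (fun a => ⟨_, hD₁ U a⟩) (fun ξ => ?_) ht
    rw [hD₂]
    exact C.dualVar_mem_linFunV U ξ
  have hres : ∀ (U W : {U : Opens M // IsCoordDomain 𝓔.toGradedPresheaf U}) (h : W.1 ≤ U.1)
      (t : FunV ι.toBaseInvolution U.1),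
      resV ι.toBaseInvolution h (D U t) = D W (resV ι.toBaseInvolution h t) := by
    intro U W h t
    refine resV_comm_of_leibniz h (D U) (D W) (hD₄ U) (hD₄ W) (fun a => ?_) (fun ξ => ?_) t
    · rw [hD₁, resV_pullV, resV_pullV, hD₁, res_app]
    · rw [hD₂, resV_linV, map_one, hD₂, C.resV_dualVar U W h]
  refine ⟨⟨D, hres, hD₃, hD₄, hD₁, hlin⟩, fun e u U ξ => ?_⟩
  change pair e le_top (dFn 𝓔 U.1 (pairPlus u le_top ξ)) = _ + pair e le_top
    (proj₁ 𝓔.toGradedManifold U.1 (contract (SecPlus.res le_top u) (D U (linV 1 ξ))))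
  rw [hD₂]
  -- The global sections `e` and `u` extend their own restrictions, so `localNabla` of the
  -- restrictions pairs as `nabla e u`.
  have h := C.pair_contract_dualVar U ξ (SecE.res le_top e) (SecPlus.res le_top u)
  have h' : pairPlus (C.localNabla (U := U.1) (SecE.res le_top e) (SecPlus.res le_top u)) le_rfl ξ
      = pairPlus (C.nabla e u) le_top ξ :=
    C.pairPlus_localNabla (U := U.1) (e := SecE.res le_top e) (u := SecPlus.res le_top u) (e' := e) (u' := u)
      le_rfl (fun _ _ _ _ _ => rfl) (fun _ _ _ _ _ => rfl) ξ
  rw [dualBilin_apply, h'] at h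
  exact (sub_eq_iff_eq_add.1 h.symm).trans (add_comm _ _)

end CourantConnection

end InverseConstruction

/-! ### Injectivity of the correspondence, and the difference of two connections. -/

section Uniqueness

variable {n : ℕ} {M : Type v} [TopologicalSpace M]
  [ChartedSpace (EuclideanSpace ℝ (Fin n)) M] {𝓔 : NQSymplecticManifold.{u, v} n M}
  {ι : GeneralizedMetric 𝓔}

namespace Connection

variable (Q Q' : Connection ι) (U : {U : Opens M // IsCoordDomain 𝓔.toGradedPresheaf U})

theorem resFn_dualForm_eq {W : Opens M} (h : W ≤ U.1) {e : SecE 𝓔.toGradedManifold U.1}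
    {u : SecPlus ι.toBaseInvolution U.1} {e' : SecE 𝓔.toGradedManifold ⊤}
    {u' : SecPlus ι.toBaseInvolution ⊤} (he : AgreeOn W e' e) (hu : AgreeOn W u'.1 u.1)
    (ξ : PlusDual ι.toBaseInvolution U.1) :
    resFn n h (Q.dualForm U le_rfl e u ξ)
      = pairPlus (Q.toCourant.nabla e' u') le_top (PlusDual.res h ξ) := by
  have hres : SecPlus.res h u = SecPlus.res (le_top : W ≤ ⊤) u' := by
    refine Subtype.ext (SecE.ext fun V hV f => ?_)
    exact (hu V hV le_top (hV.trans h) f).symm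
  rw [Q.resFn_dualForm U ⟨W, U.2.mono h⟩ le_rfl h, Q.pairPlus_toCourant ⟨W, U.2.mono h⟩,
    dualForm_apply, dualForm_apply, hres, he W le_rfl le_top h, he W le_rfl le_top h,
    hu.pairPlus le_rfl le_top h]

/-- The hypothesis asks for agreement only on some global extensions near each point. It thus serves
both for arbitrary `e`, in the injectivity of `toCourant`, and for `e` in `V₊`. -/
theorem pair_contract_eq {e : SecE 𝓔.toGradedManifold U.1} {u : SecPlus ι.toBaseInvolution U.1}
    (h : ∀ x ∈ U.1, ∃ (W : Opens M) (_ : W ≤ U.1) (e' : SecE 𝓔.toGradedManifold ⊤)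
      (u' : SecPlus ι.toBaseInvolution ⊤), x ∈ W ∧ AgreeOn W e' e ∧ AgreeOn W u'.1 u.1 ∧
      Q.toCourant.nabla e' u' = Q'.toCourant.nabla e' u')
    (ξ : PlusDual ι.toBaseInvolution U.1) :
    pair e le_rfl (proj₁ 𝓔.toGradedManifold U.1 (contract u (Q.D U (linV 1 ξ))))
      = pair e le_rfl (proj₁ 𝓔.toGradedManifold U.1 (contract u (Q'.D U (linV 1 ξ)))) := by
  have key : Q.dualForm U le_rfl e u ξ = Q'.dualForm U le_rfl e u ξ := by
    refine SmoothFn.ext_local fun x hx => ?_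
    obtain ⟨W, hW, e', u', hxW, he, hu, hQ⟩ := h x hx
    refine ⟨W, hW, hxW, ?_⟩
    rw [Q.resFn_dualForm_eq U hW he hu, Q'.resFn_dualForm_eq U hW he hu, hQ]
  rw [dualForm_apply, dualForm_apply] at key
  exact sub_right_injective key

theorem toCourant_injective [IsManifold (𝓡 n) ∞ M] [T2Space M] :
    Function.Injective (toCourant : Connection ι → CourantConnection ι) := by
  intro Q Q' hQ
  refine ext_linV fun U ξ => ?_
  refine U.2.linFunV_ext le_rfl (Q.D_linV_one_mem U ξ) (Q'.D_linV_one_mem U ξ)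
    (Q.D_linV_one_mem_degV U ξ) (Q'.D_linV_one_mem_degV U ξ) fun i j => ?_
  refine pair_contract_eq Q Q' U (fun x hx => ?_) ξ
  obtain ⟨e', W₁, hx₁, hW₁, he⟩ := (U.2.e i).exists_extension hx
  obtain ⟨u', W₂, hx₂, -, hu⟩ := (U.2.ePlus ι.toBaseInvolution j).exists_extension hx
  exact ⟨W₁ ⊓ W₂, inf_le_left.trans hW₁, e', u', ⟨hx₁, hx₂⟩, he.mono inf_le_left,
    hu.mono inf_le_right, by rw [hQ]⟩

/-- The difference of two connections on the fibre coordinates. -/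
def diff : PlusDual ι.toBaseInvolution U.1 →ₗ[SmoothFn n U.1] FunV ι.toBaseInvolution U.1 where
  toFun ξ := Q.D U (linV 1 ξ) - Q'.D U (linV 1 ξ)
  map_add' ξ η := by
    rw [linV_add_right, map_add, map_add, add_sub_add_comm]
  -- The term differentiating `c` involves only `Q_𝓔` and cancels: the difference is tensorial.
  map_smul' c ξ := by
    rw [D_linV_one_smul, D_linV_one_smul, add_sub_add_left_eq_sub, RingHom.id_apply, smul_sub]

/-- The contraction of the difference of two connections with a section of `V₊`. -/
def contractDiff (u : SecPlus ι.toBaseInvolution U.1) :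
    PlusDual ι.toBaseInvolution U.1 →ₗ[SmoothFn n U.1] 𝓔.O U.1 :=
  (contract u).comp (Q.diff Q' U)

theorem contractDiff_apply (u : SecPlus ι.toBaseInvolution U.1)
    (ξ : PlusDual ι.toBaseInvolution U.1) :
    Q.contractDiff Q' U u ξ = contract u (Q.D U (linV 1 ξ)) - contract u (Q'.D U (linV 1 ξ)) :=
  (contract u).map_sub _ _

theorem contractDiff_mem (u : SecPlus ι.toBaseInvolution U.1)
    (ξ : PlusDual ι.toBaseInvolution U.1) : Q.contractDiff Q' U u ξ ∈ 𝓔.deg U.1 1 := by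
  rw [contractDiff_apply]
  exact Submodule.sub_mem _ (Q.contract_D_mem U u ξ) (Q'.contract_D_mem U u ξ)

/-- The first term depends only on `Q_𝓔` and drops out of differences; the minus sign comes from
passing the odd function `a`. -/
theorem contract_D_linV {a : 𝓔.O U.1} (ha : a ∈ 𝓔.deg U.1 1)
    (ξ : PlusDual ι.toBaseInvolution U.1) (u : SecPlus ι.toBaseInvolution U.1) :
    contract u (Q.D U (linV a ξ)) = pairPlus u le_rfl ξ • app 𝓔.Q le_top a
      - a * contract u (Q.D U (linV 1 ξ)) := by
  have h := congrArg (contract u) (Q.D_linV U ha ξ)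
  rw [pow_one, Units.neg_smul, one_smul, ← sub_eq_add_neg, (contract u).map_sub, contract_linV,
    contract_pullV_mul] at h
  exact h

/-- The contraction of the difference of the torsions. -/
theorem contract_torsion_sub {I : Type*} (s : Finset I) (a : I → 𝓔.O U.1)
    (ha : ∀ i, a i ∈ 𝓔.deg U.1 1) (η : I → PlusDual ι.toBaseInvolution U.1)
    (u : SecPlus ι.toBaseInvolution U.1) :
    contract u (Q'.D U (∑ i ∈ s, linV (a i) (η i))) - contract u (Q.D U (∑ i ∈ s, linV (a i) (η i)))
      = ∑ i ∈ s, a i * Q.contractDiff Q' U u (η i) := by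
  rw [map_sum (Q.D U), map_sum (Q'.D U), map_sum (contract u), map_sum (contract u), ← Finset.sum_sub_distrib]
  refine Finset.sum_congr rfl fun i _ => ?_
  rw [contract_D_linV Q U (ha i), contract_D_linV Q' U (ha i), contractDiff_apply, mul_sub]
  abel

end Connection

/-! ### The tautological section and Hamiltonian vector fields. -/

section Involution

theorem IsCoordDomain.inv_of_mem_deg_zero {𝓔 : GradedManifold.{u, v} n M} {ι : BaseInvolution 𝓔}
    {U : Opens M} (hU : IsCoordDomain 𝓔.toGradedPresheaf U) {a : 𝓔.O U} (ha : a ∈ 𝓔.deg U 0) :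
    ι.inv U a = a := by
  have h := hU.algebraMap_body ⟨a, ha⟩
  rw [← show algebraMap _ (𝓔.O U) (hU.body ⟨a, ha⟩) = a from h, AlgHom.commutes]

theorem app_conj {𝓔 : GradedManifold.{u, v} n M} (ι : BaseInvolution 𝓔) {U W : Opens M} {k : ℤ}
    (X : Der 𝓔 U k) (h : W ≤ U) (a : 𝓔.O W) :
    app (ι.conj X) h a = ι.inv W (app X h (ι.inv W a)) := rfl

theorem conj_conj {𝓔 : GradedManifold.{u, v} n M} (ι : BaseInvolution 𝓔) {U : Opens M} {k : ℤ}
    (X : Der 𝓔 U k) : ι.conj (ι.conj X) = X :=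
  Der.ext fun W h a => by rw [app_conj, app_conj, ι.inv_inv, ι.inv_inv]

/-- A vector field of degree `-1` which is invariant on functions of degree 1 only sees their
invariant part. -/
theorem app_plusDual {𝓔 : GradedManifold.{u, v} n M} {ι : BaseInvolution 𝓔} {U : Opens M}
    {X : Der 𝓔 U (-1)} (hX : ∀ f ∈ 𝓔.deg U 1, app X le_rfl (ι.inv U f) = app X le_rfl f)
    (g : 𝓔.deg U 1) : app X le_rfl (plusDual ι U g : 𝓔.O U) = app X le_rfl (g : 𝓔.O U) := by
  rw [coe_plusDual, app_smul_of_neg X le_rfl (by norm_num), app_add, hX g g.2,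
    half_smul_add_self]

variable {U : Opens M} (hU : IsCoordDomain 𝓔.toGradedPresheaf U)

include hU

theorem IsCoordDomain.form_congr_left {X X' : Der 𝓔.toGradedManifold U (-1)}
    (h : ∀ f ∈ 𝓔.deg U 1, app X le_rfl f = app X' le_rfl f) (Y : Der 𝓔.toGradedManifold U (-1)) :
    𝓔.symp.form U (-1) (-1) X Y = 𝓔.symp.form U (-1) (-1) X' Y := by
  rw [hU.frame.form_expand, hU.frame.form_expand 𝓔.symp X']
  exact Finset.sum_congr rfl fun i _ => by rw [h _ (hU.frame.mem i)]

omit hU in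
-- Graded skew-symmetry becomes symmetry on fields of odd degree: on sections of `E` the form is the
-- usual Courant pairing.
theorem form_comm (X Y : Der 𝓔.toGradedManifold U (-1)) :
    𝓔.symp.form U (-1) (-1) X Y = 𝓔.symp.form U (-1) (-1) Y X := by
  rw [𝓔.symp.skew, show ((-1 : ℤ) * -1).negOnePow = -1 from Int.negOnePow_odd _ (by decide),
    Units.neg_smul, one_smul, neg_neg]

omit hU in
theorem form_mem_deg_zero (X Y : Der 𝓔.toGradedManifold U (-1)) :
    𝓔.symp.form U (-1) (-1) X Y ∈ 𝓔.deg U 0 :=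
  𝓔.symp.degree U (-1) (-1) X Y

/-- `X` and its conjugate act alike on functions of degree 1, which is all the form sees; `ι`
preserves the form and fixes its values, of degree 0. -/
theorem IsCoordDomain.form_conj {X : Der 𝓔.toGradedManifold U (-1)}
    (hX : ∀ f ∈ 𝓔.deg U 1, app X le_rfl (ι.inv U f) = app X le_rfl f)
    (Y : Der 𝓔.toGradedManifold U (-1)) :
    𝓔.symp.form U (-1) (-1) X (ι.conj Y) = 𝓔.symp.form U (-1) (-1) X Y := by
  rw [hU.form_congr_left (X := X) (X' := ι.conj X) (fun f hf => by
    rw [app_conj, hU.inv_of_mem_deg_zero (app_mem_deg_zero X le_rfl (ι.inv_mem_deg U 1 f hf)),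
      hX f hf]), ι.symplectic, hU.inv_of_mem_deg_zero (form_mem_deg_zero X Y)]

/-- The function of degree 1 with differential `ω(∂ᵢ, ·)`. -/
def IsCoordDomain.momentum (i : hU.frame.I) : 𝓔.deg U 1 :=
  ∑ j, hU.body ⟨𝓔.symp.form U (-1) (-1) (hU.frame.der j) (hU.frame.der i),
    form_mem_deg_zero _ _⟩ • hU.y j

theorem IsCoordDomain.app_momentum (i : hU.frame.I) (Y : Der 𝓔.toGradedManifold U (-1)) :
    app Y le_rfl (hU.momentum i : 𝓔.O U) = 𝓔.symp.form U (-1) (-1) (hU.frame.der i) Y := by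
  rw [form_comm, hU.frame.form_expand, momentum, AddSubmonoidClass.coe_finsetSum, app_sum]
  refine Finset.sum_congr rfl fun j _ => ?_
  rw [Submodule.coe_smul, app_smul_of_neg Y le_rfl (by norm_num), Algebra.smul_def,
    Algebra.commutes]
  exact congrArg (app Y le_rfl (hU.frame.y j) * ·) (hU.algebraMap_body _)

/-- Torsion invariance is a condition on tautological sections, so one must be exhibited. The
momenta are replaced by their invariant parts because the uniqueness argument needs invariant
coefficients. -/
theorem IsCoordDomain.isTautological : IsTautological ι U
    (∑ i, linV (plusDual ι.toBaseInvolution U (hU.momentum i) : 𝓔.O U)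
      (hU.yPlus ι.toBaseInvolution i)) := by
  refine ⟨Submodule.sum_mem _ fun j _ => linV_mem _ _, Submodule.sum_mem _ fun j _ =>
    linV_mem_degV (plusDual_le _ U (Subtype.prop _)) _, fun v X hX Y => ?_⟩
  have hpair : ∀ i, pairPlus v le_rfl (hU.yPlus ι.toBaseInvolution i)
      = pair v.1 le_rfl (hU.y i) := fun i => (pair_eq_pairPlus v le_rfl (hU.y i)).symm
  let G : 𝓔.deg U 1 := ∑ i, pair v.1 le_rfl (hU.y i) • hU.momentum i
  have hG : contract v (∑ i, linV (plusDual ι.toBaseInvolution U (hU.momentum i) : 𝓔.O U)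
      (hU.yPlus ι.toBaseInvolution i)) = (plusDual ι.toBaseInvolution U G : 𝓔.O U) := by
    rw [map_sum, map_sum, AddSubmonoidClass.coe_finsetSum]
    refine Finset.sum_congr rfl fun i _ => ?_
    rw [contract_linV, hpair, map_smul, Submodule.coe_smul]
  have hXinv : ∀ f ∈ 𝓔.deg U 1, app X le_rfl (ι.inv U f) = app X le_rfl f := by
    intro f hf
    have h1 := hX U le_rfl ⟨f, hf⟩
    have h2 := hX U le_rfl ⟨ι.inv U f, ι.inv_mem_deg U 1 f hf⟩
    rw [v.2 U le_rfl ⟨f, hf⟩] at h2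
    exact h2.trans h1.symm
  have hYG : ∀ Y : Der 𝓔.toGradedManifold U (-1),
      app Y le_rfl (G : 𝓔.O U) = 𝓔.symp.form U (-1) (-1) X Y := by
    intro Y
    rw [AddSubmonoidClass.coe_finsetSum, app_sum, hU.frame.form_expand]
    refine Finset.sum_congr rfl fun i _ => ?_
    rw [Submodule.coe_smul, app_smul_of_neg Y le_rfl (by norm_num), hU.app_momentum,
      Algebra.smul_def, ← hX U le_rfl (hU.y i)]
    rfl
  -- `G` represents `ω(X, ·)` with `X` tangent to `V₊`, so `G` and its image under `ι` have the same
  -- derivatives, and passing to the invariant part is harmless.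
  have hιG : app Y le_rfl (ι.inv U G) = app Y le_rfl (G : 𝓔.O U) := by
    rw [hYG, ← hU.form_conj hXinv, ← hYG, app_conj, hU.inv_of_mem_deg_zero
      (app_mem_deg_zero Y le_rfl (ι.inv_mem_deg U 1 _ G.2))]
  rw [hG, coe_plusDual, app_smul_of_neg Y le_rfl (by norm_num), app_add, hιG, hYG,
    half_smul_add_self]

omit hU in
/-- The Hamiltonian vector field of an invariant function of degree 1. -/
theorem exists_hamiltonian (f : PlusDual ι.toBaseInvolution U) :
    ∃ X : Der 𝓔.toGradedManifold U (-1), (∀ Y : Der 𝓔.toGradedManifold U (-1),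
      𝓔.symp.form U (-1) (-1) Y X = app Y le_rfl (f : 𝓔.O U)) ∧ ι.conj X = X := by
  obtain ⟨X, hX, huniq⟩ := 𝓔.symp.nondegenerate U (-1)
    (fun l => AddMonoidHom.mk' (fun Y : Der 𝓔.toGradedManifold U l => app Y le_rfl (f : 𝓔.O U))
      fun _ _ => rfl)
    (fun l Y => by
      have := app_mem Y le_rfl f.2.1
      rwa [show ((1 : ℕ) : ℤ) + l = l + -1 + 2 by push_cast; ring] at this)
    (fun i g hg l Y => by
      change app (smulDer g hg Y) le_rfl (f : 𝓔.O U) = g * app Y le_rfl (f : 𝓔.O U)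
      rw [app_smulDer, 𝓔.res_self])
  -- Invariance of `X` follows from uniqueness: its conjugate represents the same 1-form, as `ι`
  -- preserves `ω` and `f`.
  refine ⟨X, hX (-1), huniq _ fun l Y => ?_⟩
  have h1 := ι.symplectic U l (-1) (ι.conj Y) X
  rw [conj_conj] at h1
  refine h1.trans ?_
  rw [hX l]
  change ι.inv U (app (ι.conj Y) le_rfl (f : 𝓔.O U)) = app Y le_rfl (f : 𝓔.O U)
  rw [app_conj, ι.inv_inv, f.2.2]

end Involution

/-! ### Uniqueness of a connection with invariant torsion. -/

namespace Connection

variable {Q Q' : Connection ι} (hQ : HasInvariantTorsion Q) (hQ' : HasInvariantTorsion Q')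
  (U : {U : Opens M // IsCoordDomain 𝓔.toGradedPresheaf U})

/-- Pairing to zero with all of `V₊` means that the invariant part vanishes, so the function is
anti-invariant. -/
theorem inv_contractDiff (hpair : ∀ (e u : SecPlus ι.toBaseInvolution U.1)
      (ξ : PlusDual ι.toBaseInvolution U.1), pair e.1 le_rfl ⟨_, Q.contractDiff_mem Q' U u ξ⟩ = 0)
    (u : SecPlus ι.toBaseInvolution U.1) (ξ : PlusDual ι.toBaseInvolution U.1) :
    ι.inv U.1 (Q.contractDiff Q' U u ξ) = -Q.contractDiff Q' U u ξ := by
  have h : plusDual ι.toBaseInvolution U.1 ⟨_, Q.contractDiff_mem Q' U u ξ⟩ = 0 := by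
    rw [U.2.plusDual_expand le_rfl (plusDual ι.toBaseInvolution U.1 _)]
    refine Finset.sum_eq_zero fun i _ => ?_
    rw [← pair_eq_pairPlus, hpair, zero_smul]
  have h' := congrArg Subtype.val h
  rw [coe_plusDual] at h'
  have h2 := half_smul_add_self (n := n) (U := U.1)
    (Q.contractDiff Q' U u ξ + ι.inv U.1 (Q.contractDiff Q' U u ξ))
  rw [smul_add] at h2
  change half n U.1 • (Q.contractDiff Q' U u ξ + ι.inv U.1 (Q.contractDiff Q' U u ξ)) = 0 at h'
  rw [h', add_zero] at h2
  exact (neg_eq_of_add_eq_zero_right h2.symm).symm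

include hQ hQ' in
theorem contractDiff_eq_zero (hpair : ∀ (e u : SecPlus ι.toBaseInvolution U.1)
      (ξ : PlusDual ι.toBaseInvolution U.1), pair e.1 le_rfl ⟨_, Q.contractDiff_mem Q' U u ξ⟩ = 0)
    (u : SecPlus ι.toBaseInvolution U.1) (f : PlusDual ι.toBaseInvolution U.1) :
    Q.contractDiff Q' U u f = 0 := by
  have hanti := inv_contractDiff U hpair u
  let g : U.2.frame.I → PlusDual ι.toBaseInvolution U.1 := fun i =>
    plusDual ι.toBaseInvolution U.1 (U.2.momentum i)
  have hτ := U.2.isTautological (ι := ι)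
  have hT := contract_torsion_sub Q Q' U Finset.univ (fun i => (g i : 𝓔.O U.1))
    (fun i => (g i).2.1) (U.2.yPlus ι.toBaseInvolution) u
  -- The sum is a difference of contracted torsions, hence invariant; each summand is a product of
  -- an invariant and an anti-invariant factor, hence anti-invariant.
  have hT0 : ∑ i, (g i : 𝓔.O U.1) * Q.contractDiff Q' U u (U.2.yPlus ι.toBaseInvolution i) = 0 := by
    refine eq_zero_of_eq_neg (n := n) (U := U.1) ?_
    have h1 : ι.inv U.1
        (∑ i, (g i : 𝓔.O U.1) * Q.contractDiff Q' U u (U.2.yPlus ι.toBaseInvolution i))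
        = ∑ i, (g i : 𝓔.O U.1) * Q.contractDiff Q' U u (U.2.yPlus ι.toBaseInvolution i) := by
      rw [← hT, map_sub, ← contract_invV, ← contract_invV, hQ U _ hτ, hQ' U _ hτ]
    refine h1.symm.trans ?_
    rw [map_sum, ← Finset.sum_neg_distrib]
    refine Finset.sum_congr rfl fun i _ => ?_
    rw [map_mul, (g i).2.2, hanti, mul_neg]
  obtain ⟨X, hX, hconj⟩ := exists_hamiltonian f
  have hXinv : ∀ a ∈ 𝓔.deg U.1 1, app X le_rfl (ι.inv U.1 a) = app X le_rfl a := by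
    intro a ha
    nth_rewrite 2 [← hconj]
    rw [app_conj, U.2.inv_of_mem_deg_zero (app_mem_deg_zero X le_rfl (ι.inv_mem_deg _ 1 a ha))]
  -- An invariant field of degree `-1` takes the same value on an anti-invariant function of degree
  -- 1 and on its negative.
  have hX0 : ∀ ξ, app X le_rfl (Q.contractDiff Q' U u ξ) = 0 := by
    intro ξ
    refine eq_zero_of_eq_neg (n := n) (U := U.1) ?_
    nth_rewrite 1 [← hXinv _ (Q.contractDiff_mem Q' U u ξ)]
    rw [hanti]
    exact map_neg (X.1 ⟨U.1, le_rfl⟩) _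
  have hfin := congrArg (app X le_rfl) hT0
  rw [app_sum, app_zero] at hfin
  rw [U.2.plusDual_expand le_rfl f, map_sum, ← hfin]
  -- The coefficient `X(gᵢ) = ω(∂ᵢ, X) = ∂ᵢ f` is the one in the expansion of `f` along `yPlus`, so
  -- the sum is the difference evaluated at `f`.
  refine Finset.sum_congr rfl fun i _ => ?_
  rw [app_mul X le_rfl (g i).2.1, hX0, mul_zero, smul_zero, add_zero, app_plusDual hXinv,
    U.2.app_momentum, hX, map_smul, Algebra.smul_def, IsCoordDomain.ePlus, pairPlus_plus]
  congr 1
  · exact U.2.algebraMap_pair_secOfDer _ _ _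
  · congr 1
    exact Subtype.ext (𝓔.res_self U.1 _)

include hQ hQ' in
theorem eq_of_hasInvariantTorsion [IsManifold (𝓡 n) ∞ M] [T2Space M]
    (h : ∀ e u : SecPlus ι.toBaseInvolution ⊤,
      Q.toCourant.nabla e.1 u = Q'.toCourant.nabla e.1 u) : Q = Q' := by
  refine ext_linV fun U ξ => ?_
  have hpair : ∀ (e u : SecPlus ι.toBaseInvolution U.1) (ξ : PlusDual ι.toBaseInvolution U.1),
      pair e.1 le_rfl ⟨_, Q.contractDiff_mem Q' U u ξ⟩ = 0 := by
    intro e u ξ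
    have key := pair_contract_eq Q Q' U (e := e.1) (u := u) (fun x hx => by
      obtain ⟨e', W₁, hx₁, hW₁, he⟩ := e.exists_extension hx
      obtain ⟨u', W₂, hx₂, -, hu⟩ := u.exists_extension hx
      exact ⟨W₁ ⊓ W₂, inf_le_left.trans hW₁, e'.1, u', ⟨hx₁, hx₂⟩, he.mono inf_le_left,
        hu.mono inf_le_right, h e' u'⟩) ξ
    rw [proj₁_eq (Q.contract_D_mem U u ξ), proj₁_eq (Q'.contract_D_mem U u ξ), ← sub_eq_zero,
      ← map_sub] at key
    rw [← key]
    congr 1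
    exact Subtype.ext (contractDiff_apply Q Q' U u ξ)
  refine U.2.linFunV_ext le_rfl (Q.D_linV_one_mem U ξ) (Q'.D_linV_one_mem U ξ)
    (Q.D_linV_one_mem_degV U ξ) (Q'.D_linV_one_mem_degV U ξ) fun i j => ?_
  have h0 := contractDiff_eq_zero hQ hQ' U hpair (SecPlus.res le_rfl (U.2.ePlus _ j)) ξ
  rw [contractDiff_apply, sub_eq_zero] at h0
  rw [h0]

end Connection

end Uniqueness

end NQ

end

theorem mainTheorem2 {n : ℕ} {M : Type v} [TopologicalSpace M]
    [ChartedSpace (EuclideanSpace ℝ (Fin n)) M] [IsManifold (𝓡 n) ∞ M] [T2Space M]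
    [SecondCountableTopology M] (𝓔 : NQ.NQSymplecticManifold.{u, v} n M)
    (ι : NQ.GeneralizedMetric 𝓔) :
    ∃ Φ : NQ.Connection ι ≃ NQ.CourantConnection ι,
      (∀ (Q : NQ.Connection ι) (C : NQ.CourantConnection ι), Φ Q = C ↔ NQ.IsDual Q C) ∧
      ∀ Q Q' : NQ.Connection ι, NQ.HasInvariantTorsion Q → NQ.HasInvariantTorsion Q' →
        (∀ e u : NQ.SecPlus ι.toBaseInvolution ⊤, (Φ Q).nabla e.1 u = (Φ Q').nabla e.1 u) →
        Q = Q' :=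
  ⟨Equiv.ofBijective NQ.Connection.toCourant ⟨NQ.Connection.toCourant_injective, fun C =>
      C.exists_isDual.imp fun Q hQ => (Q.isDual_iff C).1 hQ⟩,
    fun Q C => (Q.isDual_iff C).symm,
    fun _ _ hQ hQ' h => NQ.Connection.eq_of_hasInvariantTorsion hQ hQ' h⟩
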